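/- Let $N\ge 1$ be an integer and let $K>0$, $\lambda>0$ be real numbers. For a complex matrix $Z$ write $h(Z)=\det(I-Z\overline Z^{t})$, and for a row vector $Z\in\mathbb C^{n}$ write $\beta(Z)=1+|ZZ^{t}|^{2}-2Z\overline Z^{t}$. Consider the classical domains $$R_I(m,n)=\{Z\in\mathbb C^{m\times n}: I-Z\overline Z^{t}>0\},\qquad R_{II}(p)=\{Z\in\mathbb C^{p\times p}: Z^{t}=Z,\ I-Z\overline Z^{t}>0\},$$ $$R_{III}(q)=\{Z\in\mathbb C^{q\times q}: Z^{t}=-Z,\ I-Z\overline Z^{t}>0\},\qquad R_{IV}(n)=\{Z\in\mathbb C^{n}: \beta(Z)>0,\ |ZZ^{t}|<1\},$$ with $m,n,p,q\ge 1$, and the Cartan–Hartogs domains $$Y_{*}=\{(Z,W): Z\in R_{*},\ W\in\mathbb C^{N},\ |W|^{2K}<h_{*}(Z)\},\qquad *\in\{I,II,III,IV\},$$ where $h_{I}=h_{II}=h_{III}=h$ and $h_{IV}=\beta$. On $Y_{*}$ put $$G_\lambda(Z,W)=(1-X)^{-\lambda}\,h_{*}(Z)^{-(\gamma_{*}+N/K)},\qquad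 X=|W|^{2}h_{*}(Z)^{-1/K},$$ with $\gamma_I=m+n$, $\gamma_{II}=p+1$, $\gamma_{III}=q-1$, $\gamma_{IV}=n$. Let $z=(z_1,\dots,z_d)$ be the coordinates on $Y_*$ formed by the independent entries of $Z$ (all $z_{ij}$ for type I, $z_{ij}$ with $i\le j$ for type II, $z_{ij}$ with $i<j$ for type III, all $z_i$ for type IV) and by the entries of $W$, and let $$T=\Bigl(\frac{\partial^{2}\log G_\lambda}{\partial z_i\,\partial\overline z_j}\Bigr)_{i,j}.$$ Theorem. For each of the four types, $G_\lambda$ is positive, $\log G_\lambda$ is smooth and $T$ is positive definite on $Y_{*}$, so that $T$ is the matrix of a Kähler metric $\omega_{G_\lambda}(Y_{*})$; and there are positive constants $a$ and $C$, depending only on $Y_{*}$ (that is, on its type, on the size parameters $m,n$, resp. $p$, $q$, $n$, and on $N$ and $K$) and on $\lambda$, such that the holomorphic sectional curvature of $\omega_{G_\lambda}(Y_{*})$ satisfies $$-a\ \le\ \frac{dz\,\bigl(-\overline d\,dT+dT\,T^{-1}\,\overline{dT}^{t}\bigr)\,\overline{dz}^{t}}{(dz\,T\,\overline{dz}^{t})^{2}}\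 \le\ -C$$ at every point of $Y_{*}$ and for every nonzero direction $dz\in\mathbb C^{d}$, where $dT=\sum_k\frac{\partial T}{\partial z_k}dz_k$ and $\overline d\,dT=\sum_{k,l}\frac{\partial^{2}T}{\partial z_k\partial\overline z_l}dz_k\,d\overline z_l$. -/

import Mathlib

open scoped Matrix ComplexOrder ContDiff

noncomputable section

namespace CartanHartogs

/-! ## Hermitian geometry in coordinates -/

section Geometry

variable {ι : Type} [Fintype ι] [DecidableEq ι]

/-- The Wirtinger derivative `∂f/∂zᵢ = (∂f/∂xᵢ - i ∂f/∂yᵢ) / 2`. -/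
def dz (i : ι) (f : (ι → ℂ) → ℂ) (z : ι → ℂ) : ℂ :=
  (1 / 2 : ℂ) * (fderiv ℝ f z (Pi.single i 1) -
    Complex.I * fderiv ℝ f z (Pi.single i Complex.I))

/-- The Wirtinger derivative `∂f/∂z̄ᵢ = (∂f/∂xᵢ + i ∂f/∂yᵢ) / 2`. -/
def dzbar (i : ι) (f : (ι → ℂ) → ℂ) (z : ι → ℂ) : ℂ :=
  (1 / 2 : ℂ) * (fderiv ℝ f z (Pi.single i 1) +
    Complex.I * fderiv ℝ f z (Pi.single i Complex.I))

/-- The matrix `T = (∂² log G / ∂zᵢ ∂z̄ⱼ)` generated by a positive function `G`. -/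
def metricMatrix (G : (ι → ℂ) → ℝ) (z : ι → ℂ) : Matrix ι ι ℂ :=
  Matrix.of fun i j => dz i (dzbar j fun w => ((Real.log (G w) : ℝ) : ℂ)) z

/-- `dT` evaluated on the tangent vector `v`: the matrix `∑ₖ (∂T/∂zₖ) vₖ`. -/
def dMatrix (T : (ι → ℂ) → Matrix ι ι ℂ) (z v : ι → ℂ) : Matrix ι ι ℂ :=
  Matrix.of fun i j => ∑ k, dz k (fun w => T w i j) z * v k

/-- `d̄dT` evaluated on the tangent vector `v`: the matrix `∑ₖₗ (∂²T/∂zₖ∂z̄ₗ) vₖ v̄ₗ`. -/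
def ddbarMatrix (T : (ι → ℂ) → Matrix ι ι ℂ) (z v : ι → ℂ) : Matrix ι ι ℂ :=
  Matrix.of fun i j =>
    ∑ k, ∑ l, dz k (dzbar l fun w => T w i j) z * v k * star (v l)

/-- The Hermitian form `v A v̄ᵗ` of a matrix `A` on the row vector `v`. -/
def hermForm (A : Matrix ι ι ℂ) (v : ι → ℂ) : ℂ :=
  v ⬝ᵥ (A *ᵥ star v)

/-- The holomorphic sectional curvature, at `z` in the direction `v`, of the Hermitian metric
with matrix `T`: `v (-d̄dT + dT T⁻¹ (dT)ᴴ) v̄ᵗ / (v T v̄ᵗ)²`. Where `T` is a smooth field of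
positive definite Hermitian matrices, this number is real for `v ≠ 0`. -/
def holSecCurvature (T : (ι → ℂ) → Matrix ι ι ℂ) (z v : ι → ℂ) : ℝ :=
  (hermForm (-ddbarMatrix T z v + dMatrix T z v * (T z)⁻¹ * (dMatrix T z v)ᴴ) v /
    hermForm (T z) v ^ 2).re

/-- `G` is positive, `log G` is smooth and `(∂² log G / ∂zᵢ ∂z̄ⱼ)` is positive definite at every
point of `Ω`, so that `G` generates a Kähler metric on `Ω`. -/
def GeneratesMetricOn (G : (ι → ℂ) → ℝ) (Ω : Set (ι → ℂ)) : Prop :=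
  ∀ z ∈ Ω, 0 < G z ∧ ContDiffAt ℝ ∞ (fun w => Real.log (G w)) z ∧ (metricMatrix G z).PosDef

end Geometry

/-! ## The classical domains -/

/-- The classical domain `R_I(m,n)`: complex `m × n` matrices `Z` with `I - Z Z̄ᵗ > 0`. -/
def RI (m n : ℕ) : Set (Matrix (Fin m) (Fin n) ℂ) :=
  {Z | (1 - Z * Zᴴ).PosDef}

/-- The classical domain `R_II(p)`: symmetric `p × p` matrices `Z` with `I - Z Z̄ᵗ > 0`. -/
def RII (p : ℕ) : Set (Matrix (Fin p) (Fin p) ℂ) :=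
  {Z | Zᵀ = Z ∧ (1 - Z * Zᴴ).PosDef}

/-- The classical domain `R_III(q)`: skew-symmetric `q × q` matrices `Z` with `I - Z Z̄ᵗ > 0`. -/
def RIII (q : ℕ) : Set (Matrix (Fin q) (Fin q) ℂ) :=
  {Z | Zᵀ = -Z ∧ (1 - Z * Zᴴ).PosDef}

/-- `det (I - Z Z̄ᵗ)`, which is real because `I - Z Z̄ᵗ` is Hermitian. -/
def detNorm {m n : ℕ} (Z : Matrix (Fin m) (Fin n) ℂ) : ℝ :=
  (1 - Z * Zᴴ).det.re

/-- `β(Z, Z̄) = 1 + |Z Zᵗ|² - 2 Z Z̄ᵗ` for a row vector `Z`. -/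
def betaNorm {n : ℕ} (Z : Fin n → ℂ) : ℝ :=
  1 + ‖∑ i, Z i ^ 2‖ ^ 2 - 2 * ∑ i, ‖Z i‖ ^ 2

/-- The classical domain `R_IV(n)` (Lie ball). -/
def RIV (n : ℕ) : Set (Fin n → ℂ) :=
  {Z | 0 < betaNorm Z ∧ ‖∑ i, Z i ^ 2‖ < 1}

/-! ## Independent coordinates on the matrix spaces -/

/-- The entries `z_{ij}` of an `m × n` matrix as coordinates. -/
abbrev IdxI (m n : ℕ) : Type := Fin m × Fin n

/-- The entries `z_{ij}`, `i ≤ j`, of a symmetric matrix as coordinates. -/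
abbrev IdxII (p : ℕ) : Type := {ij : Fin p × Fin p // ij.1 ≤ ij.2}

/-- The entries `z_{ij}`, `i < j`, of a skew-symmetric matrix as coordinates. -/
abbrev IdxIII (q : ℕ) : Type := {ij : Fin q × Fin q // ij.1 < ij.2}

/-- The `m × n` matrix with the given entries. -/
def matI {m n : ℕ} (ζ : IdxI m n → ℂ) : Matrix (Fin m) (Fin n) ℂ :=
  Matrix.of fun i j => ζ (i, j)

/-- The symmetric matrix with the given entries on and above the diagonal. -/
def matII {p : ℕ} (ζ : IdxII p → ℂ) : Matrix (Fin p) (Fin p) ℂ :=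
  Matrix.of fun i j =>
    if h : i ≤ j then ζ ⟨(i, j), h⟩ else ζ ⟨(j, i), (not_le.mp h).le⟩

/-- The skew-symmetric matrix with the given entries above the diagonal. -/
def matIII {q : ℕ} (ζ : IdxIII q → ℂ) : Matrix (Fin q) (Fin q) ℂ :=
  Matrix.of fun i j =>
    if h : i < j then ζ ⟨(i, j), h⟩ else if h' : j < i then -ζ ⟨(j, i), h'⟩ else 0

/-! ## Cartan-Hartogs domains and the generating functions -/

/-- The `Z` part of a point `z = (Z, W)`. -/
def zPart {κ : Type} {N : ℕ} (z : κ ⊕ Fin N → ℂ) : κ → ℂ := fun k => z (Sum.inl k)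

/-- `|W|²` for a point `z = (Z, W)`. -/
def wNormSq {κ : Type} {N : ℕ} (z : κ ⊕ Fin N → ℂ) : ℝ := ∑ k : Fin N, ‖z (Sum.inr k)‖ ^ 2

/-- `{(Z, W) : Z ∈ D, |W|^{2K} < h(Z)}`, with `W ∈ ℂᴺ`. -/
def hartogs {κ : Type} (N : ℕ) (K : ℝ) (D : Set (κ → ℂ)) (h : (κ → ℂ) → ℝ) :
    Set (κ ⊕ Fin N → ℂ) :=
  {z | zPart z ∈ D ∧ wNormSq z ^ K < h (zPart z)}

/-- `X = |W|² h(Z)^{-1/K}`. -/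
def bigX {κ : Type} (N : ℕ) (K : ℝ) (h : (κ → ℂ) → ℝ) (z : κ ⊕ Fin N → ℂ) : ℝ :=
  wNormSq z * h (zPart z) ^ (-(1 / K))

/-- `G_λ = Y^λ h(Z)^{-(γ + N/K)}` with `Y = (1 - X)⁻¹`. -/
def generator {κ : Type} (N : ℕ) (K lam γ : ℝ) (h : (κ → ℂ) → ℝ) (z : κ ⊕ Fin N → ℂ) : ℝ :=
  ((1 - bigX N K h z)⁻¹) ^ lam * h (zPart z) ^ (-(γ + (N : ℝ) / K))

/-- The Cartan-Hartogs domain `Y_I`. -/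
def YI (m n N : ℕ) (K : ℝ) : Set (IdxI m n ⊕ Fin N → ℂ) :=
  hartogs N K {ζ | matI ζ ∈ RI m n} fun ζ => detNorm (matI ζ)

/-- The Cartan-Hartogs domain `Y_II`. -/
def YII (p N : ℕ) (K : ℝ) : Set (IdxII p ⊕ Fin N → ℂ) :=
  hartogs N K {ζ | matII ζ ∈ RII p} fun ζ => detNorm (matII ζ)

/-- The Cartan-Hartogs domain `Y_III`. -/
def YIII (q N : ℕ) (K : ℝ) : Set (IdxIII q ⊕ Fin N → ℂ) :=
  hartogs N K {ζ | matIII ζ ∈ RIII q} fun ζ => detNorm (matIII ζ)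

/-- The Cartan-Hartogs domain `Y_IV`. -/
def YIV (n N : ℕ) (K : ℝ) : Set (Fin n ⊕ Fin N → ℂ) :=
  hartogs N K (RIV n) betaNorm

/-- `G_λ` on `Y_I`, with exponent `m + n + N/K`. -/
def GI (m n N : ℕ) (K lam : ℝ) : (IdxI m n ⊕ Fin N → ℂ) → ℝ :=
  generator N K lam ((m : ℝ) + n) fun ζ => detNorm (matI ζ)

/-- `G_λ` on `Y_II`, with exponent `p + 1 + N/K`. -/
def GII (p N : ℕ) (K lam : ℝ) : (IdxII p ⊕ Fin N → ℂ) → ℝ :=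
  generator N K lam ((p : ℝ) + 1) fun ζ => detNorm (matII ζ)

/-- `G_λ` on `Y_III`, with exponent `q - 1 + N/K`. -/
def GIII (q N : ℕ) (K lam : ℝ) : (IdxIII q ⊕ Fin N → ℂ) → ℝ :=
  generator N K lam ((q : ℝ) - 1) fun ζ => detNorm (matIII ζ)

/-- `G_λ` on `Y_IV`, with exponent `n + N/K`. -/
def GIV (n N : ℕ) (K lam : ℝ) : (Fin n ⊕ Fin N → ℂ) → ℝ :=
  generator N K lam (n : ℝ) betaNorm

end CartanHartogs

end

/-!
Let `φ = log G_λ`. For a tangent vector `v` at `z`, completing the square in the numerator of the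
holomorphic sectional curvature identifies it with the maximum over `u` of `-∂_s² ∂_s̄² φ(γ(s))` at
`s = 0`, where `γ(s) = z + s v + s² u / 2`. So `φ` is a potential of a metric with curvature in
`[-a, -C]` as soon as, writing `P = ∂_s ∂_s̄ φ(γ(s))`, one has `∂_s² ∂_s̄² φ(γ(s)) ≥ C P²` for every
`u` and `∂_s² ∂_s̄² φ(γ(s)) ≤ a P²` for some `u` (`curvature_bounds`). Only the jets of `φ` along
holomorphic curves modulo `s³` and `s̄³` matter. They live in the ring `ℂ[s, s̄]/(s³, s̄³)`, and
taking jets is a ring homomorphism compatible with exponentials and determinants, so that all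
computations are algebra in that ring. A holomorphic factor and its conjugate multiply `exp (-φ)`
without changing the mixed derivatives of `φ`; normalising by such factors makes the pure terms
vanish, and then the mixed derivatives can be read off (`Jet.neg_log_mixed`). This replaces the
transitive automorphism groups of the domains.

Up to a constant factor in each summand, `φ` is the sum of the fibre potential `-log (1 - X)` and of
the base potential `-log h`. If the base potential satisfies the jet estimates above (`BaseBounds`),
with constants independent of the point, then so does `φ` (`hartogs_curvature`). After
normalisation `X` is `|w|²` times a factor without pure terms. The fibre potential contributes
at least `2 y²` to the fourth-order derivative, where `y` is its second-order derivative, because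
the cross terms with the base are absorbed by changing the acceleration of the base curve
(`fibre_nonneg`). For the other estimate the accelerations in base and fibre are chosen so that the
cross terms and the normalised fibre acceleration vanish.

The estimates on the base are proved type by type. For rectangular matrices, normalisation moves the
curve to one with velocity `V` and acceleration `U` through the origin, for which the fourth-order
derivative of `-log det (I - ZZᴴ)` is `tr UUᴴ + 2 tr (VVᴴ)²` while the second-order one is `tr VVᴴ`
(`detNorm_mixed`). Symmetric and skew-symmetric matrices form linear subspaces containing the
acceleration that makes `U` vanish, so the same estimates hold there (`baseBounds_detNorm`). The Lie
ball is lifted to the cone `x·x = αδ` in the space with the form `2|x|² - |α|² - |δ|²`, which is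
`-β` on the lift `(z, 1, z·z)`. Scaling the lift of a curve so that its derivatives are orthogonal
to its value expresses the jets of `-log β` through this form (`betaNorm_mixed`), and the estimates
follow from its signature (`lieForm_nonneg`).
-/

noncomputable section

namespace CartanHartogs

/-! ### Truncated jets in one variable -/

/-- The truncated polynomial ring `A[s]/(s³)`. The element `⟨a₀, a₁, a₂⟩` stands for
`a₀ + a₁ s + a₂ s²/2`, so that the entries are values of derivatives. -/
@[ext]
structure Jet (A : Type) where
  c0 : A
  c1 : A
  c2 : A

namespace Jet

section Ring

variable {A : Type} [CommRing A]

instance : Zero (Jet A) := ⟨⟨0, 0, 0⟩⟩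
instance : One (Jet A) := ⟨⟨1, 0, 0⟩⟩
instance : Add (Jet A) := ⟨fun x y => ⟨x.c0 + y.c0, x.c1 + y.c1, x.c2 + y.c2⟩⟩
instance : Neg (Jet A) := ⟨fun x => ⟨-x.c0, -x.c1, -x.c2⟩⟩
instance : Sub (Jet A) := ⟨fun x y => ⟨x.c0 - y.c0, x.c1 - y.c1, x.c2 - y.c2⟩⟩
instance : Mul (Jet A) :=
  ⟨fun x y => ⟨x.c0 * y.c0, x.c0 * y.c1 + x.c1 * y.c0,
    x.c0 * y.c2 + 2 * (x.c1 * y.c1) + x.c2 * y.c0⟩⟩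

@[simp] lemma zero_c0 : (0 : Jet A).c0 = 0 := rfl
@[simp] lemma zero_c1 : (0 : Jet A).c1 = 0 := rfl
@[simp] lemma zero_c2 : (0 : Jet A).c2 = 0 := rfl
@[simp] lemma one_c0 : (1 : Jet A).c0 = 1 := rfl
@[simp] lemma one_c1 : (1 : Jet A).c1 = 0 := rfl
@[simp] lemma one_c2 : (1 : Jet A).c2 = 0 := rfl
@[simp] lemma add_c0 (x y : Jet A) : (x + y).c0 = x.c0 + y.c0 := rfl
@[simp] lemma add_c1 (x y : Jet A) : (x + y).c1 = x.c1 + y.c1 := rfl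
@[simp] lemma add_c2 (x y : Jet A) : (x + y).c2 = x.c2 + y.c2 := rfl
@[simp] lemma neg_c0 (x : Jet A) : (-x).c0 = -x.c0 := rfl
@[simp] lemma neg_c1 (x : Jet A) : (-x).c1 = -x.c1 := rfl
@[simp] lemma neg_c2 (x : Jet A) : (-x).c2 = -x.c2 := rfl
@[simp] lemma sub_c0 (x y : Jet A) : (x - y).c0 = x.c0 - y.c0 := rfl
@[simp] lemma sub_c1 (x y : Jet A) : (x - y).c1 = x.c1 - y.c1 := rfl
@[simp] lemma sub_c2 (x y : Jet A) : (x - y).c2 = x.c2 - y.c2 := rfl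
@[simp] lemma mul_c0 (x y : Jet A) : (x * y).c0 = x.c0 * y.c0 := rfl
@[simp] lemma mul_c1 (x y : Jet A) : (x * y).c1 = x.c0 * y.c1 + x.c1 * y.c0 := rfl
@[simp] lemma mul_c2 (x y : Jet A) :
    (x * y).c2 = x.c0 * y.c2 + 2 * (x.c1 * y.c1) + x.c2 * y.c0 := rfl

instance : CommRing (Jet A) where
  add_assoc x y z := by ext <;> simp [add_assoc]
  zero_add x := by ext <;> simp
  add_zero x := by ext <;> simp
  add_comm x y := by ext <;> simp [add_comm]
  mul_assoc x y z := by ext <;> simp <;> ring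
  one_mul x := by ext <;> simp
  mul_one x := by ext <;> simp
  left_distrib x y z := by ext <;> simp <;> ring
  right_distrib x y z := by ext <;> simp <;> ring
  mul_comm x y := by ext <;> simp <;> ring
  zero_mul x := by ext <;> simp
  mul_zero x := by ext <;> simp
  neg_add_cancel x := by ext <;> simp
  sub_eq_add_neg x y := by ext <;> simp [sub_eq_add_neg]
  nsmul := nsmulRec
  zsmul := zsmulRec

/-- The constant jets. -/
@[simps]
def const : A →+* Jet A where
  toFun a := ⟨a, 0, 0⟩
  map_one' := rfl
  map_zero' := rfl
  map_add' x y := by ext <;> simp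
  map_mul' x y := by ext <;> simp

@[simp] lemma two_c0 : (2 : Jet A).c0 = 2 := by
  rw [show (2 : Jet A) = const 2 from (map_ofNat const 2).symm]; rfl
@[simp] lemma two_c1 : (2 : Jet A).c1 = 0 := by
  rw [show (2 : Jet A) = const 2 from (map_ofNat const 2).symm]; rfl
@[simp] lemma two_c2 : (2 : Jet A).c2 = 0 := by
  rw [show (2 : Jet A) = const 2 from (map_ofNat const 2).symm]; rfl

@[simp] lemma sum_c0 {κ : Type} (s : Finset κ) (f : κ → Jet A) :
    (∑ i ∈ s, f i).c0 = ∑ i ∈ s, (f i).c0 := by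
  classical
  induction s using Finset.induction_on with
  | empty => simp
  | insert a s ha ih => simp [Finset.sum_insert ha, ih]
@[simp] lemma sum_c1 {κ : Type} (s : Finset κ) (f : κ → Jet A) :
    (∑ i ∈ s, f i).c1 = ∑ i ∈ s, (f i).c1 := by
  classical
  induction s using Finset.induction_on with
  | empty => simp
  | insert a s ha ih => simp [Finset.sum_insert ha, ih]
@[simp] lemma sum_c2 {κ : Type} (s : Finset κ) (f : κ → Jet A) :
    (∑ i ∈ s, f i).c2 = ∑ i ∈ s, (f i).c2 := by
  classical
  induction s using Finset.induction_on with
  | empty => simp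
  | insert a s ha ih => simp [Finset.sum_insert ha, ih]

end Ring

/-- Two-sided jets: elements of `ℂ[s, s̄]/(s³, s̄³)`. The outer index counts `s̄`, the inner one
`s`, so `H.c1.c2` is the `∂² ∂̄`-derivative. -/
abbrev Jet2 : Type := Jet (Jet ℂ)

/-- The jet of a holomorphic function as a two-sided jet. -/
abbrev hol : Jet ℂ →+* Jet2 := const

/-- The complex conjugate of a holomorphic jet as a two-sided jet. -/
@[simps]
def ahol : Jet ℂ →+* Jet2 where
  toFun a := ⟨const (star a.c0), const (star a.c1), const (star a.c2)⟩
  map_one' := by ext <;> simp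
  map_zero' := by ext <;> simp
  map_add' x y := by ext <;> simp
  map_mul' x y := by ext <;> simp

/-- The exponential of a jet whose constant term has exponential `e`. -/
def expWith {A : Type} [CommRing A] (e : A) (a : Jet A) : Jet A :=
  ⟨e, e * a.c1, e * (a.c2 + a.c1 * a.c1)⟩

/-- The exponential on two-sided jets. -/
def exp (a : Jet2) : Jet2 := expWith (expWith (Complex.exp a.c0.c0) a.c0) a

end Jet

/-! ### Directional Wirtinger derivatives and jets of smooth functions -/

section Calculus

open Filter Topology

set_option linter.unusedSectionVars false

variable {ι : Type} [Fintype ι]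

/-- The directional Wirtinger derivative: `∂_v f = ∑ vᵢ ∂f/∂zᵢ` for `σ = 1` and
`∂̄_v f = ∑ v̄ᵢ ∂f/∂z̄ᵢ` for `σ = -1`. -/
def wd (σ : ℝ) (v : ι → ℂ) (f : (ι → ℂ) → ℂ) (z : ι → ℂ) : ℂ :=
  (1 / 2 : ℂ) * (fderiv ℝ f z v - σ * (Complex.I * fderiv ℝ f z (Complex.I • v)))

variable {σ τ : ℝ} {v w u : ι → ℂ} {f g : (ι → ℂ) → ℂ} {z : ι → ℂ}

/-- A function that is smooth at `z`. -/
abbrev SmoothAt (f : (ι → ℂ) → ℂ) (z : ι → ℂ) : Prop := ContDiffAt ℝ ∞ f z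

lemma smoothAt_add (hf : SmoothAt f z) (hg : SmoothAt g z) : SmoothAt (f + g) z :=
  ContDiffAt.add hf hg

lemma smoothAt_mul (hf : SmoothAt f z) (hg : SmoothAt g z) : SmoothAt (f * g) z :=
  ContDiffAt.mul hf hg

lemma SmoothAt.eventually_differentiableAt (hf : SmoothAt f z) :
    ∀ᶠ y in 𝓝 z, DifferentiableAt ℝ f y := by
  have h1 : ContDiffAt ℝ 1 f z := hf.of_le (by exact_mod_cast le_top)
  filter_upwards [h1.eventually (by simp)] with y hy
  exact hy.differentiableAt (by simp)

lemma SmoothAt.fderiv_apply (hf : SmoothAt f z) (v : ι → ℂ) :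
    SmoothAt (fun y => fderiv ℝ f y v) z := by
  have h : ContDiffAt ℝ ∞ (fderiv ℝ f) z := ContDiffAt.fderiv_right hf (by simp)
  exact h.clm_apply contDiffAt_const

lemma smoothAt_wd (hf : SmoothAt f z) : SmoothAt (wd σ v f) z := by
  unfold wd
  exact contDiffAt_const.mul ((hf.fderiv_apply v).sub
    (contDiffAt_const.mul (contDiffAt_const.mul (hf.fderiv_apply _))))

lemma wd_congr (h : f =ᶠ[𝓝 z] g) : wd σ v f =ᶠ[𝓝 z] wd σ v g := by
  filter_upwards [h.fderiv (𝕜 := ℝ)] with y hy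
  simp only [wd, hy]

lemma wd_add (hf : SmoothAt f z) (hg : SmoothAt g z) :
    wd σ v (f + g) =ᶠ[𝓝 z] wd σ v f + wd σ v g := by
  filter_upwards [hf.eventually_differentiableAt, hg.eventually_differentiableAt] with y h1 h2
  simp only [wd, fderiv_add h1 h2, Pi.add_apply, add_apply]
  ring

lemma wd_mul (hf : SmoothAt f z) (hg : SmoothAt g z) :
    wd σ v (f * g) =ᶠ[𝓝 z] wd σ v f * g + f * wd σ v g := by
  filter_upwards [hf.eventually_differentiableAt, hg.eventually_differentiableAt] with y h1 h2
  simp only [wd, fderiv_mul h1 h2, Pi.add_apply, Pi.mul_apply, add_apply,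
    smul_apply, smul_eq_mul]
  ring

lemma wd_const (c : ℂ) : wd σ v (fun _ => c) = (0 : (ι → ℂ) → ℂ) := by
  ext y; simp [wd]

lemma wd_const_mul (c : ℂ) (hf : SmoothAt f z) :
    wd σ v (fun y => c * f y) =ᶠ[𝓝 z] fun y => c * wd σ v f y := by
  filter_upwards [hf.eventually_differentiableAt] with y h1
  simp only [wd, fderiv_const_mul h1, smul_apply, smul_eq_mul]
  ring

lemma wd_exp (hf : SmoothAt f z) :
    wd σ v (fun y => Complex.exp (f y)) =ᶠ[𝓝 z] (fun y => Complex.exp (f y)) * wd σ v f := by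
  filter_upwards [hf.eventually_differentiableAt] with y h1
  have h2 := (h1.hasFDerivAt.cexp).fderiv
  simp only [wd, h2, smul_apply, smul_eq_mul, Pi.mul_apply]
  ring

lemma wd_star (f : (ι → ℂ) → ℂ) (z : ι → ℂ) :
    wd σ v (fun y => star (f y)) z = star (wd (-σ) v f z) := by
  have h : fderiv ℝ (fun y => star (f y)) z
      = (Complex.conjCLE : ℂ →L[ℝ] ℂ).comp (fderiv ℝ f z) := Complex.conjCLE.comp_fderiv
  simp only [wd, h, ContinuousLinearMap.comp_apply]
  simp [sub_eq_add_neg]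

lemma wd_clm (L : (ι → ℂ) →L[ℂ] ℂ) (z : ι → ℂ) :
    wd σ v L z = (1 / 2 : ℂ) * (1 + σ) * L v := by
  have h : fderiv ℝ L z = L.restrictScalars ℝ := (L.restrictScalars ℝ).fderiv
  simp only [wd, h, ContinuousLinearMap.coe_restrictScalars', map_smul, smul_eq_mul]
  linear_combination (-1 / 2 * σ * L v) * Complex.I_mul_I

lemma fderiv_wd (hf : ContDiffAt ℝ 2 f z) (x : ι → ℂ) :
    fderiv ℝ (wd σ v f) z x = (1 / 2 : ℂ) * (fderiv ℝ (fderiv ℝ f) z x v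
      - σ * (Complex.I * fderiv ℝ (fderiv ℝ f) z x (Complex.I • v))) := by
  have hd : DifferentiableAt ℝ (fderiv ℝ f) z :=
    (ContDiffAt.fderiv_right (m := 1) hf (by norm_num)).differentiableAt (by simp)
  have key : ∀ a : ι → ℂ, HasFDerivAt (fun y => fderiv ℝ f y a)
      ((fderiv ℝ (fderiv ℝ f) z).flip a) z := fun a => by
    simpa using hd.hasFDerivAt.clm_apply (hasFDerivAt_const a z)
  have h := (((key v).sub (((key (Complex.I • v)).const_mul Complex.I).const_mul
    (σ : ℂ))).const_mul (1 / 2 : ℂ)).fderiv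
  have h' : fderiv ℝ (wd σ v f) z = _ := h
  rw [h']
  simp

/-- Directional Wirtinger derivatives commute. -/
lemma wd_comm (hf : ContDiffAt ℝ 2 f z) : wd σ v (wd τ w f) z = wd τ w (wd σ v f) z := by
  have hs : IsSymmSndFDerivAt ℝ f z := ContDiffAt.isSymmSndFDerivAt hf (by simp)
  conv_lhs => rw [wd]
  conv_rhs => rw [wd]
  simp only [fderiv_wd hf]
  rw [hs.eq v w, hs.eq (Complex.I • v) w, hs.eq v (Complex.I • w),
    hs.eq (Complex.I • v) (Complex.I • w)]
  ring

lemma SmoothAt.contDiffAt_two (hf : SmoothAt f z) : ContDiffAt ℝ 2 f z :=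
  hf.of_le (show ((2 : ℕ∞) : WithTop ℕ∞) ≤ ∞ from mod_cast le_top)

lemma SmoothAt.eventually_wd_comm (hf : SmoothAt f z) :
    wd σ v (wd τ w f) =ᶠ[𝓝 z] wd τ w (wd σ v f) := by
  filter_upwards [hf.contDiffAt_two.eventually (by simp)] with y hy
  exact wd_comm hy

/-- The second derivative along the curve `s ↦ z + s v + s² u / 2`, expressed through Wirtinger
derivatives at `z`. -/
def wd2 (σ : ℝ) (v u : ι → ℂ) (f : (ι → ℂ) → ℂ) : (ι → ℂ) → ℂ :=
  wd σ v (wd σ v f) + wd σ u f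

lemma smoothAt_wd2 (hf : SmoothAt f z) : SmoothAt (wd2 σ v u f) z :=
  ContDiffAt.add (smoothAt_wd (smoothAt_wd hf)) (smoothAt_wd hf)

lemma wd2_congr (h : f =ᶠ[𝓝 z] g) : wd2 σ v u f =ᶠ[𝓝 z] wd2 σ v u g :=
  (wd_congr (wd_congr h)).add (wd_congr h)

lemma wd2_add (hf : SmoothAt f z) (hg : SmoothAt g z) :
    wd2 σ v u (f + g) =ᶠ[𝓝 z] wd2 σ v u f + wd2 σ v u g := by
  have h1 := (wd_congr (σ := σ) (v := v) (wd_add (σ := σ) (v := v) hf hg)).trans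
    (wd_add (smoothAt_wd hf) (smoothAt_wd hg))
  have h2 := wd_add (σ := σ) (v := u) hf hg
  filter_upwards [h1, h2] with y h1 h2
  simp only [wd2, Pi.add_apply] at *
  rw [h1, h2]; ring

lemma wd2_mul (hf : SmoothAt f z) (hg : SmoothAt g z) :
    wd2 σ v u (f * g) =ᶠ[𝓝 z]
      f * wd2 σ v u g + 2 * (wd σ v f * wd σ v g) + wd2 σ v u f * g := by
  have h1 := (wd_congr (σ := σ) (v := v) (wd_mul (σ := σ) (v := v) hf hg)).trans
    (wd_add (ContDiffAt.mul (smoothAt_wd hf) hg) (ContDiffAt.mul hf (smoothAt_wd hg)))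
  have h2 := wd_mul (σ := σ) (v := u) hf hg
  have h3 := wd_mul (σ := σ) (v := v) (smoothAt_wd (σ := σ) (v := v) hf) hg
  have h4 := wd_mul (σ := σ) (v := v) hf (smoothAt_wd (σ := σ) (v := v) hg)
  filter_upwards [h1, h2, h3, h4] with y h1 h2 h3 h4
  simp only [wd2, Pi.add_apply, Pi.mul_apply, Pi.ofNat_apply] at *
  rw [h1, h2, h3, h4]; ring

lemma wd2_const (c : ℂ) : wd2 σ v u (fun _ => c) = (0 : (ι → ℂ) → ℂ) := by
  have : wd σ v (0 : (ι → ℂ) → ℂ) = 0 := wd_const 0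
  rw [wd2, wd_const, wd_const, this, add_zero]

lemma wd2_exp (hf : SmoothAt f z) :
    wd2 σ v u (fun y => Complex.exp (f y)) =ᶠ[𝓝 z]
      (fun y => Complex.exp (f y)) * (wd2 σ v u f + wd σ v f * wd σ v f) := by
  have he : SmoothAt (fun y => Complex.exp (f y)) z := ContDiffAt.cexp hf
  have h1 := (wd_congr (σ := σ) (v := v) (wd_exp (σ := σ) (v := v) hf)).trans
    (wd_mul he (smoothAt_wd hf))
  filter_upwards [h1, wd_exp (σ := σ) (v := v) hf, wd_exp (σ := σ) (v := u) hf] with y h1 h2 h3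
  simp only [wd2, Pi.add_apply, Pi.mul_apply] at *
  rw [h1, h2, h3]; ring

lemma wd2_star (f : (ι → ℂ) → ℂ) (z : ι → ℂ) :
    wd2 σ v u (fun y => star (f y)) z = star (wd2 (-σ) v u f z) := by
  have h : wd σ v (fun y => star (f y)) = fun y => star (wd (-σ) v f y) := funext (wd_star f)
  simp only [wd2, Pi.add_apply, h, wd_star, star_add]

/-- The holomorphic part of the jet of `f` along the curve `s ↦ z + s v + s² u / 2`. -/
def hjet (v u : ι → ℂ) (f : (ι → ℂ) → ℂ) (z : ι → ℂ) : Jet ℂ :=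
  ⟨f z, wd 1 v f z, wd2 1 v u f z⟩

/-- The jet at `s = 0`, modulo `s³` and `s̄³`, of `f` along the holomorphic curve
`s ↦ z + s v + s² u / 2`. -/
def jet (v u : ι → ℂ) (f : (ι → ℂ) → ℂ) (z : ι → ℂ) : Jet.Jet2 :=
  ⟨hjet v u f z, hjet v u (wd (-1) v f) z, hjet v u (wd2 (-1) v u f) z⟩

lemma hjet_congr (h : f =ᶠ[𝓝 z] g) : hjet v u f z = hjet v u g z := by
  simp only [hjet, h.eq_of_nhds, (wd_congr h).eq_of_nhds, (wd2_congr h).eq_of_nhds]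

lemma jet_congr (h : f =ᶠ[𝓝 z] g) : jet v u f z = jet v u g z := by
  simp only [jet, hjet_congr h, hjet_congr (wd_congr h), hjet_congr (wd2_congr h)]

lemma hjet_add (hf : SmoothAt f z) (hg : SmoothAt g z) :
    hjet v u (f + g) z = hjet v u f z + hjet v u g z := by
  ext
  · rfl
  · exact (wd_add hf hg).eq_of_nhds
  · exact (wd2_add hf hg).eq_of_nhds

lemma hjet_mul (hf : SmoothAt f z) (hg : SmoothAt g z) :
    hjet v u (f * g) z = hjet v u f z * hjet v u g z := by
  ext
  · rfl
  · exact (wd_mul hf hg).eq_of_nhds.trans (add_comm _ _)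
  · exact (wd2_mul hf hg).eq_of_nhds

lemma hjet_const (c : ℂ) : hjet v u (fun _ => c) z = Jet.const c := by
  ext <;> simp [hjet, wd_const, wd2_const]

lemma jet_add (hf : SmoothAt f z) (hg : SmoothAt g z) :
    jet v u (f + g) z = jet v u f z + jet v u g z := by
  apply Jet.ext
  · exact hjet_add hf hg
  · exact (hjet_congr (wd_add hf hg)).trans (hjet_add (smoothAt_wd hf) (smoothAt_wd hg))
  · exact (hjet_congr (wd2_add hf hg)).trans (hjet_add (smoothAt_wd2 hf) (smoothAt_wd2 hg))

lemma jet_mul (hf : SmoothAt f z) (hg : SmoothAt g z) :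
    jet v u (f * g) z = jet v u f z * jet v u g z := by
  apply Jet.ext
  · exact hjet_mul hf hg
  · refine (hjet_congr (wd_mul hf hg)).trans ?_
    rw [hjet_add (smoothAt_mul (smoothAt_wd hf) hg) (smoothAt_mul hf (smoothAt_wd hg)),
      hjet_mul (smoothAt_wd hf) hg, hjet_mul hf (smoothAt_wd hg), add_comm]
    rfl
  · refine (hjet_congr (wd2_mul hf hg)).trans ?_
    have h2 : SmoothAt (2 : (ι → ℂ) → ℂ) z := contDiffAt_const
    have hh : SmoothAt (wd (-1) v f * wd (-1) v g) z :=
      smoothAt_mul (smoothAt_wd hf) (smoothAt_wd hg)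
    rw [hjet_add (smoothAt_add (smoothAt_mul hf (smoothAt_wd2 hg)) (smoothAt_mul h2 hh))
        (smoothAt_mul (smoothAt_wd2 hf) hg),
      hjet_add (smoothAt_mul hf (smoothAt_wd2 hg)) (smoothAt_mul h2 hh),
      hjet_mul hf (smoothAt_wd2 hg), hjet_mul h2 hh, hjet_mul (smoothAt_wd2 hf) hg,
      hjet_mul (smoothAt_wd hf) (smoothAt_wd hg),
      show hjet v u (2 : (ι → ℂ) → ℂ) z = 2 from (hjet_const 2).trans (map_ofNat Jet.const 2)]
    rfl

lemma jet_const (c : ℂ) : jet v u (fun _ => c) z = Jet.const (Jet.const c) := by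
  have h0 : hjet v u (0 : (ι → ℂ) → ℂ) z = 0 := (hjet_const 0).trans (map_zero _)
  apply Jet.ext
  · exact hjet_const c
  · simp only [jet, wd_const, h0, Jet.const_apply_c1]
  · simp only [jet, wd2_const, h0, Jet.const_apply_c2]

lemma jet_const_mul (c : ℂ) (hf : SmoothAt f z) :
    jet v u (fun y => c * f y) z = Jet.const (Jet.const c) * jet v u f z := by
  rw [← jet_const (v := v) (u := u) (z := z), ← jet_mul contDiffAt_const hf]
  rfl

lemma hjet_exp (hf : SmoothAt f z) :
    hjet v u (fun y => Complex.exp (f y)) z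
      = Jet.expWith (Complex.exp (f z)) (hjet v u f z) := by
  ext
  · rfl
  · exact (wd_exp hf).eq_of_nhds
  · refine (wd2_exp hf).eq_of_nhds.trans ?_
    simp [Jet.expWith, hjet]

lemma jet_exp (hf : SmoothAt f z) :
    jet v u (fun y => Complex.exp (f y)) z = Jet.exp (jet v u f z) := by
  have he : SmoothAt (fun y => Complex.exp (f y)) z := ContDiffAt.cexp hf
  apply Jet.ext
  · exact hjet_exp hf
  · refine (hjet_congr (wd_exp hf)).trans ?_
    rw [hjet_mul he (smoothAt_wd hf), hjet_exp hf]
    rfl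
  · refine (hjet_congr (wd2_exp hf)).trans ?_
    have hm : SmoothAt (wd (-1) v f * wd (-1) v f) z :=
      smoothAt_mul (smoothAt_wd hf) (smoothAt_wd hf)
    rw [hjet_mul he (smoothAt_add (smoothAt_wd2 hf) hm), hjet_exp hf,
      hjet_add (smoothAt_wd2 hf) hm, hjet_mul (smoothAt_wd hf) (smoothAt_wd hf)]
    rfl

/-- The jet of a continuous linear coordinate is holomorphic. -/
lemma jet_clm (L : (ι → ℂ) →L[ℂ] ℂ) :
    jet v u L z = Jet.hol ⟨L z, L v, L u⟩ := by
  have h1 (x : ι → ℂ) : wd 1 x L = fun _ => L x := funext fun y => by rw [wd_clm]; norm_num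
  have h2 (x : ι → ℂ) : wd (-1) x L = fun _ => 0 := funext fun y => by rw [wd_clm]; norm_num
  have h0 : hjet v u (fun _ => (0 : ℂ)) z = 0 := (hjet_const 0).trans (map_zero _)
  apply Jet.ext
  · ext <;> simp [jet, hjet, wd2, h1, wd_const]
  · simp [jet, h2, h0]
  · have h3 : wd2 (-1) v u L = fun _ => 0 := by
      simp only [wd2, h2, wd_const, zero_add]
    simp [jet, h3, h0]

lemma jet_star_clm (L : (ι → ℂ) →L[ℂ] ℂ) :
    jet v u (fun y => star (L y)) z = Jet.ahol ⟨L z, L v, L u⟩ := by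
  have h1 (x : ι → ℂ) : wd (-1) x (fun y => star (L y)) = fun _ => star (L x) :=
    funext fun y => by rw [wd_star, wd_clm]; norm_num
  have h2 (x : ι → ℂ) : wd 1 x (fun y => star (L y)) = fun _ => 0 :=
    funext fun y => by rw [wd_star, wd_clm]; norm_num
  have h3 : wd2 (-1) v u (fun y => star (L y)) = fun _ => star (L u) := by
    ext y
    simp only [wd2, h1, wd_const, zero_add]
  apply Jet.ext
  · apply Jet.ext
    · rfl
    · exact congrFun (h2 v) z
    · simp only [jet, hjet, wd2, h2, wd_const]
      exact add_zero (0 : ℂ)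
  · simp only [jet, h1, hjet_const]
    rfl
  · simp only [jet, h3, hjet_const]
    rfl

lemma jet_sum {κ : Type} (s : Finset κ) (F : κ → (ι → ℂ) → ℂ) (hF : ∀ i ∈ s, SmoothAt (F i) z) :
    jet v u (fun y => ∑ i ∈ s, F i y) z = ∑ i ∈ s, jet v u (F i) z := by
  classical
  induction s using Finset.induction_on with
  | empty => simpa using jet_const (v := v) (u := u) (z := z) 0
  | insert a s ha ih =>
    simp only [Finset.sum_insert ha]
    rw [← ih fun i hi => hF i (Finset.mem_insert_of_mem hi)]
    exact jet_add (hF a (Finset.mem_insert_self a s))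
      (ContDiffAt.sum fun i hi => hF i (Finset.mem_insert_of_mem hi))

lemma jet_prod {κ : Type} (s : Finset κ) (F : κ → (ι → ℂ) → ℂ) (hF : ∀ i ∈ s, SmoothAt (F i) z) :
    jet v u (fun y => ∏ i ∈ s, F i y) z = ∏ i ∈ s, jet v u (F i) z := by
  classical
  induction s using Finset.induction_on with
  | empty => simpa using jet_const (v := v) (u := u) (z := z) 1
  | insert a s ha ih =>
    simp only [Finset.prod_insert ha]
    rw [← ih fun i hi => hF i (Finset.mem_insert_of_mem hi)]
    exact jet_mul (hF a (Finset.mem_insert_self a s))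
      (contDiffAt_prod fun i hi => hF i (Finset.mem_insert_of_mem hi))

lemma smoothAt_det {m : ℕ} (M : (ι → ℂ) → Matrix (Fin m) (Fin m) ℂ)
    (hM : ∀ i j, SmoothAt (fun y => M y i j) z) : SmoothAt (fun y => (M y).det) z := by
  simp only [Matrix.det_apply']
  exact ContDiffAt.sum fun p _ => contDiffAt_const.mul
    (contDiffAt_prod fun i _ => hM _ _)

/-- Taking jets is a ring homomorphism, hence commutes with determinants. -/
lemma jet_det {m : ℕ} (M : (ι → ℂ) → Matrix (Fin m) (Fin m) ℂ)
    (hM : ∀ i j, SmoothAt (fun y => M y i j) z) :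
    jet v u (fun y => (M y).det) z
      = (Matrix.of fun i j => jet v u (fun y => M y i j) z).det := by
  simp only [Matrix.det_apply']
  rw [jet_sum _ _ fun p _ => contDiffAt_const.mul (contDiffAt_prod fun i _ => hM _ _)]
  refine Finset.sum_congr rfl fun p _ => ?_
  rw [jet_const_mul _ (contDiffAt_prod fun i _ => hM _ _), jet_prod _ _ fun i _ => hM _ _]
  simp

/-- The jet of a function pulled back by a linear map is a jet along the image curve. -/
lemma jet_comp_clm {κ : Type} [Fintype κ] (L : (ι → ℂ) →L[ℂ] (κ → ℂ)) {φ : (κ → ℂ) → ℂ}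
    (hφ : SmoothAt φ (L z)) :
    jet v u (fun y => φ (L y)) z = jet (L v) (L u) φ (L z) := by
  have key : ∀ (σ : ℝ) (v : ι → ℂ) (φ : (κ → ℂ) → ℂ), SmoothAt φ (L z) →
      wd σ v (fun y => φ (L y)) =ᶠ[𝓝 z] fun y => wd σ (L v) φ (L y) := by
    intro σ v φ hφ
    filter_upwards [L.continuous.continuousAt.eventually hφ.eventually_differentiableAt] with y hy
    have := (hy.hasFDerivAt.comp y (L.restrictScalars ℝ).hasFDerivAt).fderiv
    have h' : fderiv ℝ (fun y => φ (L y)) y = _ := this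
    simp [wd, h']
  have key2 : ∀ (σ : ℝ) (φ : (κ → ℂ) → ℂ), SmoothAt φ (L z) →
      wd2 σ v u (fun y => φ (L y)) =ᶠ[𝓝 z] fun y => wd2 σ (L v) (L u) φ (L y) := by
    intro σ φ hφ
    exact ((wd_congr (key σ v φ hφ)).trans (key σ v _ (smoothAt_wd hφ))).add (key σ u φ hφ)
  have hj : ∀ φ : (κ → ℂ) → ℂ, SmoothAt φ (L z) →
      hjet v u (fun y => φ (L y)) z = hjet (L v) (L u) φ (L z) := by
    intro φ hφ
    simp only [hjet, (key 1 v φ hφ).eq_of_nhds, (key2 1 φ hφ).eq_of_nhds]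
  apply Jet.ext
  · exact hj φ hφ
  · exact (hjet_congr (key (-1) v φ hφ)).trans (hj _ (smoothAt_wd hφ))
  · exact (hjet_congr (key2 (-1) φ hφ)).trans (hj _ (smoothAt_wd2 hφ))

end Calculus

/-! ### Curvature as an extremal value over second-order jets of curves -/

section Curvature

open Filter Topology

set_option linter.unusedSectionVars false

variable {ι : Type} [Fintype ι] [DecidableEq ι]
variable {σ τ : ℝ} {v w u : ι → ℂ} {f g : (ι → ℂ) → ℂ} {z : ι → ℂ}

lemma wd_sum {κ : Type} (s : Finset κ) (c : κ → ℂ) (F : κ → (ι → ℂ) → ℂ)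
    (hF : ∀ i ∈ s, SmoothAt (F i) z) :
    wd σ v (fun y => ∑ i ∈ s, c i * F i y) =ᶠ[𝓝 z] fun y => ∑ i ∈ s, c i * wd σ v (F i) y := by
  have : ∀ᶠ y in 𝓝 z, ∀ i ∈ s, DifferentiableAt ℝ (F i) y := by
    rw [eventually_all_finset]
    exact fun i hi => (hF i hi).eventually_differentiableAt
  filter_upwards [this] with y hy
  have h := (HasFDerivAt.fun_sum fun i hi => ((hy i hi).hasFDerivAt.const_mul (c i))).fderiv
  simp only [wd, h, sum_apply, smul_apply, smul_eq_mul, Finset.mul_sum, ← Finset.sum_sub_distrib]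
  exact Finset.sum_congr rfl fun i _ => by ring

lemma wd_eq_sum (σ : ℝ) (hσ : σ = 1 ∨ σ = -1) (v : ι → ℂ) (f : (ι → ℂ) → ℂ) (z : ι → ℂ) :
    wd σ v f z = ∑ i, ((v i).re + σ * (v i).im * Complex.I) * wd σ (Pi.single i 1) f z := by
  have hv : v = ∑ i, ((v i).re • (Pi.single i 1 : ι → ℂ)
      + (v i).im • (Pi.single i Complex.I : ι → ℂ)) := by
    ext j
    simp only [Finset.sum_apply, Pi.add_apply, Pi.smul_apply, Pi.single_apply]
    rw [Finset.sum_eq_single j (fun b _ hb => by simp [hb.symm]) (by simp)]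
    simp [Complex.re_add_im]
  have hIv : Complex.I • v = ∑ i, ((v i).re • (Pi.single i Complex.I : ι → ℂ)
      - (v i).im • (Pi.single i 1 : ι → ℂ)) := by
    ext j
    simp only [Finset.sum_apply, Pi.sub_apply, Pi.smul_apply, Pi.single_apply]
    rw [Finset.sum_eq_single j (fun b _ hb => by simp [hb.symm]) (by simp)]
    apply Complex.ext <;> simp
  have hI : ∀ i : ι, Complex.I • (Pi.single i 1 : ι → ℂ) = Pi.single i Complex.I := fun i => by
    rw [← Pi.single_smul]; simp
  simp only [wd, hI]
  conv_lhs => rw [hIv]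
  conv_lhs => enter [2, 1]; rw [hv]
  simp only [map_sum, map_add, map_sub, map_smul, Complex.real_smul, Finset.mul_sum,
    ← Finset.sum_sub_distrib]
  refine Finset.sum_congr rfl fun i _ => ?_
  have h1 := Complex.I_mul_I
  rcases hσ with rfl | rfl
  · push_cast
    linear_combination ((1/2 : ℂ) * ((v i).im : ℂ) * fderiv ℝ f z (Pi.single i Complex.I)) * h1
  · push_cast
    linear_combination ((1/2 : ℂ) * ((v i).im : ℂ) * fderiv ℝ f z (Pi.single i Complex.I)) * h1

lemma dz_eq_wd (i : ι) : dz i f z = wd 1 (Pi.single i 1) f z := by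
  have hI : Complex.I • (Pi.single i 1 : ι → ℂ) = Pi.single i Complex.I := by
    rw [← Pi.single_smul]; simp
  simp [dz, wd, hI]

lemma dzbar_eq_wd (i : ι) : dzbar i f z = wd (-1) (Pi.single i 1) f z := by
  have hI : Complex.I • (Pi.single i 1 : ι → ℂ) = Pi.single i Complex.I := by
    rw [← Pi.single_smul]; simp
  simp [dzbar, wd, hI]

lemma wd_one_eq_sum (v : ι → ℂ) (f : (ι → ℂ) → ℂ) :
    wd 1 v f = fun y => ∑ i, v i * dz i f y := by
  ext y
  rw [wd_eq_sum 1 (Or.inl rfl)]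
  refine Finset.sum_congr rfl fun i _ => ?_
  rw [dz_eq_wd]
  simp [Complex.re_add_im]

lemma wd_neg_one_eq_sum (v : ι → ℂ) (f : (ι → ℂ) → ℂ) :
    wd (-1) v f = fun y => ∑ i, star (v i) * dzbar i f y := by
  ext y
  rw [wd_eq_sum (-1) (Or.inr rfl)]
  refine Finset.sum_congr rfl fun i _ => ?_
  rw [dzbar_eq_wd]
  congr 1
  apply Complex.ext <;> simp

lemma smoothAt_dz (hf : SmoothAt f z) (i : ι) : SmoothAt (dz i f) z := by
  rw [show dz i f = wd 1 (Pi.single i 1) f from funext fun y => dz_eq_wd i]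
  exact smoothAt_wd hf

lemma smoothAt_dzbar (hf : SmoothAt f z) (i : ι) : SmoothAt (dzbar i f) z := by
  rw [show dzbar i f = wd (-1) (Pi.single i 1) f from funext fun y => dzbar_eq_wd i]
  exact smoothAt_wd hf

lemma wd_wd_eq_sum (hf : SmoothAt f z) (v u : ι → ℂ) :
    wd 1 v (wd (-1) u f) =ᶠ[𝓝 z]
      fun y => ∑ i, ∑ j, v i * star (u j) * dz i (dzbar j f) y := by
  rw [wd_neg_one_eq_sum]
  filter_upwards [wd_sum (σ := 1) (v := v) Finset.univ (fun j => star (u j)) (fun j => dzbar j f)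
    fun j _ => smoothAt_dzbar hf j] with y hy
  rw [hy, Finset.sum_comm]
  refine Finset.sum_congr rfl fun j _ => ?_
  rw [wd_one_eq_sum, Finset.mul_sum]
  exact Finset.sum_congr rfl fun i _ => by ring

/-! #### Jets of real functions -/

lemma wd_wd2_comm (hf : SmoothAt f z) : wd σ w (wd2 τ v u f) z = wd2 τ v u (wd σ w f) z := by
  have h1 : wd σ w (wd2 τ v u f) z = wd σ w (wd τ v (wd τ v f)) z + wd σ w (wd τ u f) z :=
    (wd_add (smoothAt_wd (smoothAt_wd hf)) (smoothAt_wd hf)).eq_of_nhds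
  rw [h1, wd_comm (smoothAt_wd hf).contDiffAt_two, wd_comm hf.contDiffAt_two,
    (wd_congr hf.eventually_wd_comm).eq_of_nhds]
  rfl

lemma wd_star_of_real (hr : ∀ y, star (f y) = f y) : wd σ v f = fun y => star (wd (-σ) v f y) := by
  ext y
  rw [← wd_star]
  simp only [hr]

lemma wd2_star_of_real (hr : ∀ y, star (f y) = f y) :
    wd2 σ v u f = fun y => star (wd2 (-σ) v u f y) := by
  ext y
  rw [← wd2_star]
  simp only [hr]

lemma jet_c1_c0 (hr : ∀ y, star (f y) = f y) :
    (jet v u f z).c1.c0 = star (jet v u f z).c0.c1 := by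
  have := congrFun (wd_star_of_real (σ := -1) (v := v) hr) z
  rwa [neg_neg] at this

lemma jet_c2_c0 (hr : ∀ y, star (f y) = f y) :
    (jet v u f z).c2.c0 = star (jet v u f z).c0.c2 := by
  have := congrFun (wd2_star_of_real (σ := -1) (v := v) (u := u) hr) z
  rwa [neg_neg] at this

lemma star_wd_wd (hf : SmoothAt f z) (hr : ∀ y, star (f y) = f y) :
    star (wd 1 v (wd (-1) u f) z) = wd 1 u (wd (-1) v f) z := by
  rw [wd_star_of_real (σ := -1) hr, wd_star, star_star, neg_neg, wd_comm hf.contDiffAt_two]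

lemma jet_c1_c1 (hf : SmoothAt f z) (hr : ∀ y, star (f y) = f y) :
    star (jet v u f z).c1.c1 = (jet v u f z).c1.c1 := star_wd_wd hf hr

lemma jet_c2_c1 (hf : SmoothAt f z) (hr : ∀ y, star (f y) = f y) :
    (jet v u f z).c2.c1 = star (jet v u f z).c1.c2 := by
  change wd 1 v (wd2 (-1) v u f) z = star (wd2 1 v u (wd (-1) v f) z)
  rw [wd2_star_of_real (σ := -1) hr, wd_star, neg_neg, wd_wd2_comm hf]

lemma jet_c2_c2_expand (hf : SmoothAt f z) (hr : ∀ y, star (f y) = f y) :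
    (jet v u f z).c2.c2 = wd 1 v (wd (-1) v (wd 1 v (wd (-1) v f))) z
      + wd 1 v (wd 1 v (wd (-1) u f)) z + star (wd 1 v (wd 1 v (wd (-1) u f)) z)
      + wd 1 u (wd (-1) u f) z := by
  have e1 : (jet v u f z).c2.c2 = wd2 1 v u (wd (-1) v (wd (-1) v f)) z
      + wd2 1 v u (wd (-1) u f) z :=
    (wd2_add (smoothAt_wd (smoothAt_wd hf)) (smoothAt_wd hf)).eq_of_nhds
  have e2 : wd 1 v (wd 1 v (wd (-1) v (wd (-1) v f))) z
      = wd 1 v (wd (-1) v (wd 1 v (wd (-1) v f))) z :=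
    (wd_congr (smoothAt_wd hf).eventually_wd_comm).eq_of_nhds
  have e3 : wd 1 u (wd (-1) v (wd (-1) v f)) z = star (wd 1 v (wd 1 v (wd (-1) u f)) z) := by
    have h1 : wd (-1) u f = fun y => star (wd 1 u f y) := by
      rw [wd_star_of_real (σ := -1) hr, neg_neg]
    have h2 : wd 1 v (fun y => star (wd 1 u f y)) = fun y => star (wd (-1) v (wd 1 u f) y) :=
      funext fun y => wd_star _ _
    rw [h1, h2, wd_star, star_star, wd_comm (smoothAt_wd hf).contDiffAt_two,
      (wd_congr hf.eventually_wd_comm).eq_of_nhds]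
  rw [e1]
  simp only [wd2, Pi.add_apply]
  rw [e2, e3]
  ring

/-! #### The metric and its curvature -/

lemma hermForm_eq_sum (A : Matrix ι ι ℂ) (v : ι → ℂ) :
    hermForm A v = ∑ i, ∑ j, v i * star (v j) * A i j := by
  simp only [hermForm, dotProduct, Matrix.mulVec, Finset.mul_sum, Pi.star_apply]
  exact Finset.sum_congr rfl fun i _ => Finset.sum_congr rfl fun j _ => by ring

variable {G : (ι → ℂ) → ℝ}

/-- The logarithm of `G` as a complex-valued function. -/
abbrev logC (G : (ι → ℂ) → ℝ) : (ι → ℂ) → ℂ := fun y => ((Real.log (G y) : ℝ) : ℂ)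

lemma logC_real (G : (ι → ℂ) → ℝ) (y : ι → ℂ) : star (logC G y) = logC G y :=
  Complex.conj_ofReal _

lemma metric_bilin (hf : SmoothAt (logC G) z) (v u : ι → ℂ) :
    v ⬝ᵥ (metricMatrix G z *ᵥ star u) = wd 1 v (wd (-1) u (logC G)) z := by
  rw [(wd_wd_eq_sum hf v u).eq_of_nhds]
  simp only [dotProduct, Matrix.mulVec, Finset.mul_sum, Pi.star_apply, metricMatrix,
    Matrix.of_apply]
  exact Finset.sum_congr rfl fun i _ => Finset.sum_congr rfl fun j _ => by ring

lemma metric_isHermitian (hf : SmoothAt (logC G) z) : (metricMatrix G z).IsHermitian := by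
  ext i j
  have h : ∀ i j, metricMatrix G z i j
      = wd 1 (Pi.single i 1) (wd (-1) (Pi.single j 1) (logC G)) z := fun i j => by
    rw [← metric_bilin hf]
    simp
  rw [Matrix.conjTranspose_apply, h, h, star_wd_wd hf (logC_real G)]

lemma metric_posDef (hf : SmoothAt (logC G) z)
    (hpos : ∀ v, v ≠ 0 → 0 < (jet v 0 (logC G) z).c1.c1.re) : (metricMatrix G z).PosDef := by
  refine Matrix.PosDef.of_dotProduct_mulVec_pos (metric_isHermitian hf) fun x hx => ?_
  have h1 := hpos (star x) (by simpa using hx)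
  have h2 := metric_bilin hf (star x) (star x)
  rw [star_star] at h2
  have h3 := jet_c1_c1 (v := star x) (u := 0) hf (logC_real G)
  rw [h2, Complex.pos_iff]
  exact ⟨h1, (Complex.conj_eq_iff_im.mp h3).symm⟩

lemma hermForm_ddbar (hf : SmoothAt (logC G) z) (v : ι → ℂ) :
    hermForm (ddbarMatrix (metricMatrix G) z v) v
      = wd 1 v (wd (-1) v (wd 1 v (wd (-1) v (logC G)))) z := by
  have hs : ∀ i j, SmoothAt (fun y => metricMatrix G y i j) z := fun i j =>
    smoothAt_dz (smoothAt_dzbar hf j) i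
  have h1 := wd_congr (σ := 1) (v := v) (wd_congr (σ := -1) (v := v) (wd_wd_eq_sum hf v v))
  have h2 : (fun y => ∑ i, ∑ j, v i * star (v j) * dz i (dzbar j (logC G)) y)
      = fun y => ∑ x : ι × ι, (v x.1 * star (v x.2)) * metricMatrix G y x.1 x.2 := by
    ext y
    rw [Fintype.sum_prod_type]
    rfl
  rw [h2] at h1
  have h3 := wd_sum (σ := -1) (v := v) (z := z) Finset.univ
    (fun x : ι × ι => v x.1 * star (v x.2)) (fun x y => metricMatrix G y x.1 x.2)
    fun x _ => hs x.1 x.2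
  have h4 := wd_sum (σ := 1) (v := v) (z := z) Finset.univ
    (fun x : ι × ι => v x.1 * star (v x.2)) (fun x => wd (-1) v fun y => metricMatrix G y x.1 x.2)
    fun x _ => smoothAt_wd (hs x.1 x.2)
  rw [h1.eq_of_nhds, (wd_congr h3).eq_of_nhds, h4.eq_of_nhds, hermForm_eq_sum,
    Fintype.sum_prod_type]
  refine Finset.sum_congr rfl fun i _ => Finset.sum_congr rfl fun j _ => ?_
  rw [(wd_wd_eq_sum (hs i j) v v).eq_of_nhds]
  congr 1
  simp only [ddbarMatrix, Matrix.of_apply]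
  exact Finset.sum_congr rfl fun k _ => Finset.sum_congr rfl fun l _ => by ring

lemma dMatrix_bilin (hf : SmoothAt (logC G) z) (v u : ι → ℂ) :
    (v ᵥ* dMatrix (metricMatrix G) z v) ⬝ᵥ star u = wd 1 v (wd 1 v (wd (-1) u (logC G))) z := by
  have hs : ∀ i j, SmoothAt (fun y => metricMatrix G y i j) z := fun i j =>
    smoothAt_dz (smoothAt_dzbar hf j) i
  have h1 := wd_congr (σ := 1) (v := v) (wd_wd_eq_sum hf v u)
  have h2 : (fun y => ∑ i, ∑ j, v i * star (u j) * dz i (dzbar j (logC G)) y)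
      = fun y => ∑ x : ι × ι, (v x.1 * star (u x.2)) * metricMatrix G y x.1 x.2 := by
    ext y
    rw [Fintype.sum_prod_type]
    rfl
  rw [h2] at h1
  have h3 := wd_sum (σ := 1) (v := v) (z := z) Finset.univ
    (fun x : ι × ι => v x.1 * star (u x.2)) (fun x y => metricMatrix G y x.1 x.2)
    fun x _ => hs x.1 x.2
  rw [h1.eq_of_nhds, h3.eq_of_nhds, Fintype.sum_prod_type, Finset.sum_comm]
  simp only [dotProduct, Matrix.vecMul, Finset.sum_mul, Pi.star_apply]
  refine Finset.sum_congr rfl fun j _ => Finset.sum_congr rfl fun i _ => ?_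
  rw [wd_one_eq_sum]
  simp only [dMatrix, Matrix.of_apply, Finset.mul_sum, Finset.sum_mul]
  exact Finset.sum_congr rfl fun k _ => by ring

/-- Completing the square: the numerator of the curvature differs from `-D₂D̄₂ log G`, taken along
the curve with second-order term `u`, by the squared length of `u + ξ T⁻¹`. -/
lemma curvature_numerator (hf : SmoothAt (logC G) z) (hT : (metricMatrix G z).PosDef)
    (v u : ι → ℂ) :
    hermForm (-ddbarMatrix (metricMatrix G) z v + dMatrix (metricMatrix G) z v *
      (metricMatrix G z)⁻¹ * (dMatrix (metricMatrix G) z v)ᴴ) v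
      = -(jet v u (logC G) z).c2.c2
        + star (star u + (metricMatrix G z)⁻¹ *ᵥ star (v ᵥ* dMatrix (metricMatrix G) z v)) ⬝ᵥ
          (metricMatrix G z *ᵥ
            (star u + (metricMatrix G z)⁻¹ *ᵥ star (v ᵥ* dMatrix (metricMatrix G) z v))) := by
  set T := metricMatrix G z with hTdef
  set M := dMatrix (metricMatrix G) z v with hM
  have hTT : T * T⁻¹ = 1 := Matrix.mul_nonsing_inv _ ((Matrix.isUnit_iff_isUnit_det _).mp hT.isUnit)
  have hTi : T⁻¹ᴴ = T⁻¹ := hT.inv.1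
  rw [jet_c2_c2_expand hf (logC_real G), ← hermForm_ddbar hf, ← dMatrix_bilin hf v u,
    ← metric_bilin hf u u, ← hTdef, ← hM]
  set ξ := v ᵥ* M with hξ
  have e1 : hermForm (-ddbarMatrix (metricMatrix G) z v + M * T⁻¹ * Mᴴ) v
      = -hermForm (ddbarMatrix (metricMatrix G) z v) v + ξ ⬝ᵥ (T⁻¹ *ᵥ star ξ) := by
    have : star ξ = Mᴴ *ᵥ star v := by rw [hξ, Matrix.star_vecMul]
    rw [this, Matrix.mulVec_mulVec, hξ, ← Matrix.dotProduct_mulVec, Matrix.mulVec_mulVec]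
    simp only [hermForm, Matrix.add_mulVec, Matrix.neg_mulVec, dotProduct_add, dotProduct_neg,
      Matrix.mul_assoc]
  have e2 : T *ᵥ (star u + T⁻¹ *ᵥ star ξ) = T *ᵥ star u + star ξ := by
    rw [Matrix.mulVec_add, Matrix.mulVec_mulVec, hTT, Matrix.one_mulVec]
  have e3 : star (star u + T⁻¹ *ᵥ star ξ) = u + ξ ᵥ* T⁻¹ := by
    rw [star_add, star_star, Matrix.star_mulVec, star_star, hTi]
  have e4 : (ξ ᵥ* T⁻¹) ⬝ᵥ (T *ᵥ star u) = ξ ⬝ᵥ star u := by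
    rw [Matrix.dotProduct_mulVec, Matrix.vecMul_vecMul,
      Matrix.nonsing_inv_mul _ ((Matrix.isUnit_iff_isUnit_det _).mp hT.isUnit), Matrix.vecMul_one]
  have e5 : star (ξ ⬝ᵥ star u) = u ⬝ᵥ star ξ := by
    simp [dotProduct, mul_comm]
  rw [e1, e2, e3, add_dotProduct, dotProduct_add, dotProduct_add, e4,
    Matrix.dotProduct_mulVec ξ, e5]
  ring

/-- A metric with potential `log G` has holomorphic sectional curvature between `-a` and `-C` as
soon as the second-order jets of `log G` along holomorphic curves are controlled. -/
theorem curvature_bounds {a C : ℝ} (hf : SmoothAt (logC G) z)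
    (hpos : ∀ v, v ≠ 0 → 0 < (jet v 0 (logC G) z).c1.c1.re)
    (hC : ∀ v u, v ≠ 0 → C * (jet v u (logC G) z).c1.c1.re ^ 2 ≤ (jet v u (logC G) z).c2.c2.re)
    (ha : ∀ v, v ≠ 0 → ∃ u,
      (jet v u (logC G) z).c2.c2.re ≤ a * (jet v u (logC G) z).c1.c1.re ^ 2)
    (v : ι → ℂ) (hv : v ≠ 0) :
    -a ≤ holSecCurvature (metricMatrix G) z v ∧ holSecCurvature (metricMatrix G) z v ≤ -C := by
  have hT := metric_posDef hf hpos
  set P : ℝ := (jet v 0 (logC G) z).c1.c1.re with hP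
  have hP0 : 0 < P := hpos v hv
  have hden : hermForm (metricMatrix G z) v = (P : ℂ) := by
    rw [hermForm, metric_bilin hf]
    exact (Complex.conj_eq_iff_re.mp (jet_c1_c1 (v := v) (u := 0) hf (logC_real G))).symm
  have hval : ∀ u, holSecCurvature (metricMatrix G) z v
      = (-(jet v u (logC G) z).c2.c2.re
        + (star (star u + (metricMatrix G z)⁻¹ *ᵥ star (v ᵥ* dMatrix (metricMatrix G) z v)) ⬝ᵥ
          (metricMatrix G z *ᵥ (star u + (metricMatrix G z)⁻¹ *ᵥ
            star (v ᵥ* dMatrix (metricMatrix G) z v)))).re) / P ^ 2 := by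
    intro u
    rw [holSecCurvature, curvature_numerator hf hT v u, hden, ← Complex.ofReal_pow,
      Complex.div_ofReal_re]
    simp
  constructor
  · -- for the lower bound any `u` will do, the square being nonnegative
    obtain ⟨u, hu⟩ := ha v hv
    rw [hval u, le_div_iff₀ (by positivity)]
    have h1 := hT.posSemidef.dotProduct_mulVec_nonneg
      (star u + (metricMatrix G z)⁻¹ *ᵥ star (v ᵥ* dMatrix (metricMatrix G) z v))
    have h2 := (Complex.nonneg_iff.mp h1).1
    have h3 : (jet v u (logC G) z).c1.c1.re = P := rfl
    rw [h3] at hu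
    linarith
  · -- equality holds in the square for `u = -ξ T⁻¹`
    obtain ⟨u, hu⟩ : ∃ u : ι → ℂ, star u
        = -((metricMatrix G z)⁻¹ *ᵥ star (v ᵥ* dMatrix (metricMatrix G) z v)) :=
      ⟨star (-((metricMatrix G z)⁻¹ *ᵥ star (v ᵥ* dMatrix (metricMatrix G) z v))), star_star _⟩
    rw [hval u, div_le_iff₀ (by positivity), hu]
    have h3 := hC v u hv
    have h4 : (jet v u (logC G) z).c1.c1.re = P := rfl
    rw [h4] at h3
    simp
    linarith

end Curvature

/-! ### Logarithms and exponentials of two-sided jets -/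

namespace Jet

/-- The jet of a function of `s̄` alone. -/
def anti : Jet ℂ →+* Jet2 where
  toFun a := ⟨const a.c0, const a.c1, const a.c2⟩
  map_one' := by ext <;> simp
  map_zero' := by ext <;> simp
  map_add' x y := by ext <;> simp
  map_mul' x y := by ext <;> simp

/-- The jet `⟨1, ...⟩` of `exp φ` for a potential `φ` without pluriharmonic terms, with
`p = φ₁₁`, `q = φ₂₁` and `r = φ₂₂`. -/
@[simps]
def expMixed (p q q' r : ℂ) : Jet2 := ⟨1, ⟨0, p, q⟩, ⟨0, q', r + 2 * p ^ 2⟩⟩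

/-- The jet of an exponential splits into a holomorphic, an antiholomorphic and a mixed factor. -/
lemma exp_eq_mul (a : Jet2) (e e' : ℂ) (he : Complex.exp a.c0.c0 = e * e') :
    exp a = hol (expWith e a.c0) * anti (expWith e' ⟨0, a.c1.c0, a.c2.c0⟩)
      * expMixed a.c1.c1 a.c1.c2 a.c2.c1 a.c2.c2 := by
  ext <;> simp [exp, expWith, he, anti, expMixed] <;> ring

/-- If, after multiplication by holomorphic and antiholomorphic factors, the jet of `exp (-φ)` is
`c (1 - y)` with `y` free of pure terms, then the mixed derivatives of `φ` are those of
`y + y² / 2`. -/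
lemma neg_log_mixed {a y : Jet2} {g : Jet ℂ} {c : ℂ} (hc : c ≠ 0)
    (h : hol g * ahol g * exp (-a) = const (const c) * (1 - y))
    (h0 : y.c0 = 0) (h1 : y.c1.c0 = 0) (h2 : y.c2.c0 = 0) :
    a.c1.c1 = y.c1.c1 ∧ a.c1.c2 = y.c1.c2 ∧ a.c2.c2 = y.c2.c2 + 2 * y.c1.c1 ^ 2 := by
  rw [exp_eq_mul (-a) (Complex.exp (-a).c0.c0) 1 (mul_one _).symm] at h
  obtain ⟨P, hP⟩ : ∃ P, P = g * expWith (Complex.exp (-a).c0.c0) (-a).c0 := ⟨_, rfl⟩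
  obtain ⟨R, hR⟩ : ∃ R : Jet ℂ, R = ⟨star g.c0, star g.c1, star g.c2⟩
    * expWith 1 ⟨0, (-a).c1.c0, (-a).c2.c0⟩ := ⟨_, rfl⟩
  have h' : hol P * anti R * expMixed (-a).c1.c1 (-a).c1.c2 (-a).c2.c1 (-a).c2.c2
      = const (const c) * (1 - y) := by
    rw [← h, hP, hR, map_mul, map_mul]
    have : ahol g = anti ⟨star g.c0, star g.c1, star g.c2⟩ := rfl
    rw [this]
    ring
  -- the pure coefficients force the two outer factors to be constant
  have e00 := congrArg (fun t => t.c0.c0) h'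
  have e01 := congrArg (fun t => t.c0.c1) h'
  have e02 := congrArg (fun t => t.c0.c2) h'
  have e10 := congrArg (fun t => t.c1.c0) h'
  have e20 := congrArg (fun t => t.c2.c0) h'
  have e11 := congrArg (fun t => t.c1.c1) h'
  have e12 := congrArg (fun t => t.c1.c2) h'
  have e22 := congrArg (fun t => t.c2.c2) h'
  simp [anti, expMixed, h0, h1, h2] at e00 e01 e02 e10 e20 e11 e12 e22
  have hp : P.c0 ≠ 0 := fun h => hc (by rw [← e00, h, zero_mul])
  have hr : R.c0 ≠ 0 := fun h => hc (by rw [← e00, h, mul_zero])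
  have p1 : P.c1 = 0 := by simpa [hr] using e01
  have p2 : P.c2 = 0 := by simpa [hr] using e02
  have r1 : R.c1 = 0 := by simpa [hp] using e10
  have r2 : R.c2 = 0 := by simpa [hp] using e20
  simp [p1, p2, r1, r2, ← e00, hp, hr] at e11 e12 e22
  refine ⟨e11, e12, ?_⟩
  rw [← e11]
  have e := mul_left_cancel₀ (mul_ne_zero hp hr)
    (e22.trans (neg_mul_eq_mul_neg (P.c0 * R.c0) y.c2.c2))
  linear_combination -e

/-- The jet of `exp φ` for a real potential `φ`. -/
lemma exp_eq_hol_mul_ahol {a : Jet2} (h0 : star a.c0.c0 = a.c0.c0)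
    (h1 : a.c1.c0 = star a.c0.c1) (h2 : a.c2.c0 = star a.c0.c2) :
    exp a = hol (expWith (Complex.exp (a.c0.c0 / 2)) a.c0)
      * ahol (expWith (Complex.exp (a.c0.c0 / 2)) a.c0)
      * expMixed a.c1.c1 a.c1.c2 a.c2.c1 a.c2.c2 := by
  have he : star (Complex.exp (a.c0.c0 / 2)) = Complex.exp (a.c0.c0 / 2) := by
    have h : (starRingEnd ℂ) a.c0.c0 = a.c0.c0 := h0
    rw [Complex.star_def, ← Complex.exp_conj, map_div₀, h, Complex.conj_ofNat]
  rw [exp_eq_mul a (Complex.exp (a.c0.c0 / 2)) (Complex.exp (a.c0.c0 / 2))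
    (by rw [← Complex.exp_add]; ring_nf)]
  congr 2
  have he' : (starRingEnd ℂ) (Complex.exp (a.c0.c0 / 2)) = Complex.exp (a.c0.c0 / 2) := he
  ext <;> simp [anti, expWith, h1, h2, he']

/-- The mixed jets of `-log (1 - X)` when `X` has the jet of `|w|² e^ψ`. The holomorphic factor `g`
clearing the pure terms of `1 - X` replaces the jets `wⱼ` by `g wⱼ`, and is determined by
`gₐ = ⟨(g w)ₐ, w₀⟩`. -/
lemma neg_log_one_sub {N : ℕ} {a : Jet2} {w : Fin N → Jet ℂ} {p q q' r : ℂ} {m : ℝ} {g : Jet ℂ}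
    (hm0 : m ≠ 0) (hm : (m : ℂ) = 1 - ∑ j, (w j).c0 * star (w j).c0)
    (hexp : exp (-a) = 1 - (∑ j, hol (w j) * ahol (w j)) * expMixed p q q' r)
    (hg0 : g.c0 = 1) (hg1 : g.c1 = ∑ j, (g * w j).c1 * star (w j).c0)
    (hg2 : g.c2 = ∑ j, (g * w j).c2 * star (w j).c0) :
    m * a.c1.c1 = ∑ j, (g * w j).c1 * star (g * w j).c1
        + (∑ j, (w j).c0 * star (w j).c0) * p - g.c1 * star g.c1 ∧
    m * (a.c2.c2 - 2 * a.c1.c1 ^ 2) = ∑ j, (g * w j).c2 * star (g * w j).c2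
        + (∑ j, (w j).c0 * star (w j).c0) * (r + 2 * p ^ 2)
        + 4 * p * ∑ j, (g * w j).c1 * star (g * w j).c1
        + 2 * (g.c1 * q' + star g.c1 * q) - g.c2 * star g.c2 := by
  have hmc : (m : ℂ) ≠ 0 := by exact_mod_cast hm0
  obtain ⟨t, ht⟩ : ∃ t : Fin N → Jet ℂ, ∀ j, t j = g * w j := ⟨_, fun _ => rfl⟩
  have hw0 : ∀ j, (w j).c0 = (t j).c0 := fun j => by simp [ht, hg0]
  simp only [← ht, hw0] at hm hg1 hg2 ⊢
  obtain ⟨S, hS⟩ : ∃ S : Jet2, S = ∑ j, hol (t j) * ahol (t j) := ⟨_, rfl⟩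
  obtain ⟨s11, h11⟩ : ∃ s11, s11 = ∑ j, (t j).c1 * star (t j).c1 := ⟨_, rfl⟩
  obtain ⟨s12, h12⟩ : ∃ s12, s12 = ∑ j, (t j).c1 * star (t j).c2 := ⟨_, rfl⟩
  obtain ⟨s21, h21⟩ : ∃ s21, s21 = ∑ j, (t j).c2 * star (t j).c1 := ⟨_, rfl⟩
  obtain ⟨s22, h22⟩ : ∃ s22, s22 = ∑ j, (t j).c2 * star (t j).c2 := ⟨_, rfl⟩
  obtain ⟨x, hx⟩ : ∃ x, x = ∑ j, (t j).c0 * star (t j).c0 := ⟨_, rfl⟩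
  have hSe : S = ⟨⟨x, g.c1, g.c2⟩, ⟨star g.c1, s11, s21⟩, ⟨star g.c2, s12, s22⟩⟩ := by
    rw [hS]
    ext <;> simp [h11, h12, h21, h22, hx, hg1, hg2, mul_comm]
  rw [← h11, ← h22, ← hx]
  rw [← hx] at hm
  have hx' : x = 1 - m := by rw [hm]; ring
  have hmul : hol g * ahol g * exp (-a)
      = hol g * ahol g - S * expMixed p q q' r := by
    rw [hexp, hS, mul_sub, mul_one, ← mul_assoc, Finset.mul_sum]
    congr 2
    refine Finset.sum_congr rfl fun j _ => ?_
    rw [ht, map_mul, map_mul]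
    ring
  have hy : hol g * ahol g * exp (-a) = const (const (m : ℂ)) * (1 - (⟨0,
      ⟨0, (s11 + x * p - g.c1 * star g.c1) / m,
        (s21 + x * q + 2 * g.c1 * p - g.c2 * star g.c1) / m⟩,
      ⟨0, (s12 + x * q' + 2 * star g.c1 * p - g.c1 * star g.c2) / m,
        (s22 + x * (r + 2 * p ^ 2) + 4 * s11 * p + 2 * g.c1 * q' + 2 * star g.c1 * q
          - g.c2 * star g.c2) / m⟩⟩ : Jet2)) := by
    rw [hmul, hSe]
    ext <;> simp [hg0, hx'] <;> field_simp <;> ring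
  obtain ⟨r1, -, r2⟩ := neg_log_mixed hmc hy rfl rfl rfl
  constructor
  · rw [r1]; field_simp
  · rw [r2, r1]; field_simp; ring

end Jet

section Potentials

open Filter Topology

set_option linter.unusedSectionVars false

variable {ι : Type} [Fintype ι] {v u z : ι → ℂ} {h : (ι → ℂ) → ℝ}

/-- The potential `-log h`, as a complex-valued function. -/
def negLog (h : (ι → ℂ) → ℝ) (y : ι → ℂ) : ℂ := ((-Real.log (h y) : ℝ) : ℂ)

lemma negLog_real (h : (ι → ℂ) → ℝ) (y : ι → ℂ) : star (negLog h y) = negLog h y :=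
  Complex.conj_ofReal _

lemma smoothAt_ofReal (hs : ContDiffAt ℝ ∞ h z) : SmoothAt (fun y => (h y : ℂ)) z :=
  Complex.ofRealCLM.contDiff.contDiffAt.comp z hs

lemma smoothAt_negLog (hs : ContDiffAt ℝ ∞ h z) (h0 : 0 < h z) : SmoothAt (negLog h) z :=
  smoothAt_ofReal (hs.log h0.ne').neg

lemma smoothAt_neg {f : (ι → ℂ) → ℂ} (hf : SmoothAt f z) : SmoothAt (fun y => -f y) z :=
  ContDiffAt.neg hf

lemma jet_neg {f : (ι → ℂ) → ℂ} (hf : SmoothAt f z) :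
    jet v u (fun y => -f y) z = -jet v u f z := by
  have h1 := jet_const_mul (v := v) (u := u) (-1) hf
  simp only [neg_mul, one_mul, map_neg, map_one] at h1
  exact h1

/-- `h = exp (-(-log h))` on the level of jets. -/
lemma jet_ofReal_eq_exp (hs : ContDiffAt ℝ ∞ h z) (h0 : 0 < h z) :
    jet v u (fun y => (h y : ℂ)) z = Jet.exp (-jet v u (negLog h) z) := by
  rw [← jet_neg (smoothAt_negLog hs h0), ← jet_exp (smoothAt_neg (smoothAt_negLog hs h0))]
  refine jet_congr ?_
  filter_upwards [hs.continuousAt.eventually (lt_mem_nhds h0)] with y hy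
  simp only [negLog]
  rw [← Complex.ofReal_neg, neg_neg, ← Complex.ofReal_exp, Real.exp_log hy]

end Potentials

/-! ### From the base domain to the Cartan-Hartogs domain -/

section Hartogs

open Filter Topology

set_option linter.unusedSectionVars false

/-- Bounds, at the point `ζ`, on the mixed second-order jets `p`, `q`, `r` of the potential
`φ = -log h` along holomorphic curves with velocity `V` and acceleration `U`. They say that `φ` is
the potential of a Kähler metric whose holomorphic sectional curvature lies between `-a₀` and
`-κ₀` at `ζ`; the acceleration in `upper` is the one for which the cross term `q` vanishes. -/
structure BaseBounds {κ : Type} [Fintype κ] (h : (κ → ℂ) → ℝ) (ζ : κ → ℂ) (κ₀ a₀ : ℝ) : Prop where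
  pos : 0 < h ζ
  smooth : ContDiffAt ℝ ∞ h ζ
  velocity_pos : ∀ V, V ≠ 0 → 0 < (jet V 0 (negLog h) ζ).c1.c1.re
  lower : ∀ V U, κ₀ * (jet V U (negLog h) ζ).c1.c1.re ^ 2 ≤ (jet V U (negLog h) ζ).c2.c2.re
  upper : ∀ V, ∃ U, (jet V U (negLog h) ζ).c1.c2 = 0 ∧
    (jet V U (negLog h) ζ).c2.c2.re ≤ a₀ * (jet V U (negLog h) ζ).c1.c1.re ^ 2

lemma sum_mul_star_eq {N : ℕ} (a : Fin N → ℂ) :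
    ∑ j, a j * star (a j) = ((∑ j, ‖a j‖ ^ 2 : ℝ) : ℂ) := by
  push_cast
  exact Finset.sum_congr rfl fun j _ => by rw [Complex.star_def, Complex.mul_conj']

lemma norm_sum_mul_star_sq_le {κ : Type} (s : Finset κ) (a b : κ → ℂ) :
    ‖∑ j ∈ s, a j * star (b j)‖ ^ 2 ≤ (∑ j ∈ s, ‖a j‖ ^ 2) * ∑ j ∈ s, ‖b j‖ ^ 2 := by
  have h1 : ‖∑ j ∈ s, a j * star (b j)‖ ≤ ∑ j ∈ s, ‖a j‖ * ‖b j‖ :=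
    (norm_sum_le _ _).trans (Finset.sum_le_sum fun j _ => by rw [norm_mul, norm_star])
  calc ‖∑ j ∈ s, a j * star (b j)‖ ^ 2 ≤ (∑ j ∈ s, ‖a j‖ * ‖b j‖) ^ 2 := by gcongr
    _ ≤ _ := Finset.sum_mul_sq_le_sq_mul_sq _ _ _

/-- The mixed fourth derivative of the fibre potential is nonnegative up to the square of the
second one: the cross terms with `q` are absorbed by changing the acceleration of the base curve
by the multiple `2 g₁ / x` of its velocity. -/
lemma fibre_nonneg {n1 n2 x p r : ℝ} {g1 g2 q : ℂ} (hx0 : 0 ≤ x) (hx1 : x ≤ 1) (hp : 0 ≤ p)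
    (hn1 : 0 ≤ n1) (hn2 : 0 ≤ n2) (hg1 : ‖g1‖ ^ 2 ≤ n1 * x) (hg2 : ‖g2‖ ^ 2 ≤ n2 * x)
    (hr : ∀ α : ℂ, 0 ≤ r + 2 * (α * q).re + ‖α‖ ^ 2 * p) :
    0 ≤ n2 + x * (r + 2 * p ^ 2) + 4 * p * n1 + 4 * (g1 * q).re - ‖g2‖ ^ 2 := by
  have h2 : ‖g2‖ ^ 2 ≤ n2 := hg2.trans (mul_le_of_le_one_right hn2 hx1)
  rcases hx0.eq_or_lt with rfl | hx
  · have : g1 = 0 := by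
      have : ‖g1‖ ^ 2 ≤ 0 := by simpa using hg1
      simpa using this
    rw [this]
    have := mul_nonneg hp hn1
    simp
    linarith
  · have h3 := hr ((2 / x : ℝ) * g1)
    rw [mul_assoc, Complex.re_ofReal_mul, norm_mul, Complex.norm_real, mul_pow, Real.norm_eq_abs,
      sq_abs] at h3
    have h4 : 0 ≤ x * (r + 2 * (2 / x * (g1 * q).re) + (2 / x) ^ 2 * ‖g1‖ ^ 2 * p) :=
      mul_nonneg hx.le h3
    have h5 : x * (r + 2 * (2 / x * (g1 * q).re) + (2 / x) ^ 2 * ‖g1‖ ^ 2 * p)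
        = x * r + 4 * (g1 * q).re + 4 * p * (‖g1‖ ^ 2 / x) := by
      field_simp
      ring
    have h6 : ‖g1‖ ^ 2 / x ≤ n1 := by rwa [div_le_iff₀ hx]
    have h7 : 4 * p * (‖g1‖ ^ 2 / x) ≤ 4 * p * n1 := by gcongr
    have h8 : 0 ≤ x * (2 * p ^ 2) := by positivity
    nlinarith

/-- The final comparison with the square of the metric, from below. -/
lemma lower_arith {lam c κ₀ y p Y r : ℝ} (hlam : 0 < lam) (hc : 0 < c) (hκ : 0 < κ₀)
    (hY : 0 ≤ Y) (hr : κ₀ * p ^ 2 ≤ r) :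
    min (1 / lam) (κ₀ / (2 * c)) * (lam * y + c * p) ^ 2
      ≤ lam * (Y + 2 * y ^ 2) + c * r := by
  have h1 : min (1 / lam) (κ₀ / (2 * c)) * (2 * lam ^ 2 * y ^ 2)
      ≤ 1 / lam * (2 * lam ^ 2 * y ^ 2) := by
    gcongr; exact min_le_left _ _
  have h2 : min (1 / lam) (κ₀ / (2 * c)) * (2 * c ^ 2 * p ^ 2)
      ≤ κ₀ / (2 * c) * (2 * c ^ 2 * p ^ 2) := by
    gcongr; exact min_le_right _ _
  have h3 : 1 / lam * (2 * lam ^ 2 * y ^ 2) = 2 * lam * y ^ 2 := by field_simp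
  have h4 : κ₀ / (2 * c) * (2 * c ^ 2 * p ^ 2) = c * (κ₀ * p ^ 2) := by field_simp
  have h5 : (lam * y + c * p) ^ 2 ≤ 2 * lam ^ 2 * y ^ 2 + 2 * c ^ 2 * p ^ 2 := by
    nlinarith [sq_nonneg (lam * y - c * p)]
  have h6 : 0 ≤ min (1 / lam) (κ₀ / (2 * c)) := by positivity
  have h7 := mul_le_mul_of_nonneg_left h5 h6
  have h8 := mul_le_mul_of_nonneg_left hr hc.le
  have h9 := mul_nonneg hlam.le hY
  rw [mul_add] at h7
  linarith

/-- The final comparison with the square of the metric, from above, along a curve with `q = 0` and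
vanishing normalised acceleration in the fibre. -/
lemma upper_arith {lam c k a₀ y p m x n1 g r Y : ℝ} (hlam : 0 < lam) (hc : 0 < c) (hk : 0 < k)
    (ha : 0 ≤ a₀) (hm : 0 < m) (hmx : m = 1 - x) (hx : 0 ≤ x) (hp : 0 ≤ p) (hn1 : 0 ≤ n1)
    (hg : g ≤ n1 * x) (hy : m * y = n1 + x * (k * p) - g) (hr : r ≤ a₀ * p ^ 2)
    (hY : m * Y = x * (k * r + 2 * (k * p) ^ 2) + 4 * (k * p) * n1) :
    lam * (Y + 2 * y ^ 2) + c * r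
      ≤ (6 / lam + (6 * k + a₀) / c + a₀ / c) * (lam * y + c * p) ^ 2 := by
  have e1 : m * n1 + x * (k * p) ≤ m * y := by rw [hy, hmx]; linarith
  have hxkp : 0 ≤ x * (k * p) := by positivity
  have e2 : n1 ≤ y := by
    have : m * n1 ≤ m * y := by linarith
    exact le_of_mul_le_mul_left this hm
  have hy0 : 0 ≤ y := hn1.trans e2
  have e3 : x * (k * p) ≤ m * y := by
    have := mul_nonneg hm.le hn1
    linarith
  -- write `n₁ = m n₁ + x n₁` to compensate the factor `1 / m`
  have e4 : 4 * (k * p) * n1 ≤ m * (4 * k * p * y + 4 * y ^ 2) := by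
    have h1 : 4 * (k * p) * n1 = m * (4 * k * p * n1) + 4 * (x * (k * p)) * n1 := by
      rw [hmx]; ring
    have h2 : m * (4 * k * p * n1) ≤ m * (4 * k * p * y) := by gcongr
    have h3 : 4 * (x * (k * p)) * n1 ≤ 4 * (m * y) * y := by gcongr
    rw [h1]
    linarith
  have e5 : x * (k * r + 2 * (k * p) ^ 2) ≤ m * ((a₀ + 2 * k) * p * y) := by
    have h1 : x * (k * r + 2 * (k * p) ^ 2) ≤ x * (k * (a₀ * p ^ 2) + 2 * (k * p) ^ 2) := by
      gcongr
    have h2 : x * (k * (a₀ * p ^ 2) + 2 * (k * p) ^ 2) = (a₀ + 2 * k) * p * (x * (k * p)) := by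
      ring
    have h3 : (a₀ + 2 * k) * p * (x * (k * p)) ≤ (a₀ + 2 * k) * p * (m * y) := by gcongr
    linarith
  have e6 : Y ≤ (a₀ + 2 * k) * p * y + (4 * k * p * y + 4 * y ^ 2) := by
    refine le_of_mul_le_mul_left ?_ hm
    rw [hY]
    linarith
  have hcp : 0 ≤ c * p := by positivity
  have hly : 0 ≤ lam * y := by positivity
  have f1 : lam ^ 2 * y ^ 2 ≤ (lam * y + c * p) ^ 2 := by nlinarith
  have f2 : (lam * y) * (c * p) ≤ (lam * y + c * p) ^ 2 := by nlinarith
  have f3 : c ^ 2 * p ^ 2 ≤ (lam * y + c * p) ^ 2 := by nlinarith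
  have g1 : 6 * lam * y ^ 2 ≤ 6 / lam * (lam * y + c * p) ^ 2 := by
    have : 6 * lam * y ^ 2 = 6 / lam * (lam ^ 2 * y ^ 2) := by field_simp
    rw [this]; gcongr
  have g2 : lam * ((6 * k + a₀) * p * y) ≤ (6 * k + a₀) / c * (lam * y + c * p) ^ 2 := by
    have : lam * ((6 * k + a₀) * p * y) = (6 * k + a₀) / c * ((lam * y) * (c * p)) := by
      field_simp
    rw [this]; gcongr
  have g3 : c * (a₀ * p ^ 2) ≤ a₀ / c * (lam * y + c * p) ^ 2 := by
    have : c * (a₀ * p ^ 2) = a₀ / c * (c ^ 2 * p ^ 2) := by field_simp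
    rw [this]; gcongr
  have g4 := mul_le_mul_of_nonneg_left e6 hlam.le
  have g5 := mul_le_mul_of_nonneg_left hr hc.le
  linarith

variable {κ : Type} [Fintype κ]

/-- Adding `α V` to the acceleration of the curve replaces the operator `D₂` of second order by
`D₂ + α D₁`, so that the mixed jets change by a quadratic expression in `α`. -/
lemma jet_c2_c2_add_smul {φ : (κ → ℂ) → ℂ} {ζ : κ → ℂ} (hφ : SmoothAt φ ζ)
    (hr : ∀ y, star (φ y) = φ y) (V U : κ → ℂ) (α : ℂ) :
    (jet V (U + α • V) φ ζ).c2.c2.re = (jet V U φ ζ).c2.c2.re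
      + 2 * (α * (jet V U φ ζ).c2.c1).re + ‖α‖ ^ 2 * (jet V U φ ζ).c1.c1.re := by
  classical
  have s1 : ∀ (f : (κ → ℂ) → ℂ), wd 1 (U + α • V) f = wd 1 U f + fun y => α * wd 1 V f y := by
    intro f; ext y
    simp only [wd_one_eq_sum, Pi.add_apply, Pi.smul_apply, smul_eq_mul, Finset.mul_sum,
      ← Finset.sum_add_distrib]
    exact Finset.sum_congr rfl fun i _ => by ring
  have s2 : ∀ (f : (κ → ℂ) → ℂ),
      wd (-1) (U + α • V) f = wd (-1) U f + fun y => star α * wd (-1) V f y := by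
    intro f; ext y
    simp only [wd_neg_one_eq_sum, Pi.add_apply, Pi.smul_apply, smul_eq_mul, Finset.mul_sum,
      ← Finset.sum_add_distrib, star_add, star_mul]
    exact Finset.sum_congr rfl fun i _ => by ring
  have t1 : ∀ (f : (κ → ℂ) → ℂ), wd2 1 V (U + α • V) f = wd2 1 V U f + fun y => α * wd 1 V f y := by
    intro f; simp only [wd2, s1, add_assoc]
  have t2 : ∀ (f : (κ → ℂ) → ℂ),
      wd2 (-1) V (U + α • V) f = wd2 (-1) V U f + fun y => star α * wd (-1) V f y := by
    intro f; simp only [wd2, s2, add_assoc]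
  have hm : SmoothAt (fun y => star α * wd (-1) V φ y) ζ :=
    contDiffAt_const.mul (smoothAt_wd hφ)
  have u1 : wd2 1 V U (fun y => star α * wd (-1) V φ y) ζ
      = star α * wd2 1 V U (wd (-1) V φ) ζ := by
    have h1 := (wd_congr (σ := 1) (v := V) (wd_const_mul (σ := 1) (v := V) (star α)
      (smoothAt_wd (σ := -1) (v := V) hφ))).trans (wd_const_mul (star α)
      (smoothAt_wd (smoothAt_wd hφ)))
    have h2 := wd_const_mul (σ := 1) (v := U) (star α) (smoothAt_wd (σ := -1) (v := V) hφ)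
    simp only [wd2, Pi.add_apply]
    rw [h1.eq_of_nhds, h2.eq_of_nhds]; ring
  have key : (jet V (U + α • V) φ ζ).c2.c2 = (jet V U φ ζ).c2.c2
      + star α * (jet V U φ ζ).c1.c2 + α * (jet V U φ ζ).c2.c1
      + α * star α * (jet V U φ ζ).c1.c1 := by
    change wd2 1 V (U + α • V) (wd2 (-1) V (U + α • V) φ) ζ = _
    rw [t2, t1, Pi.add_apply, (wd2_add (smoothAt_wd2 hφ) hm).eq_of_nhds, Pi.add_apply, u1,
      (wd_add (smoothAt_wd2 hφ) hm).eq_of_nhds, Pi.add_apply,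
      (wd_const_mul (star α) (smoothAt_wd hφ)).eq_of_nhds]
    change _ = wd2 1 V U (wd2 (-1) V U φ) ζ + star α * wd2 1 V U (wd (-1) V φ) ζ
      + α * wd 1 V (wd2 (-1) V U φ) ζ + α * star α * wd 1 V (wd (-1) V φ) ζ
    ring
  have h1 : (jet V U φ ζ).c1.c2 = star (jet V U φ ζ).c2.c1 := by
    rw [jet_c2_c1 hφ hr, star_star]
  rw [key, h1, ← star_mul', Complex.star_def, Complex.mul_conj']
  simp only [Complex.add_re, Complex.conj_re]
  rw [← Complex.ofReal_pow, Complex.re_ofReal_mul]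
  ring

end Hartogs

section HartogsMetric

open Filter Topology

set_option linter.unusedSectionVars false

variable {κ : Type} [Fintype κ] [DecidableEq κ] {N : ℕ}

/-- The projection `(Z, W) ↦ Z`. -/
def zProj (κ : Type) (N : ℕ) : (κ ⊕ Fin N → ℂ) →L[ℂ] (κ → ℂ) :=
  ContinuousLinearMap.pi fun k => ContinuousLinearMap.proj (Sum.inl k)

lemma zProj_apply (y : κ ⊕ Fin N → ℂ) : zProj κ N y = zPart y := rfl

/-- The coordinate `Wⱼ` of `(Z, W)`. -/
def wProj (κ : Type) {N : ℕ} (j : Fin N) : (κ ⊕ Fin N → ℂ) →L[ℂ] ℂ :=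
  ContinuousLinearMap.proj (Sum.inr j)

variable {K lam γ κ₀ a₀ : ℝ} {h : (κ → ℂ) → ℝ} {z : κ ⊕ Fin N → ℂ}

lemma wNormSq_nonneg (z : κ ⊕ Fin N → ℂ) : 0 ≤ wNormSq z :=
  Finset.sum_nonneg fun _ _ => sq_nonneg _

lemma bigX_nonneg (h0 : 0 < h (zPart z)) : 0 ≤ bigX N K h z :=
  mul_nonneg (wNormSq_nonneg z) (Real.rpow_nonneg h0.le _)

lemma bigX_lt_one (hK : 0 < K) (h0 : 0 < h (zPart z)) (hz : wNormSq z ^ K < h (zPart z)) :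
    bigX N K h z < 1 := by
  have h1 : wNormSq z < h (zPart z) ^ (1 / K) := by
    have h2 := Real.rpow_lt_rpow (Real.rpow_nonneg (wNormSq_nonneg z) K) hz
      (z := 1 / K) (by positivity)
    rwa [← Real.rpow_mul (wNormSq_nonneg z), mul_one_div_cancel hK.ne', Real.rpow_one] at h2
  rw [bigX, Real.rpow_neg h0.le, ← div_eq_mul_inv, div_lt_one (Real.rpow_pos_of_pos h0 _)]
  exact h1

lemma contDiffAt_comp_zPart (hs : ContDiffAt ℝ ∞ h (zPart z)) :
    ContDiffAt ℝ ∞ (fun y => h (zPart y)) z :=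
  ContDiffAt.comp z (g := h) (f := (zProj κ N).restrictScalars ℝ) hs
    ((zProj κ N).restrictScalars ℝ).contDiff.contDiffAt

lemma contDiffAt_wNormSq : ContDiffAt ℝ ∞ (wNormSq : (κ ⊕ Fin N → ℂ) → ℝ) z := by
  unfold wNormSq
  refine ContDiffAt.sum fun j _ => ?_
  exact (((wProj κ j).restrictScalars ℝ).contDiff.norm_sq ℝ).contDiffAt

lemma contDiffAt_bigX (hs : ContDiffAt ℝ ∞ h (zPart z)) (h0 : 0 < h (zPart z)) :
    ContDiffAt ℝ ∞ (bigX N K h) z :=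
  contDiffAt_wNormSq.mul ((contDiffAt_comp_zPart hs).rpow_const_of_ne h0.ne')

lemma generator_pos (h0 : 0 < h (zPart z)) (hX : bigX N K h z < 1) :
    0 < generator N K lam γ h z :=
  mul_pos (Real.rpow_pos_of_pos (inv_pos.mpr (sub_pos.mpr hX)) _) (Real.rpow_pos_of_pos h0 _)

lemma log_generator (h0 : 0 < h (zPart z)) (hX : bigX N K h z < 1) :
    Real.log (generator N K lam γ h z) = lam * -Real.log (1 - bigX N K h z)
      + (γ + N / K) * -Real.log (h (zPart z)) := by
  have h1 : 0 < (1 - bigX N K h z)⁻¹ := inv_pos.mpr (sub_pos.mpr hX)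
  rw [generator, Real.log_mul (Real.rpow_pos_of_pos h1 _).ne' (Real.rpow_pos_of_pos h0 _).ne',
    Real.log_rpow h1, Real.log_rpow h0, Real.log_inv]
  ring

lemma eventually_pos_and_lt (hs : ContDiffAt ℝ ∞ h (zPart z)) (h0 : 0 < h (zPart z))
    (hX : bigX N K h z < 1) : ∀ᶠ y in 𝓝 z, 0 < h (zPart y) ∧ bigX N K h y < 1 :=
  ((contDiffAt_comp_zPart hs).continuousAt.eventually (lt_mem_nhds h0)).and
    ((contDiffAt_bigX hs h0).continuousAt.eventually (gt_mem_nhds hX))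

lemma logC_generator_eventuallyEq (hs : ContDiffAt ℝ ∞ h (zPart z)) (h0 : 0 < h (zPart z))
    (hX : bigX N K h z < 1) :
    logC (generator N K lam γ h) =ᶠ[𝓝 z]
      (fun y => (lam : ℂ) * negLog (fun y => 1 - bigX N K h y) y)
      + fun y => ((γ + N / K : ℝ) : ℂ) * negLog h (zProj κ N y) := by
  filter_upwards [eventually_pos_and_lt hs h0 hX] with y hy
  simp only [logC, Pi.add_apply, negLog, zProj_apply, log_generator hy.1 hy.2]
  push_cast
  ring

lemma contDiffAt_one_sub_bigX (hs : ContDiffAt ℝ ∞ h (zPart z)) (h0 : 0 < h (zPart z)) :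
    ContDiffAt ℝ ∞ (fun y => 1 - bigX N K h y) z :=
  contDiffAt_const.sub (contDiffAt_bigX hs h0)

lemma contDiffAt_log_generator (hs : ContDiffAt ℝ ∞ h (zPart z)) (h0 : 0 < h (zPart z))
    (hX : bigX N K h z < 1) :
    ContDiffAt ℝ ∞ (fun y => Real.log (generator N K lam γ h y)) z := by
  have h1 : ContDiffAt ℝ ∞ (fun y => lam * -Real.log (1 - bigX N K h y)
      + (γ + N / K) * -Real.log (h (zPart y))) z :=
    (contDiffAt_const.mul ((contDiffAt_one_sub_bigX hs h0).log (sub_pos.mpr hX).ne').neg).add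
      (contDiffAt_const.mul ((contDiffAt_comp_zPart hs).log h0.ne').neg)
  refine h1.congr_of_eventuallyEq ?_
  filter_upwards [eventually_pos_and_lt hs h0 hX] with y hy
  exact log_generator hy.1 hy.2

lemma jet_logC_generator (hs : ContDiffAt ℝ ∞ h (zPart z)) (h0 : 0 < h (zPart z))
    (hX : bigX N K h z < 1) (v u : κ ⊕ Fin N → ℂ) :
    jet v u (logC (generator N K lam γ h)) z
      = Jet.const (Jet.const (lam : ℂ)) * jet v u (negLog fun y => 1 - bigX N K h y) z
      + Jet.const (Jet.const ((γ + N / K : ℝ) : ℂ)) * jet (zPart v) (zPart u) (negLog h)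
        (zPart z) := by
  have s1 : SmoothAt (negLog fun y => 1 - bigX N K h y) z :=
    smoothAt_negLog (contDiffAt_one_sub_bigX hs h0) (sub_pos.mpr hX)
  have s2 : SmoothAt (fun y => negLog h (zProj κ N y)) z :=
    smoothAt_negLog (contDiffAt_comp_zPart hs) h0
  rw [jet_congr (logC_generator_eventuallyEq hs h0 hX),
    jet_add (contDiffAt_const.mul s1) (contDiffAt_const.mul s2), jet_const_mul _ s1,
    jet_const_mul _ s2, jet_comp_clm (zProj κ N) (smoothAt_negLog hs h0)]
  rfl

/-- The jets of `X = |W|² h^(-1/K)`. -/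
lemma jet_bigX (hs : ContDiffAt ℝ ∞ h (zPart z)) (h0 : 0 < h (zPart z)) (v u : κ ⊕ Fin N → ℂ) :
    jet v u (fun y => (bigX N K h y : ℂ)) z
      = (∑ j : Fin N, Jet.hol ⟨z (Sum.inr j), v (Sum.inr j), u (Sum.inr j)⟩
          * Jet.ahol ⟨z (Sum.inr j), v (Sum.inr j), u (Sum.inr j)⟩)
        * Jet.exp (Jet.const (Jet.const ((1 / K : ℝ) : ℂ))
          * jet (zPart v) (zPart u) (negLog h) (zPart z)) := by
  have s2 : SmoothAt (fun y => negLog h (zProj κ N y)) z :=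
    smoothAt_negLog (contDiffAt_comp_zPart hs) h0
  have s3 : ∀ j : Fin N, SmoothAt (wProj κ j) z := fun j =>
    ((wProj κ j).restrictScalars ℝ).contDiff.contDiffAt
  have s4 : ∀ j : Fin N, SmoothAt (fun y => star (wProj κ j y)) z := fun j =>
    Complex.conjCLE.contDiff.contDiffAt.comp z (s3 j)
  have s5 : SmoothAt (fun y => ((1 / K : ℝ) : ℂ) * negLog h (zProj κ N y)) z :=
    contDiffAt_const.mul s2
  have s6 : ∀ j ∈ (Finset.univ : Finset (Fin N)),
      SmoothAt (⇑(wProj κ j) * fun y => star (wProj κ j y)) z :=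
    fun j _ => smoothAt_mul (s3 j) (s4 j)
  have e : (fun y => (bigX N K h y : ℂ)) =ᶠ[𝓝 z]
      (fun y => ∑ j : Fin N, (⇑(wProj κ j) * fun y => star (wProj κ j y)) y)
        * fun y => Complex.exp (((1 / K : ℝ) : ℂ) * negLog h (zProj κ N y)) := by
    filter_upwards [(contDiffAt_comp_zPart hs).continuousAt.eventually (lt_mem_nhds h0)] with y hy
    have h1 : Complex.exp (((1 / K : ℝ) : ℂ) * negLog h (zProj κ N y))
        = ((h (zPart y) ^ (-(1 / K)) : ℝ) : ℂ) := by
      rw [negLog, zProj_apply, Real.rpow_def_of_pos hy, ← Complex.ofReal_mul,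
        ← Complex.ofReal_exp]
      congr 2; ring
    simp only [bigX, Pi.mul_apply]
    rw [h1, sum_mul_star_eq, ← Complex.ofReal_mul]
    rfl
  rw [jet_congr e, jet_mul (ContDiffAt.sum s6) (ContDiffAt.cexp s5), jet_exp s5,
    jet_const_mul _ s2, jet_comp_clm (zProj κ N) (smoothAt_negLog hs h0), jet_sum _ _ s6]
  congr 1
  refine Finset.sum_congr rfl fun j _ => ?_
  rw [jet_mul (s3 j) (s4 j), jet_clm, jet_star_clm]
  rfl

/-- The holomorphic 2-jet of the curve in the fibre coordinate `Wⱼ`, multiplied by the holomorphic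
factor of `h^(-1/K)`. Here `k = 1/K` and `A` is the jet of `-log h`; half of its constant term goes
into each of the holomorphic and the antiholomorphic factor. -/
def fibreJet (k : ℂ) (A : Jet.Jet2) (z v u : κ ⊕ Fin N → ℂ) (j : Fin N) : Jet ℂ :=
  Jet.expWith (Complex.exp (k * A.c0.c0 / 2)) (Jet.const k * A.c0)
    * ⟨z (Sum.inr j), v (Sum.inr j), u (Sum.inr j)⟩

/-- The jet of `1 - X`, with `X = |w|² e^ψ` for the rescaled fibre coordinates `w` and a `ψ`
without pure terms. -/
lemma exp_neg_jet_one_sub_bigX (hs : ContDiffAt ℝ ∞ h (zPart z)) (h0 : 0 < h (zPart z))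
    (hX : bigX N K h z < 1) (v u : κ ⊕ Fin N → ℂ) {A : Jet.Jet2} {k : ℂ}
    (hA : A = jet (zPart v) (zPart u) (negLog h) (zPart z)) (hk : k = ((1 / K : ℝ) : ℂ)) :
    Jet.exp (-jet v u (negLog fun y => 1 - bigX N K h y) z)
      = 1 - (∑ j, Jet.hol (fibreJet k A z v u j) * Jet.ahol (fibreJet k A z v u j))
        * Jet.expMixed (k * A.c1.c1) (k * A.c1.c2) (k * A.c2.c1) (k * A.c2.c2) := by
  have hsX := contDiffAt_bigX (N := N) (K := K) hs h0
  have hkr : (starRingEnd ℂ) k = k := by rw [hk]; exact Complex.conj_ofReal _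
  have hr := negLog_real h
  have hj0 : star A.c0.c0 = A.c0.c0 := by rw [hA]; exact hr _
  have hj1 : A.c1.c0 = star A.c0.c1 := by rw [hA]; exact jet_c1_c0 hr
  have hj2 : A.c2.c0 = star A.c0.c2 := by rw [hA]; exact jet_c2_c0 hr
  have e1 : Jet.exp (Jet.const (Jet.const k) * A)
      = Jet.hol (Jet.expWith (Complex.exp (k * A.c0.c0 / 2)) (Jet.const k * A.c0))
        * Jet.ahol (Jet.expWith (Complex.exp (k * A.c0.c0 / 2)) (Jet.const k * A.c0))
        * Jet.expMixed (k * A.c1.c1) (k * A.c1.c2) (k * A.c2.c1) (k * A.c2.c2) := by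
    have hj0' : (starRingEnd ℂ) A.c0.c0 = A.c0.c0 := hj0
    have := Jet.exp_eq_hol_mul_ahol (a := Jet.const (Jet.const k) * A)
      (by simp [hkr, hj0']) (by simp [hkr, hj1]) (by simp [hkr, hj2])
    simpa using this
  have e2 : jet v u (fun y => ((1 - bigX N K h y : ℝ) : ℂ)) z
      = 1 - jet v u (fun y => (bigX N K h y : ℂ)) z := by
    have h1 : (fun y => ((1 - bigX N K h y : ℝ) : ℂ))
        = (fun _ => (1 : ℂ)) + fun y => -(bigX N K h y : ℂ) := by
      ext y; simp [sub_eq_add_neg]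
    rw [h1, jet_add contDiffAt_const (smoothAt_neg (smoothAt_ofReal hsX)),
      jet_neg (smoothAt_ofReal hsX), jet_const, map_one, map_one, sub_eq_add_neg]
  rw [← jet_ofReal_eq_exp (contDiffAt_one_sub_bigX hs h0) (sub_pos.mpr hX), e2, jet_bigX hs h0,
    ← hA, ← hk, e1, Finset.sum_mul, Finset.sum_mul]
  congr 1
  refine Finset.sum_congr rfl fun j _ => ?_
  rw [fibreJet, map_mul, map_mul]
  ring

lemma sum_fibreJet_c0 (h0 : 0 < h (zPart z)) (v u : κ ⊕ Fin N → ℂ) {A : Jet.Jet2} {k : ℂ}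
    (hA : A = jet (zPart v) (zPart u) (negLog h) (zPart z)) (hk : k = ((1 / K : ℝ) : ℂ)) :
    ∑ j, (fibreJet k A z v u j).c0 * star (fibreJet k A z v u j).c0
      = (bigX N K h z : ℂ) := by
  have hA0 : A.c0.c0 = ((-Real.log (h (zPart z)) : ℝ) : ℂ) := by rw [hA]; rfl
  have e : Complex.exp (k * A.c0.c0 / 2)
      = ((Real.exp (1 / K * -Real.log (h (zPart z)) / 2) : ℝ) : ℂ) := by
    rw [hA0, hk]; push_cast; rfl
  have e2 : h (zPart z) ^ (-(1 / K)) = Real.exp (1 / K * -Real.log (h (zPart z)) / 2) ^ 2 := by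
    rw [Real.rpow_def_of_pos h0, ← Real.exp_nat_mul]
    congr 1; push_cast; ring
  rw [sum_mul_star_eq, bigX, e2, wNormSq, Finset.sum_mul]
  congr 1
  refine Finset.sum_congr rfl fun j _ => ?_
  simp only [fibreJet, Jet.mul_c0, Jet.expWith, e, norm_mul, Complex.norm_real, mul_pow,
    Real.norm_eq_abs, sq_abs]
  ring

end HartogsMetric

section HartogsCurvature

open Filter Topology

set_option linter.unusedSectionVars false

variable {κ : Type} [Fintype κ] [DecidableEq κ] {N : ℕ}
variable {K lam γ κ₀ a₀ : ℝ} {h : (κ → ℂ) → ℝ} {z : κ ⊕ Fin N → ℂ}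

/-- The holomorphic factor `g = 1 + g₁ s + g₂ s² / 2` for which `|g|² (1 - |w|²)` has no pure
terms, where `m = 1 - |w(0)|²`. -/
def clearing (m : ℂ) (w : Fin N → Jet ℂ) : Jet ℂ :=
  ⟨1, (∑ j, (w j).c1 * star (w j).c0) / m,
    (∑ j, (w j).c2 * star (w j).c0
      + 2 * ((∑ j, (w j).c1 * star (w j).c0) / m) * ∑ j, (w j).c1 * star (w j).c0) / m⟩

lemma clearing_c1 {m : ℂ} {w : Fin N → Jet ℂ} (hm0 : m ≠ 0)
    (hm : m = 1 - ∑ j, (w j).c0 * star (w j).c0) :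
    (clearing m w).c1 = ∑ j, (clearing m w * w j).c1 * star (w j).c0 := by
  have h0 : (clearing m w).c0 = 1 := rfl
  have h1 : m * (clearing m w).c1 = ∑ j, (w j).c1 * star (w j).c0 := mul_div_cancel₀ _ hm0
  have h2 : ∑ j, (clearing m w * w j).c1 * star (w j).c0 = ∑ j, (w j).c1 * star (w j).c0
      + (clearing m w).c1 * ∑ j, (w j).c0 * star (w j).c0 := by
    rw [Finset.mul_sum, ← Finset.sum_add_distrib]
    refine Finset.sum_congr rfl fun j _ => ?_
    rw [Jet.mul_c1, h0]; ring
  rw [h2, ← h1, hm]; ring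

lemma clearing_c2 {m : ℂ} {w : Fin N → Jet ℂ} (hm0 : m ≠ 0)
    (hm : m = 1 - ∑ j, (w j).c0 * star (w j).c0) :
    (clearing m w).c2 = ∑ j, (clearing m w * w j).c2 * star (w j).c0 := by
  have h0 : (clearing m w).c0 = 1 := rfl
  have h1 : m * (clearing m w).c2 = ∑ j, (w j).c2 * star (w j).c0
      + 2 * (clearing m w).c1 * ∑ j, (w j).c1 * star (w j).c0 := mul_div_cancel₀ _ hm0
  have h2 : ∑ j, (clearing m w * w j).c2 * star (w j).c0 = (∑ j, (w j).c2 * star (w j).c0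
      + 2 * (clearing m w).c1 * ∑ j, (w j).c1 * star (w j).c0)
      + (clearing m w).c2 * ∑ j, (w j).c0 * star (w j).c0 := by
    rw [Finset.mul_sum, Finset.mul_sum, ← Finset.sum_add_distrib, ← Finset.sum_add_distrib]
    refine Finset.sum_congr rfl fun j _ => ?_
    rw [Jet.mul_c2, h0]; ring
  rw [h2, ← h1, hm]; ring

/-- The mixed jets of `-log (1 - X)` in real terms. Here `t` is the fibre curve after both
normalisations, by the holomorphic factors of `h^(-1/K)` and of `1 - X`, and the last two estimates
are the Cauchy-Schwarz inequality for `gₐ = ⟨tₐ, w₀⟩`. -/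
lemma fibre_mixed (hs : ContDiffAt ℝ ∞ h (zPart z)) (h0 : 0 < h (zPart z))
    (hX : bigX N K h z < 1) (v u : κ ⊕ Fin N → ℂ) {A a : Jet.Jet2} {k m : ℝ} {g : Jet ℂ}
    {t : Fin N → Jet ℂ}
    (hA : A = jet (zPart v) (zPart u) (negLog h) (zPart z)) (hk : k = 1 / K)
    (hm : m = 1 - bigX N K h z) (ha : a = jet v u (negLog fun y => 1 - bigX N K h y) z)
    (hg : g = clearing (m : ℂ) (fibreJet (k : ℂ) A z v u))
    (ht : ∀ j, t j = g * fibreJet (k : ℂ) A z v u j) :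
    m * a.c1.c1.re = ∑ j, ‖(t j).c1‖ ^ 2 + bigX N K h z * (k * A.c1.c1.re) - ‖g.c1‖ ^ 2 ∧
    m * (a.c2.c2.re - 2 * a.c1.c1.re ^ 2) = ∑ j, ‖(t j).c2‖ ^ 2
      + bigX N K h z * (k * A.c2.c2.re + 2 * (k * A.c1.c1.re) ^ 2)
      + 4 * (k * A.c1.c1.re) * ∑ j, ‖(t j).c1‖ ^ 2
      + 4 * (g.c1 * (k * A.c2.c1)).re - ‖g.c2‖ ^ 2 ∧
    ‖g.c1‖ ^ 2 ≤ (∑ j, ‖(t j).c1‖ ^ 2) * bigX N K h z ∧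
    ‖g.c2‖ ^ 2 ≤ (∑ j, ‖(t j).c2‖ ^ 2) * bigX N K h z := by
  have hm0 : m ≠ 0 := by rw [hm]; exact (sub_pos.mpr hX).ne'
  have hmc : (m : ℂ) ≠ 0 := by exact_mod_cast hm0
  have hk' : (k : ℂ) = ((1 / K : ℝ) : ℂ) := by rw [hk]
  have hsum := sum_fibreJet_c0 h0 v u hA hk'
  have hmsum : (m : ℂ) = 1 - ∑ j, (fibreJet (k : ℂ) A z v u j).c0
      * star (fibreJet (k : ℂ) A z v u j).c0 := by
    rw [hsum, hm]; push_cast; rfl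
  have hexp := exp_neg_jet_one_sub_bigX hs h0 hX v u hA hk'
  rw [← ha] at hexp
  have hg0 : g.c0 = 1 := by rw [hg]; rfl
  have hg1 : g.c1 = ∑ j, (t j).c1 * star (fibreJet (k : ℂ) A z v u j).c0 := by
    simp only [ht, hg]; exact clearing_c1 hmc hmsum
  have hg2 : g.c2 = ∑ j, (t j).c2 * star (fibreJet (k : ℂ) A z v u j).c0 := by
    simp only [ht, hg]; exact clearing_c2 hmc hmsum
  have hx : ∑ j, ‖(fibreJet (k : ℂ) A z v u j).c0‖ ^ 2 = bigX N K h z := by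
    rw [sum_mul_star_eq] at hsum
    exact_mod_cast hsum
  have hmain := Jet.neg_log_one_sub (g := g) hm0 hmsum hexp hg0 (by simpa only [ht] using hg1)
    (by simpa only [ht] using hg2)
  simp only [← ht] at hmain
  rw [hsum, sum_mul_star_eq, sum_mul_star_eq] at hmain
  obtain ⟨i1, i2⟩ := hmain
  have hA11 : ((A.c1.c1.re : ℝ) : ℂ) = A.c1.c1 := by
    rw [hA]
    exact Complex.conj_eq_iff_re.mp (jet_c1_c1 (smoothAt_negLog hs h0) (negLog_real h))
  have ha11 : ((a.c1.c1.re : ℝ) : ℂ) = a.c1.c1 := by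
    rw [ha]
    exact Complex.conj_eq_iff_re.mp (jet_c1_c1 (smoothAt_negLog (contDiffAt_one_sub_bigX hs h0)
      (sub_pos.mpr hX)) (negLog_real _))
  have hA12 : A.c1.c2 = star A.c2.c1 := by
    rw [hA, jet_c2_c1 (smoothAt_negLog hs h0) (negLog_real h), star_star]
  have hgn : ∀ c : ℂ, c * star c = ((‖c‖ ^ 2 : ℝ) : ℂ) := fun c => by
    rw [Complex.star_def, Complex.mul_conj']; push_cast; rfl
  refine ⟨?_, ?_, ?_, ?_⟩
  · rw [hgn, ← hA11, ← ha11] at i1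
    exact_mod_cast i1
  · have hcross : g.c1 * (k * A.c2.c1) + star g.c1 * (k * A.c1.c2)
        = ((2 * (g.c1 * (k * A.c2.c1)).re : ℝ) : ℂ) := by
      rw [hA12]
      have : star g.c1 * ((k : ℂ) * star A.c2.c1)
          = (starRingEnd ℂ) (g.c1 * (k * A.c2.c1)) := by simp
      rw [this, Complex.add_conj]
    rw [hgn, ← hA11, ← ha11, hcross] at i2
    have i3 := congrArg Complex.re i2
    have e1 : ((m : ℂ) * (a.c2.c2 - 2 * ((a.c1.c1.re : ℝ) : ℂ) ^ 2)).re
        = m * (a.c2.c2.re - 2 * a.c1.c1.re ^ 2) := by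
      rw [Complex.re_ofReal_mul]
      norm_cast
    have e2 : ((bigX N K h z : ℂ) * (k * A.c2.c2 + 2 * ((k : ℂ) * (A.c1.c1.re : ℝ)) ^ 2)).re
        = bigX N K h z * (k * A.c2.c2.re + 2 * (k * A.c1.c1.re) ^ 2) := by
      rw [Complex.re_ofReal_mul, Complex.add_re, Complex.re_ofReal_mul]
      norm_cast
    rw [e1] at i3
    simp only [Complex.add_re, Complex.sub_re] at i3
    rw [e2] at i3
    have e3 : (4 * ((k : ℂ) * (A.c1.c1.re : ℝ)) * ((∑ j, ‖(t j).c1‖ ^ 2 : ℝ) : ℂ)).re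
        = 4 * (k * A.c1.c1.re) * ∑ j, ‖(t j).c1‖ ^ 2 := by norm_cast
    have e4 : (2 * ((2 * (g.c1 * (k * A.c2.c1)).re : ℝ) : ℂ)).re
        = 4 * (g.c1 * (k * A.c2.c1)).re := by
      rw [← Complex.ofReal_ofNat, ← Complex.ofReal_mul, Complex.ofReal_re]; ring
    rw [e3, e4, Complex.ofReal_re, Complex.ofReal_re] at i3
    exact i3
  · rw [hg1, ← hx]; exact norm_sum_mul_star_sq_le _ _ _
  · rw [hg2, ← hx]; exact norm_sum_mul_star_sq_le _ _ _

lemma jet_zero_velocity (φ : (κ → ℂ) → ℂ) (U ζ : κ → ℂ) :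
    (jet 0 U φ ζ).c1.c1 = 0 ∧ (jet 0 U φ ζ).c0.c1 = 0 := by
  have h0 : ∀ (σ : ℝ) (f : (κ → ℂ) → ℂ), wd σ 0 f = 0 := fun σ f => by ext y; simp [wd]
  simp [jet, hjet, h0]

lemma BaseBounds.velocity_nonneg (hb : BaseBounds h (zPart z) κ₀ a₀) (V U : κ → ℂ) :
    0 ≤ (jet V U (negLog h) (zPart z)).c1.c1.re := by
  rcases eq_or_ne V 0 with rfl | hV
  · rw [(jet_zero_velocity _ _ _).1, Complex.zero_re]
  · exact (hb.velocity_pos V hV).le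

/-- The fibre potential has nonnegative Levi form, positive on vertical vectors. -/
lemma fibre_velocity (hK : 0 < K) (hb : BaseBounds h (zPart z) κ₀ a₀) (hX : bigX N K h z < 1)
    (v : κ ⊕ Fin N → ℂ) :
    0 ≤ (jet v 0 (negLog fun y => 1 - bigX N K h y) z).c1.c1.re ∧
    (zPart v = 0 → v ≠ 0 → 0 < (jet v 0 (negLog fun y => 1 - bigX N K h y) z).c1.c1.re) := by
  have hmpos : 0 < 1 - bigX N K h z := sub_pos.mpr hX
  have hx0 := bigX_nonneg (N := N) (K := K) hb.pos
  obtain ⟨A, hA⟩ : ∃ A, A = jet (zPart v) (zPart (0 : κ ⊕ Fin N → ℂ)) (negLog h) (zPart z) :=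
    ⟨_, rfl⟩
  obtain ⟨g, hg⟩ : ∃ g, g = clearing ((1 - bigX N K h z : ℝ) : ℂ)
    (fibreJet ((1 / K : ℝ) : ℂ) A z v 0) := ⟨_, rfl⟩
  obtain ⟨t, ht⟩ : ∃ t : Fin N → Jet ℂ,
    ∀ j, t j = g * fibreJet ((1 / K : ℝ) : ℂ) A z v 0 j := ⟨_, fun _ => rfl⟩
  obtain ⟨i1, -, i3, -⟩ := fibre_mixed hb.smooth hb.pos hX v 0 hA rfl rfl rfl hg ht
  have hp : 0 ≤ A.c1.c1.re := by rw [hA]; exact hb.velocity_nonneg _ _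
  have hn1 : 0 ≤ ∑ j, ‖(t j).c1‖ ^ 2 := Finset.sum_nonneg fun _ _ => sq_nonneg _
  have hxp : 0 ≤ bigX N K h z * (1 / K * A.c1.c1.re) := by positivity
  have key : (1 - bigX N K h z) * ∑ j, ‖(t j).c1‖ ^ 2 ≤ (1 - bigX N K h z)
      * (jet v 0 (negLog fun y => 1 - bigX N K h y) z).c1.c1.re := by
    rw [i1]; linarith
  have hle := le_of_mul_le_mul_left key hmpos
  refine ⟨hn1.trans hle, fun hV hv => lt_of_lt_of_le (lt_of_le_of_ne hn1 fun hz => hv ?_) hle⟩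
  have ht0 : ∀ j, (t j).c1 = 0 := fun j => by
    have := (Finset.sum_eq_zero_iff_of_nonneg fun _ _ => sq_nonneg _).mp hz.symm j
      (Finset.mem_univ j)
    simpa using this
  have hg1 : g.c1 = 0 := by
    rw [← hz, zero_mul] at i3
    simpa using i3
  have hA1 : A.c0.c1 = 0 := by rw [hA, hV]; exact (jet_zero_velocity _ _ _).2
  have hg0 : g.c0 = 1 := by rw [hg]; rfl
  ext i
  rcases i with i | j
  · exact congrFun hV i
  · have := ht0 j
    rw [ht] at this
    simpa [fibreJet, Jet.expWith, hg1, hg0, hA1, Complex.exp_ne_zero] using this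

/-- A Cartan-Hartogs domain over a base with pinched negative holomorphic sectional curvature:
the generating function defines a Kähler metric with pinched negative holomorphic sectional
curvature. The potential is `λ` times the fibre potential `-log (1 - X)` plus `γ + N/K` times the
base potential `-log h`, and both are controlled along each curve. -/
theorem hartogs_curvature (hK : 0 < K) (hlam : 0 < lam) (hc : 0 < γ + N / K) (hκ : 0 < κ₀)
    (ha : 0 ≤ a₀) (hb : BaseBounds h (zPart z) κ₀ a₀) (hz : wNormSq z ^ K < h (zPart z)) :
    (0 < generator N K lam γ h z ∧
      ContDiffAt ℝ ∞ (fun w => Real.log (generator N K lam γ h w)) z ∧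
      (metricMatrix (generator N K lam γ h) z).PosDef) ∧
    ∀ v, v ≠ 0 →
      -(6 / lam + (6 * (1 / K) + a₀) / (γ + N / K) + a₀ / (γ + N / K))
        ≤ holSecCurvature (metricMatrix (generator N K lam γ h)) z v ∧
      holSecCurvature (metricMatrix (generator N K lam γ h)) z v
        ≤ -min (1 / lam) (κ₀ / (2 * (γ + N / K))) := by
  have hX := bigX_lt_one hK hb.pos hz
  have hx0 := bigX_nonneg (N := N) (K := K) hb.pos
  have hmpos : 0 < 1 - bigX N K h z := sub_pos.mpr hX
  have hsm := contDiffAt_log_generator (N := N) (K := K) (lam := lam) (γ := γ) hb.smooth hb.pos hX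
  have hf : SmoothAt (logC (generator N K lam γ h)) z := smoothAt_ofReal hsm
  have j11 : ∀ v u, (jet v u (logC (generator N K lam γ h)) z).c1.c1.re
      = lam * (jet v u (negLog fun y => 1 - bigX N K h y) z).c1.c1.re
        + (γ + N / K) * (jet (zPart v) (zPart u) (negLog h) (zPart z)).c1.c1.re := fun v u => by
    rw [jet_logC_generator hb.smooth hb.pos hX]
    simp only [Jet.add_c1, Jet.mul_c1, Jet.const_apply_c0, Jet.const_apply_c1, zero_mul, add_zero,
      Complex.add_re, Complex.re_ofReal_mul]
  have j22 : ∀ v u, (jet v u (logC (generator N K lam γ h)) z).c2.c2.re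
      = lam * (jet v u (negLog fun y => 1 - bigX N K h y) z).c2.c2.re
        + (γ + N / K) * (jet (zPart v) (zPart u) (negLog h) (zPart z)).c2.c2.re := fun v u => by
    rw [jet_logC_generator hb.smooth hb.pos hX]
    simp only [Jet.add_c2, Jet.mul_c2, Jet.const_apply_c0, Jet.const_apply_c1, Jet.const_apply_c2,
      zero_mul, mul_zero, add_zero, Complex.add_re, Complex.re_ofReal_mul]
  have hpos : ∀ v, v ≠ 0 → 0 < (jet v 0 (logC (generator N K lam γ h)) z).c1.c1.re := by
    intro v hv
    rw [j11]
    obtain ⟨h1, h2⟩ := fibre_velocity hK hb hX v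
    rcases eq_or_ne (zPart v) 0 with hV | hV
    · exact add_pos_of_pos_of_nonneg (mul_pos hlam (h2 hV hv))
        (mul_nonneg hc.le (hb.velocity_nonneg _ _))
    · exact add_pos_of_nonneg_of_pos (mul_nonneg hlam.le h1)
        (mul_pos hc (hb.velocity_pos _ hV))
  refine ⟨⟨generator_pos hb.pos hX, hsm, metric_posDef hf hpos⟩,
    curvature_bounds hf hpos ?_ ?_⟩
  · -- the upper bound for the curvature holds along every curve
    intro v u hv
    obtain ⟨A, hA⟩ : ∃ A, A = jet (zPart v) (zPart u) (negLog h) (zPart z) := ⟨_, rfl⟩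
    obtain ⟨g, hg⟩ : ∃ g, g = clearing ((1 - bigX N K h z : ℝ) : ℂ)
      (fibreJet ((1 / K : ℝ) : ℂ) A z v u) := ⟨_, rfl⟩
    obtain ⟨t, ht⟩ : ∃ t : Fin N → Jet ℂ,
      ∀ j, t j = g * fibreJet ((1 / K : ℝ) : ℂ) A z v u j := ⟨_, fun _ => rfl⟩
    obtain ⟨-, i2, i3, i4⟩ := fibre_mixed hb.smooth hb.pos hX v u hA rfl rfl rfl hg ht
    have hp : 0 ≤ A.c1.c1.re := by rw [hA]; exact hb.velocity_nonneg _ _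
    have hr : ∀ α : ℂ, 0 ≤ 1 / K * A.c2.c2.re + 2 * (α * (((1 / K : ℝ) : ℂ) * A.c2.c1)).re
        + ‖α‖ ^ 2 * (1 / K * A.c1.c1.re) := by
      intro α
      have h1 := jet_c2_c2_add_smul (smoothAt_negLog hb.smooth hb.pos) (negLog_real h)
        (zPart v) (zPart u) α
      have h2 := hb.lower (zPart v) (zPart u + α • zPart v)
      rw [h1, ← hA] at h2
      have h3 := (mul_nonneg hκ.le (sq_nonneg _)).trans h2
      have h4 := mul_nonneg (one_div_pos.mpr hK).le h3
      have h5 : (α * (((1 / K : ℝ) : ℂ) * A.c2.c1)).re = 1 / K * (α * A.c2.c1).re := by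
        rw [mul_left_comm, Complex.re_ofReal_mul]
      rw [h5]
      linarith
    have hY := fibre_nonneg hx0 hX.le (by positivity : 0 ≤ 1 / K * A.c1.c1.re)
      (Finset.sum_nonneg fun _ _ => sq_nonneg _) (Finset.sum_nonneg fun _ _ => sq_nonneg _)
      i3 i4 hr
    rw [← i2] at hY
    have hY' := nonneg_of_mul_nonneg_right hY hmpos
    have := lower_arith hlam hc hκ hY' (hb.lower (zPart v) (zPart u))
      (y := (jet v u (negLog fun y => 1 - bigX N K h y) z).c1.c1.re)
    rw [j11, j22]
    linarith
  · -- the lower bound needs one good curve: `U` kills the cross term of the base potential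
    intro v hv
    obtain ⟨U, hU1, hU2⟩ := hb.upper (zPart v)
    obtain ⟨A, hA⟩ : ∃ A, A = jet (zPart v) U (negLog h) (zPart z) := ⟨_, rfl⟩
    -- the acceleration in the fibre is chosen so that the normalised one vanishes
    obtain ⟨f, hf⟩ : ∃ f, f = Jet.expWith (Complex.exp (((1 / K : ℝ) : ℂ) * A.c0.c0 / 2))
      (Jet.const ((1 / K : ℝ) : ℂ) * A.c0) := ⟨_, rfl⟩
    have hf0 : f.c0 ≠ 0 := by rw [hf]; exact Complex.exp_ne_zero _
    obtain ⟨b, hbdef⟩ : ∃ b : ℂ, b = (∑ j : Fin N,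
      (f.c0 * v (Sum.inr j) + f.c1 * z (Sum.inr j)) * star (f.c0 * z (Sum.inr j)))
        / ((1 - bigX N K h z : ℝ) : ℂ) := ⟨_, rfl⟩
    obtain ⟨W, hW⟩ : ∃ W : Fin N → ℂ, ∀ j, f.c0 * W j
        = -(2 * b * (f.c0 * v (Sum.inr j) + f.c1 * z (Sum.inr j)))
          - 2 * (f.c1 * v (Sum.inr j)) - f.c2 * z (Sum.inr j) :=
      ⟨fun j => (-(2 * b * (f.c0 * v (Sum.inr j) + f.c1 * z (Sum.inr j)))
          - 2 * (f.c1 * v (Sum.inr j)) - f.c2 * z (Sum.inr j)) / f.c0,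
        fun j => mul_div_cancel₀ _ hf0⟩
    refine ⟨Sum.elim U W, ?_⟩
    have hA' : A = jet (zPart v) (zPart (Sum.elim U W)) (negLog h) (zPart z) := hA
    obtain ⟨w, hw⟩ : ∃ w, w = fibreJet ((1 / K : ℝ) : ℂ) A z v (Sum.elim U W) := ⟨_, rfl⟩
    have w0 : ∀ j, (w j).c0 = f.c0 * z (Sum.inr j) := fun j => by rw [hw, hf]; rfl
    have w1 : ∀ j, (w j).c1 = f.c0 * v (Sum.inr j) + f.c1 * z (Sum.inr j) := fun j => by
      rw [hw, hf]; rfl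
    have w2 : ∀ j, (w j).c2 = -(2 * b * (w j).c1) := fun j => by
      have e : (w j).c2 = f.c0 * W j + 2 * (f.c1 * v (Sum.inr j)) + f.c2 * z (Sum.inr j) := by
        rw [hw, hf]; rfl
      rw [e, hW, w1]; ring
    obtain ⟨g, hg⟩ : ∃ g, g = clearing ((1 - bigX N K h z : ℝ) : ℂ) w := ⟨_, rfl⟩
    have hg0 : g.c0 = 1 := by rw [hg]; rfl
    have hg1 : g.c1 = b := by rw [hg, hbdef]; simp only [clearing, w0, w1]
    have hg2 : g.c2 = 0 := by
      have e1 : g.c2 = (∑ j, (w j).c2 * star (w j).c0 + 2 * g.c1 * ∑ j, (w j).c1 * star (w j).c0)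
          / ((1 - bigX N K h z : ℝ) : ℂ) := by rw [hg]; rfl
      have e2 : ∑ j, (w j).c2 * star (w j).c0
          = -(2 * b) * ∑ j, (w j).c1 * star (w j).c0 := by
        rw [Finset.mul_sum]
        exact Finset.sum_congr rfl fun j _ => by rw [w2]; ring
      rw [e1, e2, hg1]; simp
    obtain ⟨t, ht⟩ : ∃ t : Fin N → Jet ℂ, ∀ j, t j = g * w j := ⟨_, fun _ => rfl⟩
    have t2 : ∀ j, (t j).c2 = 0 := fun j => by
      rw [ht, Jet.mul_c2, hg0, hg1, hg2, w2]; ring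
    rw [hw] at hg ht
    obtain ⟨i1, i2, i3, -⟩ := fibre_mixed hb.smooth hb.pos hX v _ hA' rfl rfl rfl hg ht
    have hA21 : A.c2.c1 = 0 := by
      rw [hA, jet_c2_c1 (smoothAt_negLog hb.smooth hb.pos) (negLog_real h), hU1, star_zero]
    have hp : 0 ≤ A.c1.c1.re := by rw [hA]; exact hb.velocity_nonneg _ _
    rw [← hA] at hU2
    simp only [t2, hg2, hA21, mul_zero, Complex.zero_re, norm_zero, sub_zero, add_zero,
      ne_eq, OfNat.ofNat_ne_zero, not_false_eq_true, zero_pow, Finset.sum_const_zero,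
      zero_add] at i2
    have := upper_arith hlam hc (one_div_pos.mpr hK) ha hmpos rfl hx0 hp
      (Finset.sum_nonneg fun _ _ => sq_nonneg _) i3 i1 hU2 i2
    rw [j11, j22, ← hA']
    linarith

end HartogsCurvature

/-! ### The domains of rectangular matrices -/

section MatrixJets

variable {m n l : ℕ}

/-- The matrix of jets with the given matrices of derivatives. -/
def jetMat (A B C : Matrix (Fin m) (Fin n) ℂ) : Matrix (Fin m) (Fin n) (Jet ℂ) :=
  Matrix.of fun i j => ⟨A i j, B i j, C i j⟩

lemma jetMat_mul (A B C : Matrix (Fin m) (Fin n) ℂ) (A' B' C' : Matrix (Fin n) (Fin l) ℂ) :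
    jetMat A B C * jetMat A' B' C'
      = jetMat (A * A') (A * B' + B * A') (A * C' + 2 • (B * B') + C * A') := by
  ext i j <;>
  simp [jetMat, Matrix.mul_apply, Finset.sum_add_distrib, Finset.mul_sum]

/-- The product of a holomorphic matrix with its conjugate transpose, on the level of jets. -/
def gramJet (A : Matrix (Fin m) (Fin n) (Jet ℂ)) : Matrix (Fin m) (Fin m) Jet.Jet2 :=
  A.map Jet.hol * Aᵀ.map Jet.ahol

lemma gramJet_mul (A : Matrix (Fin l) (Fin m) (Jet ℂ)) (B : Matrix (Fin m) (Fin n) (Jet ℂ)) :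
    A.map Jet.hol * gramJet B * Aᵀ.map Jet.ahol = gramJet (A * B) := by
  simp only [gramJet, Matrix.transpose_mul, Matrix.map_mul, Matrix.mul_assoc]

lemma gramJet_apply (A B C : Matrix (Fin m) (Fin n) ℂ) (i j : Fin m) :
    gramJet (jetMat A B C) i j = ⟨⟨(A * Aᴴ) i j, (B * Aᴴ) i j, (C * Aᴴ) i j⟩,
      ⟨(A * Bᴴ) i j, (B * Bᴴ) i j, (C * Bᴴ) i j⟩,
      ⟨(A * Cᴴ) i j, (B * Cᴴ) i j, (C * Cᴴ) i j⟩⟩ := by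
  ext <;> simp [gramJet, jetMat, Matrix.mul_apply]

/-- The element `s s̄` of the jet ring. -/
def ss : Jet.Jet2 := ⟨0, ⟨0, 1, 0⟩, 0⟩

lemma ss_mul (x : Jet.Jet2) : ss * x = ⟨0, ⟨0, x.c0.c0, 2 * x.c0.c1⟩,
    ⟨0, 2 * x.c1.c0, 4 * x.c1.c1⟩⟩ := by
  ext <;> simp [ss]
  ring

lemma ss_cube : ss ^ 3 = 0 := by
  rw [pow_succ, sq, mul_assoc, ss_mul, ss_mul]
  ext <;> simp [ss]

/-- The determinant of `1 - r M` when `r³ = 0`: the coefficient of `r²` is read off from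
`det (1 - r M) det (1 + r M) = det (1 - r² M²)`. -/
lemma det_one_sub_smul_of_cube_eq_zero {R : Type} [CommRing R] (r : R) (hr : r ^ 3 = 0)
    (M : Matrix (Fin m) (Fin m) R) :
    ∃ e : R, (1 - r • M).det = 1 - r * M.trace + r ^ 2 * e ∧
      2 * (r ^ 2 * e) = r ^ 2 * (M.trace ^ 2 - (M * M).trace) := by
  obtain ⟨P, hP⟩ : ∃ P : Polynomial R, ∀ x : R, (1 + x • M).det
      = 1 + M.trace * x + P.eval x * x ^ 2 := ⟨_, fun x => Matrix.det_one_add_smul x M⟩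
  obtain ⟨c, hc⟩ : ∃ c, P.eval r = P.eval 0 + r * c := by
    obtain ⟨c, hc⟩ := P.sub_dvd_eval_sub r 0
    exact ⟨c, by rw [sub_zero] at hc; rw [← hc]; ring⟩
  obtain ⟨d, hd⟩ : ∃ d, P.eval (-r) = P.eval 0 + r * d := by
    obtain ⟨d, hd⟩ := P.sub_dvd_eval_sub (-r) 0
    exact ⟨-d, by rw [sub_zero] at hd; linear_combination hd⟩
  obtain ⟨Q, hQ⟩ : ∃ Q : R, (1 + (-(r ^ 2)) • (M * M)).det
      = 1 + (M * M).trace * (-(r ^ 2)) + Q * (-(r ^ 2)) ^ 2 :=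
    ⟨_, Matrix.det_one_add_smul _ _⟩
  have h1 := hP r
  have h2 := hP (-r)
  rw [hc] at h1
  rw [hd] at h2
  have h3 : (1 + (-r) • M).det * (1 + r • M).det = (1 + (-(r ^ 2)) • (M * M)).det := by
    rw [← Matrix.det_mul]
    congr 1
    simp only [add_mul, mul_add, one_mul, mul_one, Matrix.smul_mul, Matrix.mul_smul, smul_smul]
    module
  rw [h1, h2, hQ] at h3
  refine ⟨P.eval 0, ?_, ?_⟩
  · rw [sub_eq_add_neg, ← neg_smul, h2]
    linear_combination d * hr
  · linear_combination h3 + (Q * r - (c + d) - r * P.eval 0 ^ 2 - M.trace * (d - c) * r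
      - r ^ 2 * P.eval 0 * (c + d) - r ^ 3 * c * d) * hr

/-- The mixed jets of a potential `-log h` when `h` is, up to holomorphic and antiholomorphic
factors, `det (1 - Y)` for the Gram matrix `Y` of a curve `s V + s² U / 2` through the origin. As
the curve is `s` times `V + s U / 2`, its Gram matrix is `s s̄` times that of the latter. -/
lemma neg_log_det_mixed {a : Jet.Jet2} {g : Jet ℂ} {V U : Matrix (Fin m) (Fin n) ℂ}
    (h : Jet.hol g * Jet.ahol g * Jet.exp (-a)
      = (1 - ss • gramJet (jetMat V ((1 / 2 : ℂ) • U) 0)).det) :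
    a.c1.c1 = (V * Vᴴ).trace ∧ a.c1.c2 = (U * Vᴴ).trace ∧
    a.c2.c2 = (U * Uᴴ).trace + 2 * (V * Vᴴ * (V * Vᴴ)).trace := by
  obtain ⟨M, hM⟩ : ∃ M, M = gramJet (jetMat V ((1 / 2 : ℂ) • U) 0) := ⟨_, rfl⟩
  obtain ⟨e, he1, he2⟩ := det_one_sub_smul_of_cube_eq_zero ss ss_cube M
  rw [← hM, he1] at h
  have hy : Jet.hol g * Jet.ahol g * Jet.exp (-a)
      = Jet.const (Jet.const 1) * (1 - (ss * M.trace - ss ^ 2 * e)) := by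
    rw [h, map_one, map_one]; ring
  have hc0 : ∀ x : Jet.Jet2, (ss * x).c0 = 0 := fun x => by rw [ss_mul]
  have hc10 : ∀ x : Jet.Jet2, (ss * x).c1.c0 = 0 := fun x => by rw [ss_mul]
  have hc20 : ∀ x : Jet.Jet2, (ss * x).c2.c0 = 0 := fun x => by rw [ss_mul]
  have hsq : ∀ x : Jet.Jet2, ss ^ 2 * x = ⟨0, 0, ⟨0, 0, 4 * x.c0.c0⟩⟩ := fun x => by
    rw [sq, mul_assoc, ss_mul, ss_mul]
    ext <;> simp
  have hfac : ss * M.trace - ss ^ 2 * e = ss * (M.trace - ss * e) := by ring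
  obtain ⟨r1, r2, r3⟩ := Jet.neg_log_mixed one_ne_zero hy (by rw [hfac, hc0])
    (by rw [hfac, hc10]) (by rw [hfac, hc20])
  have t1 : ∀ i j, (M i j).c0.c0 = (V * Vᴴ) i j := fun i j => by rw [hM, gramJet_apply]
  have t2 : ∀ i j, (M i j).c0.c1 = 1 / 2 * (U * Vᴴ) i j := fun i j => by
    rw [hM, gramJet_apply]; simp
  have t3 : ∀ i j, (M i j).c1.c1 = 1 / 4 * (U * Uᴴ) i j := fun i j => by
    rw [hM, gramJet_apply]; simp; ring
  have T1 : M.trace.c0.c0 = (V * Vᴴ).trace := by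
    simp only [Matrix.trace, Matrix.diag_apply, Jet.sum_c0, t1]
  have T2 : 2 * M.trace.c0.c1 = (U * Vᴴ).trace := by
    simp only [Matrix.trace, Matrix.diag_apply, Jet.sum_c0, Jet.sum_c1, t2, ← Finset.mul_sum]
    ring
  have T3 : 4 * M.trace.c1.c1 = (U * Uᴴ).trace := by
    simp only [Matrix.trace, Matrix.diag_apply, Jet.sum_c1, t3, ← Finset.mul_sum]
    ring
  have T4 : (M * M).trace.c0.c0 = (V * Vᴴ * (V * Vᴴ)).trace := by
    simp only [Matrix.trace, Matrix.diag_apply, Jet.sum_c0]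
    refine Finset.sum_congr rfl fun i _ => ?_
    rw [Matrix.mul_apply, Matrix.mul_apply]
    simp only [Jet.sum_c0, Jet.mul_c0, t1]
  have T5 : 2 * (4 * e.c0.c0)
      = 4 * ((V * Vᴴ).trace ^ 2 - (V * Vᴴ * (V * Vᴴ)).trace) := by
    have := congrArg (fun x => x.c2.c2) he2
    simp only [hsq, Jet.sub_c0, sq M.trace, Jet.mul_c0, T1, T4] at this
    have h2 : (2 * (⟨0, 0, ⟨0, 0, 4 * e.c0.c0⟩⟩ : Jet.Jet2)).c2.c2 = 2 * (4 * e.c0.c0) := by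
      simp
    rw [h2] at this
    rw [this]; ring
  have f1 : (ss * M.trace - ss ^ 2 * e).c1.c1 = (V * Vᴴ).trace := by
    rw [hsq, ss_mul, ← T1]; simp
  have f2 : (ss * M.trace - ss ^ 2 * e).c1.c2 = (U * Vᴴ).trace := by
    rw [hsq, ss_mul, ← T2]; simp
  have f3 : (ss * M.trace - ss ^ 2 * e).c2.c2 = (U * Uᴴ).trace - 4 * e.c0.c0 := by
    rw [hsq, ss_mul, ← T3]; simp
  refine ⟨r1.trans f1, r2.trans f2, ?_⟩
  rw [r3, f1, f3]
  linear_combination (-1 / 2 : ℂ) * T5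

end MatrixJets

section MatrixDomains

set_option linter.unusedSectionVars false

variable {m n : ℕ}

open scoped MatrixOrder Matrix.Norms.L2Operator in
lemma posDef_exists_factor {A : Matrix (Fin n) (Fin n) ℂ} (hA : A.PosDef) :
    ∃ B : Matrix (Fin n) (Fin n) ℂ, IsUnit B.det ∧ A = B * Bᴴ := by
  obtain ⟨y, hy⟩ := CStarAlgebra.nonneg_iff_eq_star_mul_self.mp hA.posSemidef.nonneg
  rw [Matrix.star_eq_conjTranspose] at hy
  refine ⟨yᴴ, ?_, by rw [Matrix.conjTranspose_conjTranspose, hy]⟩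
  have h1 := (Matrix.isUnit_iff_isUnit_det _).mp hA.isUnit
  rw [hy, Matrix.det_mul] at h1
  exact isUnit_of_mul_isUnit_left h1

/-- `I - ZᴴZ` is positive definite along with `I - ZZᴴ`, having inverse `I + Zᴴ(I - ZZᴴ)⁻¹Z`. -/
lemma posDef_one_sub_conjTranspose_mul {Z : Matrix (Fin m) (Fin n) ℂ}
    (hZ : (1 - Z * Zᴴ).PosDef) : (1 - Zᴴ * Z).PosDef := by
  have hu := (Matrix.isUnit_iff_isUnit_det _).mp hZ.isUnit
  have h1 : (1 + Zᴴ * (1 - Z * Zᴴ)⁻¹ * Z).PosDef :=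
    Matrix.PosDef.one.add_posSemidef (hZ.inv.posSemidef.conjTranspose_mul_mul_same Z)
  have h2 : (1 - Zᴴ * Z) * (1 + Zᴴ * (1 - Z * Zᴴ)⁻¹ * Z) = 1 := by
    have h3 : Zᴴ * ((1 - Z * Zᴴ) * (1 - Z * Zᴴ)⁻¹) * Z = Zᴴ * Z := by
      rw [Matrix.mul_nonsing_inv _ hu, Matrix.mul_one]
    have h4 : (1 - Zᴴ * Z) * (1 + Zᴴ * (1 - Z * Zᴴ)⁻¹ * Z)
        = 1 - Zᴴ * Z + Zᴴ * ((1 - Z * Zᴴ) * (1 - Z * Zᴴ)⁻¹) * Z := by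
      simp only [Matrix.sub_mul, Matrix.mul_add, Matrix.mul_sub, Matrix.one_mul, Matrix.mul_one,
        Matrix.mul_assoc]
    rw [h4, h3]; abel
  rw [← Matrix.inv_eq_left_inv h2]
  exact h1.inv

lemma ofReal_detNorm (Z : Matrix (Fin m) (Fin n) ℂ) :
    ((detNorm Z : ℝ) : ℂ) = (1 - Z * Zᴴ).det := by
  have h : (1 - Z * Zᴴ)ᴴ = 1 - Z * Zᴴ := by simp
  refine Complex.conj_eq_iff_re.mp ?_
  rw [← Complex.star_def, ← Matrix.det_conjTranspose, h]

lemma detNorm_pos {Z : Matrix (Fin m) (Fin n) ℂ} (hZ : (1 - Z * Zᴴ).PosDef) : 0 < detNorm Z :=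
  (Complex.pos_iff.mp hZ.det_pos).1

/-- The coordinate `z_{ik}`. -/
def entryI (i : Fin m) (k : Fin n) : (IdxI m n → ℂ) →L[ℂ] ℂ :=
  ContinuousLinearMap.proj (i, k)

lemma one_sub_mul_apply (y : IdxI m n → ℂ) (i j : Fin m) :
    (1 - matI y * (matI y)ᴴ : Matrix (Fin m) (Fin m) ℂ) i j
      = (1 : Matrix (Fin m) (Fin m) ℂ) i j
        + -∑ k, (⇑(entryI i k) * fun y => star (entryI j k y)) y := by
  rw [Matrix.sub_apply, sub_eq_add_neg, Matrix.mul_apply]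
  rfl

lemma one_apply_jet (i j : Fin m) : (1 : Matrix (Fin m) (Fin m) Jet.Jet2) i j
    = Jet.const (Jet.const ((1 : Matrix (Fin m) (Fin m) ℂ) i j)) := by
  rcases eq_or_ne i j with rfl | hij
  · rw [Matrix.one_apply_eq, Matrix.one_apply_eq, map_one, map_one]
  · rw [Matrix.one_apply_ne hij, Matrix.one_apply_ne hij, map_zero, map_zero]

variable {ζ : IdxI m n → ℂ}

lemma smoothAt_entryI (i : Fin m) (k : Fin n) : SmoothAt (entryI i k) ζ :=
  ((entryI i k).restrictScalars ℝ).contDiff.contDiffAt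

lemma smoothAt_star_entryI (i : Fin m) (k : Fin n) : SmoothAt (fun y => star (entryI i k y)) ζ :=
  Complex.conjCLE.contDiff.contDiffAt.comp ζ (smoothAt_entryI i k)

lemma smoothAt_sum_entryI (i j : Fin m) :
    SmoothAt (fun y => ∑ k : Fin n, (⇑(entryI i k) * fun y => star (entryI j k y)) y) ζ :=
  ContDiffAt.sum fun k _ => smoothAt_mul (smoothAt_entryI i k) (smoothAt_star_entryI j k)

lemma smoothAt_one_sub_mul (i j : Fin m) :
    SmoothAt (fun y => (1 - matI y * (matI y)ᴴ : Matrix (Fin m) (Fin m) ℂ) i j) ζ := by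
  simp only [one_sub_mul_apply]
  exact contDiffAt_const.add (smoothAt_sum_entryI i j).neg

lemma contDiffAt_detNorm : ContDiffAt ℝ ∞ (fun y : IdxI m n → ℂ => detNorm (matI y)) ζ :=
  Complex.reCLM.contDiff.contDiffAt.comp ζ
    (smoothAt_det _ fun i j => smoothAt_one_sub_mul i j)

lemma jet_detNorm (v u : IdxI m n → ℂ) :
    jet v u (fun y => ((detNorm (matI y) : ℝ) : ℂ)) ζ
      = (1 - gramJet (jetMat (matI ζ) (matI v) (matI u))).det := by
  simp only [ofReal_detNorm]
  rw [jet_det _ fun i j => smoothAt_one_sub_mul i j]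
  congr 1
  ext1 i j
  rw [Matrix.of_apply]
  have h1 : (fun y : IdxI m n → ℂ => (1 - matI y * (matI y)ᴴ : Matrix (Fin m) (Fin m) ℂ) i j)
      = (fun _ => (1 : Matrix (Fin m) (Fin m) ℂ) i j) + fun y =>
        -∑ k, (⇑(entryI i k) * fun y => star (entryI j k y)) y := funext fun y =>
    one_sub_mul_apply y i j
  rw [h1, jet_add contDiffAt_const (smoothAt_neg (smoothAt_sum_entryI i j)),
    jet_neg (smoothAt_sum_entryI i j), jet_const,
    jet_sum _ _ fun k _ => smoothAt_mul (smoothAt_entryI i k) (smoothAt_star_entryI j k),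
    Matrix.sub_apply, sub_eq_add_neg]
  congr 1
  · exact (one_apply_jet i j).symm
  · rw [gramJet, Matrix.mul_apply]
    congr 1
    refine Finset.sum_congr rfl fun k _ => ?_
    rw [jet_mul (smoothAt_entryI i k) (smoothAt_star_entryI j k), jet_clm, jet_star_clm]
    rfl

/-- Normal form of the jets of `-log det (I - ZZᴴ)` along a curve with velocity `V` and
acceleration `U` through an arbitrary point `Z`: they are those of the curve with velocity `PVQ`
and acceleration `P(U + 2VRV)Q` through the origin, where `R = (I - ZᴴZ)⁻¹Zᴴ`. The factors `P` and
`Q` come from factorisations `I - ZZᴴ = CCᴴ` and `I - ZᴴZ = EEᴴ`. -/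
lemma detNorm_mixed (hZ : (1 - matI ζ * (matI ζ)ᴴ).PosDef) :
    ∃ (P : Matrix (Fin m) (Fin m) ℂ) (Q : Matrix (Fin n) (Fin n) ℂ), IsUnit P.det ∧ IsUnit Q.det ∧
      ∀ (v u : IdxI m n → ℂ) (a : Jet.Jet2) (V' U' : Matrix (Fin m) (Fin n) ℂ),
        a = jet v u (negLog fun y => detNorm (matI y)) ζ →
        V' = P * matI v * Q →
        U' = P * (matI u + 2 • (matI v * ((1 - (matI ζ)ᴴ * matI ζ)⁻¹ * (matI ζ)ᴴ) * matI v)) * Q →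
        a.c1.c1 = (V' * V'ᴴ).trace ∧ a.c1.c2 = (U' * V'ᴴ).trace ∧
        a.c2.c2 = (U' * U'ᴴ).trace + 2 * (V' * V'ᴴ * (V' * V'ᴴ)).trace := by
  obtain ⟨Z, hZdef⟩ : ∃ Z, Z = matI ζ := ⟨_, rfl⟩
  rw [← hZdef] at hZ ⊢
  have hZ' := posDef_one_sub_conjTranspose_mul hZ
  obtain ⟨C, hC, hCS⟩ := posDef_exists_factor hZ
  obtain ⟨E, hE, hES⟩ := posDef_exists_factor hZ'
  obtain ⟨T, hT⟩ : ∃ T, T = (1 - Zᴴ * Z)⁻¹ := ⟨_, rfl⟩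
  have hTu : T * (1 - Zᴴ * Z) = 1 := by
    rw [hT]; exact Matrix.nonsing_inv_mul _ ((Matrix.isUnit_iff_isUnit_det _).mp hZ'.isUnit)
  have hTE : IsUnit (T * E).det := by
    rw [Matrix.det_mul]
    refine IsUnit.mul ?_ hE
    rw [hT]; exact Matrix.isUnit_nonsing_inv_det _ ((Matrix.isUnit_iff_isUnit_det _).mp hZ'.isUnit)
  refine ⟨C⁻¹, T * E, Matrix.isUnit_nonsing_inv_det _ hC, hTE, ?_⟩
  rintro v u a V' U' rfl hV' hU'
  rw [← hT] at hU'
  obtain ⟨V, hV⟩ : ∃ V, V = matI v := ⟨_, rfl⟩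
  obtain ⟨U, hU⟩ : ∃ U, U = matI u := ⟨_, rfl⟩
  rw [← hV] at hV' hU'
  rw [← hU] at hU'
  -- multiplying `I - ZZᴴ` by the holomorphic matrix with derivatives `C⁻¹`, `Z₁Zᴴ`, `Z₂Zᴴ` and its
  -- conjugate transpose removes the pure terms
  obtain ⟨Z1, hZ1⟩ : ∃ Z1, Z1 = C⁻¹ * V * T := ⟨_, rfl⟩
  obtain ⟨Z2, hZ2⟩ : ∃ Z2, Z2 = C⁻¹ * (U + 2 • (V * (T * Zᴴ) * V)) * T := ⟨_, rfl⟩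
  have hV1 : V' = Z1 * E := by rw [hV', hZ1]; simp only [Matrix.mul_assoc]
  have hU1 : U' = Z2 * E := by rw [hU', hZ2]; simp only [Matrix.mul_assoc]
  have k1 : Z1 = C⁻¹ * V + Z1 * Zᴴ * Z := by
    have : Z1 * (1 - Zᴴ * Z) = C⁻¹ * V := by rw [hZ1, Matrix.mul_assoc _ T, hTu, Matrix.mul_one]
    rw [← this, Matrix.mul_sub, Matrix.mul_one, Matrix.mul_assoc]; abel
  have k2 : Z2 = C⁻¹ * U + 2 • (Z1 * Zᴴ * V) + Z2 * Zᴴ * Z := by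
    have h1 : Z2 * (1 - Zᴴ * Z) = C⁻¹ * U + 2 • (Z1 * Zᴴ * V) := by
      rw [hZ2, Matrix.mul_assoc _ T, hTu, Matrix.mul_one, Matrix.mul_add, Matrix.mul_smul, hZ1]
      simp only [Matrix.mul_assoc]
    rw [← h1, Matrix.mul_sub, Matrix.mul_one, Matrix.mul_assoc]; abel
  have hGZ : jetMat C⁻¹ (Z1 * Zᴴ) (Z2 * Zᴴ) * jetMat Z V U = jetMat (C⁻¹ * Z) Z1 Z2 := by
    rw [jetMat_mul, ← k1, ← k2]
  have hjet : (jetMat C⁻¹ (Z1 * Zᴴ) (Z2 * Zᴴ)).map Jet.hol * (1 - gramJet (jetMat Z V U))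
      * (jetMat C⁻¹ (Z1 * Zᴴ) (Z2 * Zᴴ))ᵀ.map Jet.ahol
      = 1 - ss • gramJet (jetMat V' ((1 / 2 : ℂ) • U') 0) := by
    rw [Matrix.mul_sub, Matrix.sub_mul, gramJet_mul, hGZ, Matrix.mul_one]
    have hCi : C⁻¹ * (1 - Z * Zᴴ) * C⁻¹ᴴ = 1 := by
      have h1 : C⁻¹ * C = 1 := Matrix.nonsing_inv_mul _ hC
      have h2 : C⁻¹ * (1 - Z * Zᴴ) * C⁻¹ᴴ = C⁻¹ * C * (C⁻¹ * C)ᴴ := by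
        rw [hCS, Matrix.conjTranspose_mul]; simp only [Matrix.mul_assoc]
      rw [h2, h1]; simp
    have d00 : C⁻¹ * C⁻¹ᴴ - C⁻¹ * Z * (C⁻¹ * Z)ᴴ = 1 := by
      rw [← hCi, Matrix.conjTranspose_mul]
      simp only [Matrix.mul_sub, Matrix.sub_mul, Matrix.mul_one, Matrix.mul_assoc]
    have da0 : ∀ X : Matrix (Fin m) (Fin n) ℂ, X * Zᴴ * C⁻¹ᴴ - X * (C⁻¹ * Z)ᴴ = 0 := fun X => by
      rw [Matrix.conjTranspose_mul, Matrix.mul_assoc, sub_self]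
    have d0b : ∀ X : Matrix (Fin m) (Fin n) ℂ, C⁻¹ * (X * Zᴴ)ᴴ - C⁻¹ * Z * Xᴴ = 0 := fun X => by
      rw [Matrix.conjTranspose_mul, Matrix.conjTranspose_conjTranspose, Matrix.mul_assoc, sub_self]
    have dab : ∀ X Y : Matrix (Fin m) (Fin n) ℂ,
        X * Zᴴ * (Y * Zᴴ)ᴴ - X * Yᴴ = -((X * E) * (Y * E)ᴴ) := fun X Y => by
      have h1 : (X * E) * (Y * E)ᴴ = X * (E * Eᴴ) * Yᴴ := by
        rw [Matrix.conjTranspose_mul]; simp only [Matrix.mul_assoc]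
      rw [h1, ← hES, Matrix.conjTranspose_mul, Matrix.conjTranspose_conjTranspose]
      simp only [Matrix.mul_sub, Matrix.sub_mul, Matrix.mul_one, Matrix.mul_assoc]
      abel
    ext1 i j
    have e := fun (A B D : Matrix (Fin m) (Fin m) ℂ) (h : A - B = D) =>
      congrFun (congrFun h i) j
    have f00 := e _ _ _ d00
    have f10 := e _ _ _ (da0 Z1)
    have f20 := e _ _ _ (da0 Z2)
    have f01 := e _ _ _ (d0b Z1)
    have f02 := e _ _ _ (d0b Z2)
    have f11 := e _ _ _ (dab Z1 Z1)
    have f12 := e _ _ _ (dab Z1 Z2)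
    have f21 := e _ _ _ (dab Z2 Z1)
    have f22 := e _ _ _ (dab Z2 Z2)
    rw [← hV1] at f11
    rw [← hV1, ← hU1] at f12 f21
    rw [← hU1] at f22
    rw [Matrix.sub_apply] at f00 f10 f20 f01 f02 f11 f12 f21 f22
    rw [Matrix.sub_apply, Matrix.sub_apply, Matrix.smul_apply, smul_eq_mul, ss_mul, one_apply_jet]
    have hg : (jetMat C⁻¹ (Z1 * Zᴴ) (Z2 * Zᴴ)).map Jet.hol
      * (jetMat C⁻¹ (Z1 * Zᴴ) (Z2 * Zᴴ))ᵀ.map Jet.ahol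
        = gramJet (jetMat C⁻¹ (Z1 * Zᴴ) (Z2 * Zᴴ)) := rfl
    rw [hg, gramJet_apply, gramJet_apply, gramJet_apply]
    ext
    · simpa using f00
    · simpa using f10
    · simpa using f20
    · simpa using f01
    · simpa using f11
    · simpa using f21
    · simpa using f02
    · simpa using f12
    · simp only [Jet.sub_c2, f22]
      simp
      ring
  have hdet := congrArg Matrix.det hjet
  rw [Matrix.det_mul, Matrix.det_mul] at hdet
  have g1 : ((jetMat C⁻¹ (Z1 * Zᴴ) (Z2 * Zᴴ)).map Jet.hol).det
      = Jet.hol (jetMat C⁻¹ (Z1 * Zᴴ) (Z2 * Zᴴ)).det := (RingHom.map_det _ _).symm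
  have g2 : ((jetMat C⁻¹ (Z1 * Zᴴ) (Z2 * Zᴴ))ᵀ.map Jet.ahol).det
      = Jet.ahol (jetMat C⁻¹ (Z1 * Zᴴ) (Z2 * Zᴴ)).det := by
    rw [← Matrix.det_transpose (jetMat C⁻¹ (Z1 * Zᴴ) (Z2 * Zᴴ))]
    exact (RingHom.map_det _ _).symm
  have hh := jet_ofReal_eq_exp (v := v) (u := u) (z := ζ)
    (contDiffAt_detNorm (m := m) (n := n)) (detNorm_pos (hZdef ▸ hZ))
  rw [jet_detNorm, ← hZdef, ← hV, ← hU] at hh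
  refine neg_log_det_mixed (g := (jetMat C⁻¹ (Z1 * Zᴴ) (Z2 * Zᴴ)).det) ?_
  rw [← hdet, g1, g2, ← hh]
  ring

end MatrixDomains

section MatrixBounds

set_option linter.unusedSectionVars false

variable {m n : ℕ}

lemma trace_gram_re (V : Matrix (Fin m) (Fin n) ℂ) :
    (V * Vᴴ).trace.re = ∑ i, ∑ k, ‖V i k‖ ^ 2 := by
  simp only [Matrix.trace, Matrix.diag_apply, Matrix.mul_apply, Matrix.conjTranspose_apply,
    sum_mul_star_eq]
  norm_cast

lemma trace_gram_sq_re (V : Matrix (Fin m) (Fin n) ℂ) :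
    (V * Vᴴ * (V * Vᴴ)).trace.re = ∑ i, ∑ j, ‖(V * Vᴴ) i j‖ ^ 2 := by
  have h : (V * Vᴴ)ᴴ = V * Vᴴ := by simp
  rw [← trace_gram_re, h]

lemma trace_gram_pos {V : Matrix (Fin m) (Fin n) ℂ} (hV : V ≠ 0) : 0 < (V * Vᴴ).trace.re := by
  rw [trace_gram_re]
  obtain ⟨i, j, hij⟩ : ∃ i j, V i j ≠ 0 := by
    by_contra! h
    exact hV (Matrix.ext h)
  refine Finset.sum_pos' (fun _ _ => Finset.sum_nonneg fun _ _ => sq_nonneg _)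
    ⟨i, Finset.mem_univ i, ?_⟩
  exact Finset.sum_pos' (fun _ _ => sq_nonneg _) ⟨j, Finset.mem_univ j, by positivity⟩

lemma trace_gram_nonneg (V : Matrix (Fin m) (Fin n) ℂ) : 0 ≤ (V * Vᴴ).trace.re := by
  rw [trace_gram_re]
  exact Finset.sum_nonneg fun _ _ => Finset.sum_nonneg fun _ _ => sq_nonneg _

lemma sq_trace_gram_le (V : Matrix (Fin m) (Fin n) ℂ) :
    (V * Vᴴ).trace.re ^ 2 ≤ m * (V * Vᴴ * (V * Vᴴ)).trace.re := by
  have h1 : (V * Vᴴ).trace.re = ∑ i, ((V * Vᴴ) i i).re := by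
    simp [Matrix.trace, Matrix.diag_apply, Complex.re_sum]
  rw [trace_gram_sq_re, h1]
  calc (∑ i, ((V * Vᴴ) i i).re) ^ 2 ≤ (Finset.univ : Finset (Fin m)).card
        * ∑ i, ((V * Vᴴ) i i).re ^ 2 := sq_sum_le_card_mul_sum_sq
    _ = m * ∑ i, ((V * Vᴴ) i i).re ^ 2 := by simp
    _ ≤ m * ∑ i, ∑ j, ‖(V * Vᴴ) i j‖ ^ 2 := by
      gcongr with i
      calc ((V * Vᴴ) i i).re ^ 2 ≤ ‖(V * Vᴴ) i i‖ ^ 2 := by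
            rw [← sq_abs]; gcongr; exact Complex.abs_re_le_norm _
        _ ≤ _ := Finset.single_le_sum (f := fun j => ‖(V * Vᴴ) i j‖ ^ 2)
            (fun _ _ => sq_nonneg _) (Finset.mem_univ i)

lemma trace_gram_sq_le (V : Matrix (Fin m) (Fin n) ℂ) :
    (V * Vᴴ * (V * Vᴴ)).trace.re ≤ (V * Vᴴ).trace.re ^ 2 := by
  rw [trace_gram_sq_re, trace_gram_re, sq, Finset.sum_mul]
  refine Finset.sum_le_sum fun i _ => ?_
  rw [Finset.mul_sum]
  exact Finset.sum_le_sum fun j _ => norm_sum_mul_star_sq_le _ _ _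

/-- The pinching of `-log det (I - ZZᴴ)` restricted to a linear subspace that contains, with `V`,
the acceleration `-2 V (I - ZᴴZ)⁻¹ Zᴴ V` for which the normalised curve is a straight line. With
`M = VVᴴ` for the normalised velocity, the constants come from `(tr M)² / m ≤ tr M² ≤ (tr M)²`. -/
lemma baseBounds_detNorm {κ : Type} [Fintype κ] (hm : 1 ≤ m)
    (L : (κ → ℂ) →L[ℂ] (IdxI m n → ℂ)) (hL : Function.Injective L) {ζ : κ → ℂ}
    (hζ : matI (L ζ) ∈ RI m n)
    (hclosed : ∀ v, ∃ u, matI (L u) = -(2 • (matI (L v)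
      * ((1 - (matI (L ζ))ᴴ * matI (L ζ))⁻¹ * (matI (L ζ))ᴴ) * matI (L v)))) :
    BaseBounds (fun y => detNorm (matI (L y))) ζ (2 / m) 2 := by
  obtain ⟨P, Q, hP, hQ, hPQ⟩ := detNorm_mixed hζ
  have hs : ContDiffAt ℝ ∞ (fun y => detNorm (matI y)) (L ζ) := contDiffAt_detNorm
  have hj : ∀ v u, jet v u (negLog fun y => detNorm (matI (L y))) ζ
      = jet (L v) (L u) (negLog fun y => detNorm (matI y)) (L ζ) := fun v u =>
    jet_comp_clm L (smoothAt_negLog hs (detNorm_pos hζ))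
  have hm' : (0 : ℝ) < m := by exact_mod_cast hm
  refine ⟨detNorm_pos hζ, ContDiffAt.comp ζ (g := fun y => detNorm (matI y))
    (f := L.restrictScalars ℝ) hs (L.restrictScalars ℝ).contDiff.contDiffAt, ?_, ?_, ?_⟩
  · intro v hv
    rw [hj, (hPQ _ _ _ _ _ rfl rfl rfl).1]
    refine trace_gram_pos fun h0 => hv (hL ?_)
    have h1 : matI (L v) = P⁻¹ * (P * matI (L v) * Q) * Q⁻¹ := by
      rw [Matrix.mul_assoc, Matrix.mul_assoc, Matrix.mul_nonsing_inv _ hQ, Matrix.mul_one,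
        ← Matrix.mul_assoc, Matrix.nonsing_inv_mul _ hP, Matrix.one_mul]
    rw [h0, Matrix.mul_zero, Matrix.zero_mul] at h1
    rw [map_zero]
    ext ⟨i, j⟩
    exact congrFun (congrFun h1 i) j
  · intro v u
    obtain ⟨e1, -, e3⟩ := hPQ (L v) (L u) _ _ _ rfl rfl rfl
    rw [hj, e1, e3, Complex.add_re, ← Complex.ofReal_ofNat, Complex.re_ofReal_mul]
    have h1 := sq_trace_gram_le (P * matI (L v) * Q)
    have h2 := trace_gram_nonneg (P * (matI (L u) + 2 • (matI (L v)
      * ((1 - (matI (L ζ))ᴴ * matI (L ζ))⁻¹ * (matI (L ζ))ᴴ) * matI (L v))) * Q)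
    rw [div_mul_eq_mul_div, div_le_iff₀ hm']
    have h3 := mul_nonneg hm'.le h2
    linarith
  · intro v
    obtain ⟨u, hu⟩ := hclosed v
    refine ⟨u, ?_⟩
    obtain ⟨e1, e2, e3⟩ := hPQ (L v) (L u) _ _ _ rfl rfl rfl
    rw [hu, neg_add_cancel, Matrix.mul_zero, Matrix.zero_mul] at e2 e3
    rw [hj, e1, e2, e3]
    simp only [Matrix.zero_mul, Matrix.trace_zero, zero_add, true_and]
    rw [← Complex.ofReal_ofNat, Complex.re_ofReal_mul]
    exact mul_le_mul_of_nonneg_left (trace_gram_sq_le _) (by norm_num)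

lemma baseBounds_typeI (hm : 1 ≤ m) {ζ : IdxI m n → ℂ} (hζ : matI ζ ∈ RI m n) :
    BaseBounds (fun y => detNorm (matI y)) ζ (2 / m) 2 :=
  baseBounds_detNorm hm (ContinuousLinearMap.id ℂ _) (fun _ _ h => h) hζ fun v =>
    ⟨fun ij => (-(2 • (matI v * ((1 - (matI ζ)ᴴ * matI ζ)⁻¹ * (matI ζ)ᴴ) * matI v)) :
      Matrix (Fin m) (Fin n) ℂ) ij.1 ij.2,
      rfl⟩

/-! ### The domains of symmetric and skew-symmetric matrices -/

variable {p : ℕ}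

/-- The quasi-inverse `(I - ZᴴZ)⁻¹ Zᴴ` of a symmetric or skew-symmetric matrix has the same
symmetry. -/
lemma transpose_quasiInverse {Z : Matrix (Fin p) (Fin p) ℂ} {ε : ℂ} (hε : ε * ε = 1)
    (hεs : star ε = ε) (hZ : Zᵀ = ε • Z) (hpos : (1 - Z * Zᴴ).PosDef) :
    ((1 - Zᴴ * Z)⁻¹ * Zᴴ)ᵀ = ε • ((1 - Zᴴ * Z)⁻¹ * Zᴴ) := by
  have hu := (Matrix.isUnit_iff_isUnit_det _).mp hpos.isUnit
  have hu' := (Matrix.isUnit_iff_isUnit_det _).mp (posDef_one_sub_conjTranspose_mul hpos).isUnit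
  have hZc : Zᴴᵀ = ε • Zᴴ := by
    have := congrArg Matrix.conjTranspose hZ
    rw [Matrix.conjTranspose_smul, hεs] at this
    exact this
  have h1 : (1 - Zᴴ * Z)ᵀ = 1 - Z * Zᴴ := by
    rw [Matrix.transpose_sub, Matrix.transpose_one, Matrix.transpose_mul, hZ, hZc,
      Matrix.smul_mul, Matrix.mul_smul, smul_smul, hε, one_smul]
  rw [Matrix.transpose_mul, Matrix.transpose_nonsing_inv, h1, hZc, Matrix.smul_mul]
  congr 1
  have h2 : (1 - Zᴴ * Z) * Zᴴ = Zᴴ * (1 - Z * Zᴴ) := by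
    simp only [Matrix.sub_mul, Matrix.mul_sub, Matrix.one_mul, Matrix.mul_one, Matrix.mul_assoc]
  calc Zᴴ * (1 - Z * Zᴴ)⁻¹
      = (1 - Zᴴ * Z)⁻¹ * ((1 - Zᴴ * Z) * Zᴴ) * (1 - Z * Zᴴ)⁻¹ := by
        rw [← Matrix.mul_assoc, Matrix.nonsing_inv_mul _ hu', Matrix.one_mul]
    _ = (1 - Zᴴ * Z)⁻¹ * Zᴴ := by
        rw [h2, Matrix.mul_assoc, Matrix.mul_assoc, Matrix.mul_nonsing_inv _ hu, Matrix.mul_one]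

/-- The acceleration that straightens the normalised curve stays in the space of symmetric
(`ε = 1`) or skew-symmetric (`ε = -1`) matrices. -/
lemma transpose_acceleration {Z V : Matrix (Fin p) (Fin p) ℂ} {ε : ℂ} (hε : ε * ε = 1)
    (hεs : star ε = ε) (hZ : Zᵀ = ε • Z) (hV : Vᵀ = ε • V) (hpos : (1 - Z * Zᴴ).PosDef) :
    (-(2 • (V * ((1 - Zᴴ * Z)⁻¹ * Zᴴ) * V)) : Matrix (Fin p) (Fin p) ℂ)ᵀ
      = ε • (-(2 • (V * ((1 - Zᴴ * Z)⁻¹ * Zᴴ) * V)) : Matrix (Fin p) (Fin p) ℂ) := by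
  obtain ⟨R, hR⟩ : ∃ R, R = (1 - Zᴴ * Z)⁻¹ * Zᴴ := ⟨_, rfl⟩
  have hRt : Rᵀ = ε • R := by rw [hR]; exact transpose_quasiInverse hε hεs hZ hpos
  have h1 : (V * R * V)ᵀ = ε • (V * R * V) := by
    rw [Matrix.transpose_mul, Matrix.transpose_mul, hV, hRt]
    simp only [Matrix.smul_mul, Matrix.mul_smul, smul_smul, Matrix.mul_assoc]
    rw [mul_assoc, hε, mul_one]
  rw [← hR, Matrix.transpose_neg, Matrix.transpose_smul, h1, smul_neg, smul_comm]

/-- The symmetric matrix with the given independent entries, as a point of the matrix space. -/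
def symL (p : ℕ) : (IdxII p → ℂ) →L[ℂ] (IdxI p p → ℂ) :=
  LinearMap.toContinuousLinearMap
    { toFun := fun ζ ij => matII ζ ij.1 ij.2
      map_add' := fun x y => by
        ext ij; simp only [matII, Matrix.of_apply, Pi.add_apply]; split_ifs <;> rfl
      map_smul' := fun c x => by
        ext ij; simp only [matII, Matrix.of_apply, Pi.smul_apply]; split_ifs <;> rfl }

lemma matI_symL (ζ : IdxII p → ℂ) : matI (symL p ζ) = matII ζ := rfl

/-- The skew-symmetric matrix with the given independent entries, as a point of the matrix
space. -/
def skewL (p : ℕ) : (IdxIII p → ℂ) →L[ℂ] (IdxI p p → ℂ) :=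
  LinearMap.toContinuousLinearMap
    { toFun := fun ζ ij => matIII ζ ij.1 ij.2
      map_add' := fun x y => by
        ext ij; simp only [matIII, Matrix.of_apply, Pi.add_apply]; split_ifs <;> ring
      map_smul' := fun c x => by
        ext ij; simp only [matIII, Matrix.of_apply, Pi.smul_apply, smul_eq_mul, RingHom.id_apply]
        split_ifs <;> ring }

lemma matI_skewL (ζ : IdxIII p → ℂ) : matI (skewL p ζ) = matIII ζ := rfl

lemma matII_transpose (ζ : IdxII p → ℂ) : (matII ζ)ᵀ = matII ζ := by
  ext i j
  simp only [Matrix.transpose_apply, matII, Matrix.of_apply]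
  rcases lt_trichotomy i j with h | rfl | h
  · rw [dif_neg h.not_ge, dif_pos h.le]
  · rfl
  · rw [dif_pos h.le, dif_neg h.not_ge]

lemma matII_surj {M : Matrix (Fin p) (Fin p) ℂ} (hM : Mᵀ = M) :
    matII (fun x : IdxII p => M x.1.1 x.1.2) = M := by
  ext i j
  simp only [matII, Matrix.of_apply]
  split_ifs with h
  · rfl
  · exact congrFun (congrFun hM i) j

lemma matIII_transpose (ζ : IdxIII p → ℂ) : (matIII ζ)ᵀ = -matIII ζ := by
  ext i j
  simp only [Matrix.transpose_apply, matIII, Matrix.of_apply, Matrix.neg_apply]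
  rcases lt_trichotomy i j with h | rfl | h
  · simp [h, h.not_gt]
  · simp
  · simp [h, h.not_gt]

lemma matIII_surj {M : Matrix (Fin p) (Fin p) ℂ} (hM : Mᵀ = -M) :
    matIII (fun x : IdxIII p => M x.1.1 x.1.2) = M := by
  have hM' : ∀ i j, M j i = -M i j := fun i j => congrFun (congrFun hM i) j
  ext i j
  simp only [matIII, Matrix.of_apply]
  rcases lt_trichotomy i j with h | rfl | h
  · simp [h]
  · have : M i i = 0 := by
      have := hM' i i
      linear_combination (1 / 2 : ℂ) * this
    simp [this]
  · simp only [h, h.not_gt, dif_pos, dif_neg, not_false_eq_true]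
    rw [hM' i j, neg_neg]

lemma baseBounds_typeII (hp : 1 ≤ p) {ζ : IdxII p → ℂ} (hζ : matII ζ ∈ RII p) :
    BaseBounds (fun y => detNorm (matII y)) ζ (2 / p) 2 := by
  refine baseBounds_detNorm hp (symL p) (fun x y hxy => ?_) hζ.2 fun v => ?_
  · ext ⟨⟨i, j⟩, hij⟩
    have := congrFun hxy (i, j)
    change matII x i j = matII y i j at this
    simpa only [matII, Matrix.of_apply, dif_pos hij] using this
  · refine ⟨_, (matI_symL _).trans (matII_surj ?_)⟩
    have h := transpose_acceleration (ε := 1) (one_mul 1) (star_one ℂ)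
      ((matII_transpose ζ).trans (one_smul ℂ _).symm)
      ((matII_transpose v).trans (one_smul ℂ _).symm) hζ.2
    rw [one_smul] at h
    exact h

lemma baseBounds_typeIII (hp : 1 ≤ p) {ζ : IdxIII p → ℂ} (hζ : matIII ζ ∈ RIII p) :
    BaseBounds (fun y => detNorm (matIII y)) ζ (2 / p) 2 := by
  refine baseBounds_detNorm hp (skewL p) (fun x y hxy => ?_) hζ.2 fun v => ?_
  · ext ⟨⟨i, j⟩, hij⟩
    have := congrFun hxy (i, j)
    change matIII x i j = matIII y i j at this
    simp only [matIII, Matrix.of_apply] at this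
    rwa [dif_pos hij, dif_pos hij] at this
  · refine ⟨_, (matI_skewL _).trans (matIII_surj ?_)⟩
    have h := transpose_acceleration (ε := -1) (by norm_num) (by simp)
      ((matIII_transpose ζ).trans (neg_one_smul ℂ _).symm)
      ((matIII_transpose v).trans (neg_one_smul ℂ _).symm) hζ.2
    rw [neg_one_smul] at h
    exact h

end MatrixBounds

/-! ### The Lie ball -/

section LieBall

set_option linter.unusedSectionVars false

variable {n : ℕ}

/-- On the vectors `(x, α, δ)` orthogonal to the lift `(z, 1, z·z)` of a point of the Lie ball and
to the conjugate `(z̄, ζ̄, 1)` of that lift, where `ζ = z·z`, the form `2|x|² - |α|² - |δ|²` of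
signature `(n, 2)` is positive definite, since the two vectors span a negative definite plane. -/
lemma lieForm_nonneg {z x : Fin n → ℂ} {α δ ζ : ℂ} (hζ : ζ = ∑ i, z i ^ 2) (hz : z ∈ RIV n)
    (h1 : 2 * ∑ i, x i * star (z i) - α - δ * star ζ = 0)
    (h2 : 2 * ∑ i, x i * z i - α * ζ - δ = 0) :
    0 ≤ 2 * ∑ i, ‖x i‖ ^ 2 - ‖α‖ ^ 2 - ‖δ‖ ^ 2 ∧
    (2 * ∑ i, ‖x i‖ ^ 2 - ‖α‖ ^ 2 - ‖δ‖ ^ 2 = 0 → x = 0 ∧ α = 0) := by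
  obtain ⟨hb, hn⟩ := hz
  rw [betaNorm, ← hζ] at hb
  rw [← hζ] at hn
  have hnc : ∀ c : ℂ, c * star c = ((‖c‖ ^ 2 : ℝ) : ℂ) := fun c => by
    rw [Complex.star_def, Complex.mul_conj']; push_cast; rfl
  have hd : (1 : ℂ) - ζ * star ζ ≠ 0 := by
    rw [hnc, ← Complex.ofReal_one, ← Complex.ofReal_sub]
    have : ‖ζ‖ ^ 2 < 1 := by nlinarith [norm_nonneg ζ]
    exact_mod_cast (sub_pos.mpr this).ne'
  -- solve `(α, δ) = y₁ (1, ζ) + y₂ (ζ̄, 1)`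
  obtain ⟨y1, hy1⟩ : ∃ y1, y1 = (α - star ζ * δ) / (1 - ζ * star ζ) := ⟨_, rfl⟩
  obtain ⟨y2, hy2⟩ : ∃ y2, y2 = (δ - ζ * α) / (1 - ζ * star ζ) := ⟨_, rfl⟩
  have hy1d : y1 * (1 - ζ * star ζ) = α - star ζ * δ := by rw [hy1, div_mul_cancel₀ _ hd]
  have hy2d : y2 * (1 - ζ * star ζ) = δ - ζ * α := by rw [hy2, div_mul_cancel₀ _ hd]
  have hα : α = y1 + y2 * star ζ :=
    mul_right_cancel₀ hd (by linear_combination -hy1d - star ζ * hy2d)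
  have hδ : δ = y1 * ζ + y2 := mul_right_cancel₀ hd (by linear_combination -ζ * hy1d - hy2d)
  obtain ⟨s, hs⟩ : ∃ s : Fin n → ℂ, ∀ i, s i = y1 * z i + y2 * star (z i) := ⟨_, fun _ => rfl⟩
  obtain ⟨T, hT⟩ : ∃ T, T = ‖α‖ ^ 2 + ‖δ‖ ^ 2 := ⟨_, rfl⟩
  obtain ⟨X, hX⟩ : ∃ X, X = ∑ i, ‖x i‖ ^ 2 := ⟨_, rfl⟩
  obtain ⟨S, hS⟩ : ∃ S, S = ∑ i, ‖s i‖ ^ 2 := ⟨_, rfl⟩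
  have hT0 : 0 ≤ T := by rw [hT]; positivity
  have hX0 : 0 ≤ X := by rw [hX]; positivity
  have hTx : (T : ℂ) = 2 * ∑ i, x i * star (s i) := by
    have e1 : ∑ i, x i * star (s i)
        = star y1 * ∑ i, x i * star (z i) + star y2 * ∑ i, x i * z i := by
      rw [Finset.mul_sum, Finset.mul_sum, ← Finset.sum_add_distrib]
      refine Finset.sum_congr rfl fun i _ => ?_
      rw [hs, star_add, star_mul', star_mul', star_star]; ring
    have e2 : (T : ℂ) = α * star α + δ * star δ := by rw [hnc, hnc, hT]; push_cast; rfl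
    have e3 : star α = star y1 + star y2 * ζ := by rw [hα, star_add, star_mul', star_star]
    have e4 : star δ = star y1 * star ζ + star y2 := by rw [hδ, star_add, star_mul']
    rw [e1, e2, e3, e4]
    linear_combination (-star y1) * h1 - star y2 * h2
  have hTS : T = 2 * S + (‖y1‖ ^ 2 + ‖y2‖ ^ 2) * (1 + ‖ζ‖ ^ 2 - 2 * ∑ i, ‖z i‖ ^ 2) := by
    have e0 : (S : ℂ) = (y1 * star y1 + y2 * star y2) * ∑ i, z i * star (z i)
        + y1 * star y2 * ζ + star y1 * y2 * star ζ := by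
      rw [hS, ← sum_mul_star_eq, hζ, star_sum, Finset.mul_sum, Finset.mul_sum, Finset.mul_sum,
        ← Finset.sum_add_distrib, ← Finset.sum_add_distrib]
      refine Finset.sum_congr rfl fun i _ => ?_
      rw [hs, star_add, star_mul', star_mul', star_star, star_pow]; ring
    have e2 : (T : ℂ) = α * star α + δ * star δ := by rw [hnc, hnc, hT]; push_cast; rfl
    have e3 : star α = star y1 + star y2 * ζ := by rw [hα, star_add, star_mul', star_star]
    have e4 : star δ = star y1 * star ζ + star y2 := by rw [hδ, star_add, star_mul']
    have e5 : (T : ℂ) = 2 * (S : ℂ) + (y1 * star y1 + y2 * star y2)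
        * (1 + ζ * star ζ - 2 * ∑ i, z i * star (z i)) := by
      rw [e2, e0, e3, e4, hα, hδ]; ring
    rw [hnc, hnc, hnc, sum_mul_star_eq] at e5
    exact_mod_cast e5
  have hTsq : T ^ 2 ≤ (2 * X) * (2 * S) := by
    have e1 : T = ‖(2 : ℂ) * ∑ i, x i * star (s i)‖ := by
      rw [← hTx, Complex.norm_real, Real.norm_of_nonneg hT0]
    rw [e1, norm_mul, mul_pow, hX, hS, Complex.norm_ofNat]
    have := norm_sum_mul_star_sq_le Finset.univ x s
    linarith
  have hy : 0 ≤ (‖y1‖ ^ 2 + ‖y2‖ ^ 2) * (1 + ‖ζ‖ ^ 2 - 2 * ∑ i, ‖z i‖ ^ 2) := by positivity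
  have hle : T ≤ 2 * X := by
    rcases hT0.eq_or_lt with h0 | h0
    · rw [← h0]; positivity
    · have : T * T ≤ T * (2 * X) := by nlinarith
      exact le_of_mul_le_mul_left this h0
  rw [← hX, sub_sub, ← hT]
  refine ⟨sub_nonneg.mpr hle, fun heq => ?_⟩
  have hTX : T = 2 * X := by linarith
  have hTz : T = 0 := by
    by_contra hne
    have h0 : 0 < T := lt_of_le_of_ne hT0 (Ne.symm hne)
    have h3 : T ≤ 2 * S := by
      rw [← hTX, sq] at hTsq
      exact le_of_mul_le_mul_left hTsq h0
    have h4 : (‖y1‖ ^ 2 + ‖y2‖ ^ 2) * (1 + ‖ζ‖ ^ 2 - 2 * ∑ i, ‖z i‖ ^ 2) = 0 := by linarith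
    have h5 : ‖y1‖ ^ 2 + ‖y2‖ ^ 2 = 0 := (mul_eq_zero.mp h4).resolve_right hb.ne'
    have h6 : y1 = 0 := by
      have : ‖y1‖ ^ 2 = 0 := by nlinarith [sq_nonneg ‖y1‖, sq_nonneg ‖y2‖]
      simpa using this
    have h7 : y2 = 0 := by
      have : ‖y2‖ ^ 2 = 0 := by nlinarith [sq_nonneg ‖y1‖, sq_nonneg ‖y2‖]
      simpa using this
    apply hne
    rw [hT, hα, hδ, h6, h7]
    simp
  constructor
  · have hXz : ∑ i, ‖x i‖ ^ 2 = 0 := by rw [← hX]; linarith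
    ext i
    have := (Finset.sum_eq_zero_iff_of_nonneg fun _ _ => sq_nonneg _).mp hXz i (Finset.mem_univ i)
    simpa using this
  · have : ‖α‖ ^ 2 = 0 := by nlinarith [sq_nonneg ‖α‖, sq_nonneg ‖δ‖]
    simpa using this

lemma norm_sub_mul_sq (a b θ : ℂ) (hθ : ‖θ‖ = 1) :
    ‖a - θ * star b‖ ^ 2 = ‖a‖ ^ 2 + ‖b‖ ^ 2 - 2 * (star θ * (a * b)).re := by
  have h1 : ∀ c : ℂ, ‖c‖ ^ 2 = c.re ^ 2 + c.im ^ 2 := fun c => by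
    rw [Complex.sq_norm, Complex.normSq_apply]; ring
  have h2 : θ.re ^ 2 + θ.im ^ 2 = 1 := by rw [← h1, hθ]; norm_num
  rw [h1, h1, h1]
  simp
  linear_combination (b.re ^ 2 + b.im ^ 2) * h2

/-- On the same subspace the quadric `x·x - αδ` is dominated by the Hermitian form: the subspace
is stable under the conjugation `(x, α, δ) ↦ (x̄, δ̄, ᾱ)`, and the form is nonnegative on the
difference of a vector and a unimodular multiple of its conjugate. -/
lemma two_mul_norm_quadric_le {z x : Fin n → ℂ} {α δ ζ : ℂ} (hζ : ζ = ∑ i, z i ^ 2)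
    (hz : z ∈ RIV n) (h1 : 2 * ∑ i, x i * star (z i) - α - δ * star ζ = 0)
    (h2 : 2 * ∑ i, x i * z i - α * ζ - δ = 0) :
    2 * ‖∑ i, x i * x i - α * δ‖ ≤ 2 * ∑ i, ‖x i‖ ^ 2 - ‖α‖ ^ 2 - ‖δ‖ ^ 2 := by
  obtain ⟨q, hq⟩ : ∃ q, q = ∑ i, x i * x i - α * δ := ⟨_, rfl⟩
  obtain ⟨θ, hθ1, hθ2⟩ : ∃ θ : ℂ, ‖θ‖ = 1 ∧ star θ * q = ‖q‖ := by
    rcases eq_or_ne q 0 with h0 | h0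
    · exact ⟨1, by simp, by simp [h0]⟩
    · have hn : (‖q‖ : ℂ) ≠ 0 := by exact_mod_cast norm_ne_zero_iff.mpr h0
      refine ⟨q / ‖q‖, by simp [h0], ?_⟩
      rw [Complex.star_def, map_div₀, Complex.conj_ofReal, div_mul_eq_mul_div, Complex.conj_mul']
      field_simp
  have s1 := congrArg star h1
  have s2 := congrArg star h2
  simp only [star_sub, star_mul', star_sum, star_star, star_zero, star_ofNat] at s1 s2
  have key := (lieForm_nonneg (x := fun i => x i - θ * star (x i)) (α := α - θ * star δ)
    (δ := δ - θ * star α) hζ hz (by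
      simp only [sub_mul, Finset.sum_sub_distrib, mul_assoc, ← Finset.mul_sum]
      linear_combination h1 - θ * s2) (by
      simp only [sub_mul, Finset.sum_sub_distrib, mul_assoc, ← Finset.mul_sum]
      linear_combination h2 - θ * s1)).1
  simp only [norm_sub_mul_sq _ _ θ hθ1, Finset.sum_sub_distrib, Finset.sum_add_distrib] at key
  have e1 : ∑ i, 2 * (star θ * (x i * x i)).re = 2 * (star θ * ∑ i, x i * x i).re := by
    rw [Finset.mul_sum, Complex.re_sum, Finset.mul_sum]
  have e2 : (star θ * ∑ i, x i * x i).re - (star θ * (α * δ)).re = ‖q‖ := by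
    rw [← Complex.sub_re, ← mul_sub, ← hq, hθ2, Complex.ofReal_re]
  rw [e1, mul_comm δ α] at key
  rw [← hq]
  linarith

/-- A vector orthogonal only to the lift of the point: the form is bounded below through its
product `η` with the conjugate lift, by subtracting the component along that lift. -/
lemma lieForm_lower {z x : Fin n → ℂ} {α δ ζ η : ℂ} (hζ : ζ = ∑ i, z i ^ 2) (hz : z ∈ RIV n)
    (h1 : 2 * ∑ i, x i * star (z i) - α - δ * star ζ = 0)
    (h2 : 2 * ∑ i, x i * z i - α * ζ - δ = η) :
    -‖η‖ ^ 2 ≤ betaNorm z * (2 * ∑ i, ‖x i‖ ^ 2 - ‖α‖ ^ 2 - ‖δ‖ ^ 2) := by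
  have hb := hz.1
  obtain ⟨m, hm⟩ : ∃ m, m = betaNorm z := ⟨_, rfl⟩
  rw [← hm] at hb ⊢
  have hmc : (m : ℂ) ≠ 0 := by exact_mod_cast hb.ne'
  have hnc : ∀ c : ℂ, c * star c = ((‖c‖ ^ 2 : ℝ) : ℂ) := fun c => by
    rw [Complex.star_def, Complex.mul_conj']; push_cast; rfl
  have hmz : (m : ℂ) = 1 + ζ * star ζ - 2 * ∑ i, z i * star (z i) := by
    rw [hm, betaNorm, ← hζ, hnc, sum_mul_star_eq]; push_cast; rfl
  obtain ⟨μ, hμ⟩ : ∃ μ, μ = -η / m := ⟨_, rfl⟩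
  have hμm : μ * m = -η := by rw [hμ]; field_simp
  have hzz : ∑ i, star (z i) * star (z i) = star ζ := by
    rw [hζ, star_sum]; exact Finset.sum_congr rfl fun i _ => by rw [star_pow]; ring
  have hzc : ∑ i, star (z i) * z i = ∑ i, z i * star (z i) :=
    Finset.sum_congr rfl fun i _ => mul_comm _ _
  have key := (lieForm_nonneg (x := fun i => x i - μ * star (z i)) (α := α - μ * star ζ)
    (δ := δ - μ) hζ hz (by
      simp only [sub_mul, Finset.sum_sub_distrib, mul_assoc, ← Finset.mul_sum, hzz]
      linear_combination h1) (by
      simp only [sub_mul, Finset.sum_sub_distrib, mul_assoc, ← Finset.mul_sum, hzc]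
      linear_combination h2 + hμm - μ * hmz)).1
  have key2 : ((2 * ∑ i, ‖x i - μ * star (z i)‖ ^ 2 - ‖α - μ * star ζ‖ ^ 2 - ‖δ - μ‖ ^ 2 : ℝ) : ℂ)
      * m = ((m * (2 * ∑ i, ‖x i‖ ^ 2 - ‖α‖ ^ 2 - ‖δ‖ ^ 2) + ‖η‖ ^ 2 : ℝ) : ℂ) := by
    have e1 : ((2 * ∑ i, ‖x i - μ * star (z i)‖ ^ 2 - ‖α - μ * star ζ‖ ^ 2 - ‖δ - μ‖ ^ 2 : ℝ) : ℂ)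
        = 2 * ∑ i, (x i - μ * star (z i)) * star (x i - μ * star (z i))
          - (α - μ * star ζ) * star (α - μ * star ζ) - (δ - μ) * star (δ - μ) := by
      rw [sum_mul_star_eq, hnc, hnc]; push_cast; rfl
    have e2 : ((m * (2 * ∑ i, ‖x i‖ ^ 2 - ‖α‖ ^ 2 - ‖δ‖ ^ 2) + ‖η‖ ^ 2 : ℝ) : ℂ)
        = m * (2 * ∑ i, x i * star (x i) - α * star α - δ * star δ) + η * star η := by
      rw [sum_mul_star_eq, hnc, hnc, hnc]; push_cast; rfl
    have e3 : ∑ i, (x i - μ * star (z i)) * star (x i - μ * star (z i))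
        = ∑ i, x i * star (x i) - star μ * ∑ i, x i * z i
          - μ * star (∑ i, x i * z i) + μ * star μ * ∑ i, z i * star (z i) := by
      rw [star_sum, Finset.mul_sum, Finset.mul_sum, Finset.mul_sum, ← Finset.sum_sub_distrib,
        ← Finset.sum_sub_distrib, ← Finset.sum_add_distrib]
      refine Finset.sum_congr rfl fun i _ => ?_
      rw [star_sub, star_mul', star_star, star_mul']; ring
    have hms : star (m : ℂ) = m := Complex.conj_ofReal m
    have hη : η = -(μ * m) := by rw [hμm, neg_neg]
    have hηs : star η = -(star μ * m) := by rw [hη, star_neg, star_mul', hms]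
    have s2 := congrArg star h2
    rw [star_sub, star_sub, star_mul', star_mul', star_ofNat, hηs] at s2
    rw [hη] at h2
    rw [e1, e2, e3, hηs, hη]
    simp only [star_sub, star_mul', star_star]
    linear_combination (-star μ * m) * h2 - μ * m * s2 + μ * star μ * m * hmz
  have key3 : (2 * ∑ i, ‖x i - μ * star (z i)‖ ^ 2 - ‖α - μ * star ζ‖ ^ 2 - ‖δ - μ‖ ^ 2) * m
      = m * (2 * ∑ i, ‖x i‖ ^ 2 - ‖α‖ ^ 2 - ‖δ‖ ^ 2) + ‖η‖ ^ 2 := by exact_mod_cast key2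
  have := mul_nonneg key hb.le
  linarith

end LieBall

section LieBallJets

set_option linter.unusedSectionVars false

variable {n : ℕ} {z : Fin n → ℂ}

/-- The coordinate `zᵢ` as a continuous linear form. -/
def coordIV (i : Fin n) : (Fin n → ℂ) →L[ℂ] ℂ := ContinuousLinearMap.proj i

lemma smoothAt_coordIV (i : Fin n) : SmoothAt (coordIV i) z :=
  ((coordIV i).restrictScalars ℝ).contDiff.contDiffAt

lemma smoothAt_star_coordIV (i : Fin n) : SmoothAt (fun y => star (coordIV i y)) z :=
  Complex.conjCLE.contDiff.contDiffAt.comp z (smoothAt_coordIV i)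

/-- The 2-jets of the coordinates along a curve in `ℂⁿ`. -/
def coordJet (z v u : Fin n → ℂ) (i : Fin n) : Jet ℂ := ⟨z i, v i, u i⟩

lemma contDiffAt_betaNorm : ContDiffAt ℝ ∞ (betaNorm : (Fin n → ℂ) → ℝ) z := by
  have h1 : ∀ i : Fin n, ContDiff ℝ ∞ fun y : Fin n → ℂ => y i := fun i => by fun_prop
  have h2 : ContDiff ℝ ∞ fun y : Fin n → ℂ => ∑ i, y i ^ 2 :=
    ContDiff.sum fun i _ => (h1 i).pow 2
  have h3 : ContDiff ℝ ∞ fun y : Fin n → ℂ => ∑ i, ‖y i‖ ^ 2 :=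
    ContDiff.sum fun i _ => (h1 i).norm_sq ℝ
  exact ((contDiff_const.add (h2.norm_sq ℝ)).sub (contDiff_const.mul h3)).contDiffAt

lemma jet_betaNorm (v u : Fin n → ℂ) :
    jet v u (fun y => (betaNorm y : ℂ)) z
      = 1 + Jet.hol (∑ i, coordJet z v u i * coordJet z v u i)
          * Jet.ahol (∑ i, coordJet z v u i * coordJet z v u i)
        + Jet.const (Jet.const (-2))
          * ∑ i, Jet.hol (coordJet z v u i) * Jet.ahol (coordJet z v u i) := by
  have hp := fun i : Fin n => smoothAt_coordIV (z := z) i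
  have hq := fun i : Fin n => smoothAt_star_coordIV (z := z) i
  have jp : ∀ i, jet v u (coordIV i) z = Jet.hol (coordJet z v u i) := fun i => jet_clm _
  have jq : ∀ i, jet v u (fun y => star (coordIV i y)) z = Jet.ahol (coordJet z v u i) :=
    fun i => jet_star_clm _
  have s1 : ∀ i ∈ (Finset.univ : Finset (Fin n)), SmoothAt (⇑(coordIV i) * ⇑(coordIV i)) z :=
    fun i _ => smoothAt_mul (hp i) (hp i)
  have s2 : ∀ i ∈ (Finset.univ : Finset (Fin n)),
      SmoothAt ((fun y => star (coordIV i y)) * fun y => star (coordIV i y)) z :=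
    fun i _ => smoothAt_mul (hq i) (hq i)
  have s3 : ∀ i ∈ (Finset.univ : Finset (Fin n)),
      SmoothAt (⇑(coordIV i) * fun y => star (coordIV i y)) z :=
    fun i _ => smoothAt_mul (hp i) (hq i)
  have e : (fun y : Fin n → ℂ => (betaNorm y : ℂ))
      = (fun _ => (1 : ℂ))
        + (fun y => ∑ i, (⇑(coordIV i) * ⇑(coordIV i)) y)
          * (fun y => ∑ i, ((fun y => star (coordIV i y)) * fun y => star (coordIV i y)) y)
        + fun y => (-2 : ℂ) * ∑ i, (⇑(coordIV i) * fun y => star (coordIV i y)) y := by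
    ext y
    simp only [Pi.add_apply, Pi.mul_apply]
    have h1 : ∑ i, star (coordIV i y) * star (coordIV i y) = star (∑ i, y i ^ 2) := by
      rw [star_sum]
      exact Finset.sum_congr rfl fun i _ => by rw [star_pow, sq]; rfl
    have h2 : ∑ i, coordIV i y * coordIV i y = ∑ i, y i ^ 2 :=
      Finset.sum_congr rfl fun i _ => (sq (y i)).symm
    rw [sum_mul_star_eq, h1, h2, Complex.star_def, Complex.mul_conj']
    simp only [betaNorm]
    push_cast
    rw [neg_mul, ← sub_eq_add_neg]
    rfl
  have S1 : SmoothAt (fun y => ∑ i, (⇑(coordIV i) * ⇑(coordIV i)) y) z := ContDiffAt.sum s1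
  have S2 : SmoothAt (fun y => ∑ i, ((fun y => star (coordIV i y))
      * fun y => star (coordIV i y)) y) z := ContDiffAt.sum s2
  have S3 : SmoothAt (fun y => ∑ i, (⇑(coordIV i) * fun y => star (coordIV i y)) y) z :=
    ContDiffAt.sum s3
  have S4 : SmoothAt (fun y => (-2 : ℂ) * ∑ i, (⇑(coordIV i) * fun y => star (coordIV i y)) y) z :=
    contDiffAt_const.mul S3
  have S0 : SmoothAt (fun _ : Fin n → ℂ => (1 : ℂ)) z := contDiffAt_const
  rw [e, jet_add (smoothAt_add S0 (smoothAt_mul S1 S2)) S4, jet_add S0 (smoothAt_mul S1 S2),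
    jet_mul S1 S2, jet_const_mul _ S3,
    jet_sum _ _ s1, jet_sum _ _ s2, jet_sum _ _ s3, jet_const, map_one, map_one, map_sum, map_sum]
  congr 1
  · congr 2
    · exact Finset.sum_congr rfl fun i _ => by rw [jet_mul (hp i) (hp i), jp, map_mul]
    · exact Finset.sum_congr rfl fun i _ => by rw [jet_mul (hq i) (hq i), jq, map_mul]
  · congr 1
    exact Finset.sum_congr rfl fun i _ => by rw [jet_mul (hp i) (hq i), jp, jq]

/-- The lift `(x, α, δ) = g (z, 1, z·z)` of a curve lies on the quadric `x·x = αδ`; these are the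
first two derivatives of that relation. -/
lemma quadric_jet {v u : Fin n → ℂ} {g δ : Jet ℂ} {x : Fin n → Jet ℂ} (hg0 : g.c0 = 1)
    (hx : ∀ i, x i = g * coordJet z v u i)
    (hδ : δ = g * ∑ i, coordJet z v u i * coordJet z v u i) :
    2 * ∑ i, (x i).c1 * z i - g.c1 * ∑ i, z i ^ 2 - δ.c1 = 0 ∧
    2 * ∑ i, (x i).c2 * z i - g.c2 * ∑ i, z i ^ 2 - δ.c2
      = -(2 * (∑ i, (x i).c1 * (x i).c1 - g.c1 * δ.c1)) := by
  obtain ⟨ζ, hζ⟩ : ∃ ζ, ζ = ∑ i, z i ^ 2 := ⟨_, rfl⟩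
  rw [← hζ]
  have hx0 : ∀ i, (x i).c0 = z i := fun i => by rw [hx, Jet.mul_c0, hg0, one_mul]; rfl
  have hδ0 : δ.c0 = ζ := by
    rw [hδ, Jet.mul_c0, hg0, one_mul, Jet.sum_c0, hζ]
    exact Finset.sum_congr rfl fun i _ => (sq (z i)).symm
  have hquad : g * δ = ∑ i, x i * x i := by
    rw [hδ, Finset.mul_sum, Finset.mul_sum]
    exact Finset.sum_congr rfl fun i _ => by rw [hx]; ring
  constructor
  · have := congrArg Jet.c1 hquad
    simp only [Jet.mul_c1, Jet.sum_c1, hg0, hδ0, hx0, one_mul] at this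
    have e : ∑ i, (z i * (x i).c1 + (x i).c1 * z i) = 2 * ∑ i, (x i).c1 * z i := by
      rw [Finset.mul_sum]; exact Finset.sum_congr rfl fun i _ => by ring
    rw [e] at this
    linear_combination -this
  · have := congrArg Jet.c2 hquad
    simp only [Jet.mul_c2, Jet.sum_c2, hg0, hδ0, hx0, one_mul] at this
    have e : ∑ i, (z i * (x i).c2 + 2 * ((x i).c1 * (x i).c1) + (x i).c2 * z i)
        = 2 * ∑ i, (x i).c2 * z i + 2 * ∑ i, (x i).c1 * (x i).c1 := by
      rw [Finset.mul_sum, Finset.mul_sum, ← Finset.sum_add_distrib]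
      exact Finset.sum_congr rfl fun i _ => by ring
    rw [e] at this
    linear_combination -this

/-- Mixed jets of `-log β` along a curve, in terms of the jets of a lift
`(x, α, δ) = g (z, 1, z·z)` to the cone over the quadric, scaled so that its derivatives are
orthogonal to its value. -/
lemma betaNorm_mixed (hz : z ∈ RIV n) {v u : Fin n → ℂ} {a : Jet.Jet2} {g δ : Jet ℂ}
    {x : Fin n → Jet ℂ} (ha : a = jet v u (negLog betaNorm) z) (hg0 : g.c0 = 1)
    (hx : ∀ i, x i = g * coordJet z v u i)
    (hδ : δ = g * ∑ i, coordJet z v u i * coordJet z v u i)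
    (h1 : 2 * ∑ i, (x i).c1 * star (z i) - g.c1 - δ.c1 * star (∑ i, z i ^ 2) = 0)
    (h2 : 2 * ∑ i, (x i).c2 * star (z i) - g.c2 - δ.c2 * star (∑ i, z i ^ 2) = 0) :
    betaNorm z * a.c1.c1
        = 2 * ∑ i, (x i).c1 * star (x i).c1 - g.c1 * star g.c1 - δ.c1 * star δ.c1 ∧
    betaNorm z * a.c1.c2
        = 2 * ∑ i, (x i).c2 * star (x i).c1 - g.c2 * star g.c1 - δ.c2 * star δ.c1 ∧
    betaNorm z * (a.c2.c2 - 2 * a.c1.c1 ^ 2)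
        = 2 * ∑ i, (x i).c2 * star (x i).c2 - g.c2 * star g.c2 - δ.c2 * star δ.c2 := by
  obtain ⟨m, hm⟩ : ∃ m, m = (betaNorm z : ℂ) := ⟨_, rfl⟩
  have hm0 : m ≠ 0 := by rw [hm]; exact_mod_cast hz.1.ne'
  obtain ⟨ζ, hζ⟩ : ∃ ζ, ζ = ∑ i, z i ^ 2 := ⟨_, rfl⟩
  rw [← hζ] at h1 h2
  rw [← hm]
  have hx0 : ∀ i, (x i).c0 = z i := fun i => by rw [hx, Jet.mul_c0, hg0, one_mul]; rfl
  have hδ0 : δ.c0 = ζ := by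
    rw [hδ, Jet.mul_c0, hg0, one_mul, Jet.sum_c0, hζ]
    exact Finset.sum_congr rfl fun i _ => (sq (z i)).symm
  have hjet : Jet.hol g * Jet.ahol g * Jet.exp (-a) = Jet.hol g * Jet.ahol g
      + Jet.hol δ * Jet.ahol δ
      + Jet.const (Jet.const (-2)) * ∑ i, Jet.hol (x i) * Jet.ahol (x i) := by
    rw [ha, ← jet_ofReal_eq_exp contDiffAt_betaNorm hz.1, jet_betaNorm, mul_add, mul_add, mul_one,
      hδ, map_mul, map_mul]
    congr 1
    · ring
    · rw [mul_left_comm, Finset.mul_sum]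
      congr 1
      exact Finset.sum_congr rfl fun i _ => by rw [hx, map_mul, map_mul]; ring
  have hmz : m = 1 + ζ * star ζ - 2 * ∑ i, z i * star (z i) := by
    rw [hm, betaNorm, ← hζ, sum_mul_star_eq, Complex.star_def, Complex.mul_conj']
    push_cast; rfl
  obtain ⟨s11, h11⟩ : ∃ s, s = ∑ i, (x i).c1 * star (x i).c1 := ⟨_, rfl⟩
  obtain ⟨s12, h12⟩ : ∃ s, s = ∑ i, (x i).c1 * star (x i).c2 := ⟨_, rfl⟩
  obtain ⟨s21, h21⟩ : ∃ s, s = ∑ i, (x i).c2 * star (x i).c1 := ⟨_, rfl⟩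
  obtain ⟨s22, h22⟩ : ∃ s, s = ∑ i, (x i).c2 * star (x i).c2 := ⟨_, rfl⟩
  obtain ⟨s00, h00⟩ : ∃ s, s = ∑ i, z i * star (z i) := ⟨_, rfl⟩
  obtain ⟨s10, h10⟩ : ∃ s, s = ∑ i, (x i).c1 * star (z i) := ⟨_, rfl⟩
  obtain ⟨s20, h20⟩ : ∃ s, s = ∑ i, (x i).c2 * star (z i) := ⟨_, rfl⟩
  have hS : ∑ i, Jet.hol (x i) * Jet.ahol (x i) = (⟨⟨s00, s10, s20⟩, ⟨star s10, s11, s21⟩,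
      ⟨star s20, s12, s22⟩⟩ : Jet.Jet2) := by
    ext <;> simp [h11, h12, h21, h22, h00, h10, h20, hx0, mul_comm]
  rw [← h10] at h1
  rw [← h20] at h2
  rw [← h00] at hmz
  rw [← h11, ← h21, ← h22]
  have s1 := congrArg star h1
  have s2 := congrArg star h2
  simp only [star_sub, star_mul', star_star, star_zero, star_ofNat] at s1 s2
  have hy : Jet.hol g * Jet.ahol g * Jet.exp (-a) = Jet.const (Jet.const m) * (1 - (⟨0,
      ⟨0, (2 * s11 - g.c1 * star g.c1 - δ.c1 * star δ.c1) / m,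
        (2 * s21 - g.c2 * star g.c1 - δ.c2 * star δ.c1) / m⟩,
      ⟨0, (2 * s12 - g.c1 * star g.c2 - δ.c1 * star δ.c2) / m,
        (2 * s22 - g.c2 * star g.c2 - δ.c2 * star δ.c2) / m⟩⟩ : Jet.Jet2)) := by
    simp only [Complex.star_def] at h1 h2 s1 s2 hmz
    rw [hjet, hS]
    ext
    · simp [hg0, hδ0]; linear_combination -hmz
    · simp [hg0, hδ0]; linear_combination -h1
    · simp [hg0, hδ0]; linear_combination -h2
    · simp [hg0, hδ0]; linear_combination -s1
    · simp [hg0, hδ0]; field_simp; ring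
    · simp [hg0, hδ0]; field_simp; ring
    · simp [hg0, hδ0]; linear_combination -s2
    · simp [hg0, hδ0]; field_simp; ring
    · simp [hg0, hδ0]; field_simp; ring
  obtain ⟨r1, r2, r3⟩ := Jet.neg_log_mixed hm0 hy rfl rfl rfl
  refine ⟨?_, ?_, ?_⟩
  · rw [r1]; field_simp
  · rw [r2]; field_simp
  · rw [r3, r1]; field_simp; ring

end LieBallJets

section LieBallBounds

set_option linter.unusedSectionVars false

variable {n : ℕ} {z : Fin n → ℂ}

/-- A multiple of the lift `(z, 1, z·z)` of a point of the Lie ball can be added to a vector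
`(P, 0, D)` to make it orthogonal to that lift. -/
lemma exists_orthogonal (hz : z ∈ RIV n) (P : Fin n → ℂ) (D : ℂ) :
    ∃ g : ℂ, 2 * ∑ i, (P i + g * z i) * star (z i) - g
      - (D + g * ∑ i, z i ^ 2) * star (∑ i, z i ^ 2) = 0 := by
  have hm0 : (betaNorm z : ℂ) ≠ 0 := by exact_mod_cast hz.1.ne'
  obtain ⟨ζ, hζ⟩ : ∃ ζ, ζ = ∑ i, z i ^ 2 := ⟨_, rfl⟩
  have hmz : (betaNorm z : ℂ) = 1 + ζ * star ζ - 2 * ∑ i, z i * star (z i) := by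
    rw [betaNorm, ← hζ, sum_mul_star_eq, Complex.star_def, Complex.mul_conj']
    push_cast; rfl
  obtain ⟨g, hg⟩ : ∃ g, g = (2 * ∑ i, P i * star (z i) - D * star ζ) / betaNorm z := ⟨_, rfl⟩
  have hgm : g * betaNorm z = 2 * ∑ i, P i * star (z i) - D * star ζ := by
    rw [hg, div_mul_cancel₀ _ hm0]
  refine ⟨g, ?_⟩
  rw [← hζ]
  simp only [add_mul, Finset.sum_add_distrib, mul_assoc, ← Finset.mul_sum]
  rw [hmz] at hgm
  linear_combination -hgm

lemma sum_coordJet_mul_self_c0 (v u : Fin n → ℂ) :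
    (∑ i, coordJet z v u i * coordJet z v u i).c0 = ∑ i, z i ^ 2 := by
  rw [Jet.sum_c0]
  exact Finset.sum_congr rfl fun i _ => (sq (z i)).symm

/-- Every curve has a lift whose first two derivatives are orthogonal to its value. -/
lemma exists_lift (hz : z ∈ RIV n) (v u : Fin n → ℂ) :
    ∃ (g δ : Jet ℂ) (x : Fin n → Jet ℂ), g.c0 = 1 ∧
      (∀ i, x i = g * coordJet z v u i) ∧
      δ = g * ∑ i, coordJet z v u i * coordJet z v u i ∧
      2 * ∑ i, (x i).c1 * star (z i) - g.c1 - δ.c1 * star (∑ i, z i ^ 2) = 0 ∧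
      2 * ∑ i, (x i).c2 * star (z i) - g.c2 - δ.c2 * star (∑ i, z i ^ 2) = 0 := by
  obtain ⟨Z, hZ⟩ : ∃ Z, Z = ∑ i, coordJet z v u i * coordJet z v u i := ⟨_, rfl⟩
  have hZ0 : Z.c0 = ∑ i, z i ^ 2 := by rw [hZ, sum_coordJet_mul_self_c0]
  obtain ⟨g1, hg1⟩ := exists_orthogonal hz v Z.c1
  obtain ⟨g2, hg2⟩ := exists_orthogonal hz (fun i => 2 * (g1 * v i) + u i) (2 * (g1 * Z.c1) + Z.c2)
  refine ⟨⟨1, g1, g2⟩, ⟨1, g1, g2⟩ * Z, fun i => ⟨1, g1, g2⟩ * coordJet z v u i, rfl,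
    fun _ => rfl, by rw [hZ], ?_, ?_⟩
  · simp only [Jet.mul_c1, hZ0, coordJet, one_mul]
    exact hg1
  · simp only [Jet.mul_c2, hZ0, coordJet, one_mul]
    rw [← hg2]
    congr 3
    · exact Finset.sum_congr rfl fun i _ => by ring
    · ring

/-- For a suitable acceleration of the curve, the second derivative of the lift is a multiple of the
conjugate of its value. -/
lemma exists_lift_conj (hz : z ∈ RIV n) (v : Fin n → ℂ) :
    ∃ (u : Fin n → ℂ) (g δ : Jet ℂ) (x : Fin n → Jet ℂ) (μ : ℂ), g.c0 = 1 ∧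
      (∀ i, x i = g * coordJet z v u i) ∧
      δ = g * ∑ i, coordJet z v u i * coordJet z v u i ∧
      2 * ∑ i, (x i).c1 * star (z i) - g.c1 - δ.c1 * star (∑ i, z i ^ 2) = 0 ∧
      (∀ i, (x i).c2 = μ * star (z i)) ∧ g.c2 = μ * star (∑ i, z i ^ 2) ∧ δ.c2 = μ := by
  have hm0 : (betaNorm z : ℂ) ≠ 0 := by exact_mod_cast hz.1.ne'
  obtain ⟨ζ, hζ⟩ : ∃ ζ, ζ = ∑ i, z i ^ 2 := ⟨_, rfl⟩
  have hmz : (betaNorm z : ℂ) = 1 + ζ * star ζ - 2 * ∑ i, z i * star (z i) := by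
    rw [betaNorm, ← hζ, sum_mul_star_eq, Complex.star_def, Complex.mul_conj']
    push_cast; rfl
  obtain ⟨D, hD⟩ : ∃ D, D = ∑ i, (z i * v i + v i * z i) := ⟨_, rfl⟩
  obtain ⟨g1, hg1⟩ := exists_orthogonal hz v D
  obtain ⟨Q, hQ⟩ : ∃ Q, Q = ∑ i, (v i + g1 * z i) * (v i + g1 * z i) - g1 * (D + g1 * ζ) :=
    ⟨_, rfl⟩
  -- the factor is forced by the second derivative of the quadric relation
  obtain ⟨μ, hμ⟩ : ∃ μ, μ = 2 * Q / betaNorm z := ⟨_, rfl⟩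
  have hμm : μ * betaNorm z = 2 * Q := by rw [hμ, div_mul_cancel₀ _ hm0]
  obtain ⟨u, hu⟩ : ∃ u : Fin n → ℂ, ∀ i,
      u i = μ * star (z i) - μ * star ζ * z i - 2 * (g1 * v i) := ⟨_, fun _ => rfl⟩
  obtain ⟨g, hg⟩ : ∃ g : Jet ℂ, g = ⟨1, g1, μ * star ζ⟩ := ⟨_, rfl⟩
  obtain ⟨x, hx⟩ : ∃ x : Fin n → Jet ℂ, ∀ i, x i = g * coordJet z v u i := ⟨_, fun _ => rfl⟩
  obtain ⟨δ, hδ⟩ : ∃ δ, δ = g * ∑ i, coordJet z v u i * coordJet z v u i := ⟨_, rfl⟩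
  have hx1 : ∀ i, (x i).c1 = v i + g1 * z i := fun i => by
    rw [hx, hg, Jet.mul_c1]; simp only [coordJet, one_mul]
  have hx2 : ∀ i, (x i).c2 = μ * star (z i) := fun i => by
    rw [hx, hg, Jet.mul_c2]; simp only [coordJet, one_mul, hu]; ring
  have hδ1 : δ.c1 = D + g1 * ζ := by
    rw [hδ, hg, Jet.mul_c1, sum_coordJet_mul_self_c0, ← hζ, Jet.sum_c1, hD]
    simp only [Jet.mul_c1, coordJet, one_mul]
  have hg0 : g.c0 = 1 := by rw [hg]
  have hg1' : g.c1 = g1 := by rw [hg]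
  have hg2 : g.c2 = μ * star ζ := by rw [hg]
  refine ⟨u, g, δ, x, μ, hg0, hx, hδ, ?_, hx2, by rw [hg2, hζ], ?_⟩
  · simp only [hx1, hg1', hδ1, hζ]
    exact hg1
  · have h := (quadric_jet hg0 hx hδ).2
    simp only [hx1, hx2, hg1', hg2, hδ1, ← hζ, mul_assoc, ← Finset.mul_sum] at h
    rw [← hQ] at h
    have e : ∑ i, star (z i) * z i = ∑ i, z i * star (z i) :=
      Finset.sum_congr rfl fun i _ => mul_comm _ _
    rw [e, ← hμm] at h
    linear_combination -h + μ * hmz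

/-- The diagonal values of the form `2 x·x̄' - α ᾱ' - δ δ̄'` are real. -/
lemma lieForm_eq_ofReal (x : Fin n → ℂ) (α δ : ℂ) :
    2 * ∑ i, x i * star (x i) - α * star α - δ * star δ
      = ((2 * ∑ i, ‖x i‖ ^ 2 - ‖α‖ ^ 2 - ‖δ‖ ^ 2 : ℝ) : ℂ) := by
  have hnc : ∀ c : ℂ, c * star c = ((‖c‖ ^ 2 : ℝ) : ℂ) := fun c => by
    rw [Complex.star_def, Complex.mul_conj']; push_cast; rfl
  rw [sum_mul_star_eq, hnc, hnc]
  push_cast; rfl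

/-- The pinching of `-log β` on the Lie ball. With `Q` the value of the quadric on the derivative of
the lift, the lower bound comes from `2|Q| ≤ β p`, the upper one from the curve whose lift has
second derivative proportional to the conjugate lift. -/
theorem baseBounds_typeIV (hz : z ∈ RIV n) : BaseBounds betaNorm z 1 2 := by
  have hb := hz.1
  have re_eq : ∀ {c : ℂ} {t : ℝ}, betaNorm z * c = (t : ℂ) → betaNorm z * c.re = t := by
    intro c t h
    have := congrArg Complex.re h
    rwa [Complex.re_ofReal_mul, Complex.ofReal_re] at this
  refine ⟨hb, contDiffAt_betaNorm, fun v hv => ?_, fun v u => ?_, fun v => ?_⟩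
  · obtain ⟨g, δ, x, hg0, hx, hδ, h1, h2⟩ := exists_lift hz v 0
    obtain ⟨r1, -, -⟩ := betaNorm_mixed hz rfl hg0 hx hδ h1 h2
    have q1 := (quadric_jet hg0 hx hδ).1
    rw [lieForm_eq_ofReal] at r1
    obtain ⟨hp, hs⟩ := lieForm_nonneg rfl hz h1 q1
    rw [← re_eq r1] at hp hs
    refine lt_of_le_of_ne (nonneg_of_mul_nonneg_right hp hb) fun h0 => hv ?_
    obtain ⟨hx0, hg1⟩ := hs (by rw [← h0, mul_zero])
    ext i
    have := congrFun hx0 i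
    simpa [hx, coordJet, hg0, hg1] using this
  · obtain ⟨g, δ, x, hg0, hx, hδ, h1, h2⟩ := exists_lift hz v u
    obtain ⟨r1, -, r3⟩ := betaNorm_mixed hz rfl hg0 hx hδ h1 h2
    obtain ⟨q1, q2⟩ := quadric_jet hg0 hx hδ
    rw [lieForm_eq_ofReal] at r1 r3
    -- the second derivative of the lift has product `-2Q` with the conjugate lift
    have hq := two_mul_norm_quadric_le rfl hz h1 q1
    have hl := lieForm_lower rfl hz h2 q2
    obtain ⟨p, hp⟩ : ∃ p, p = (jet v u (negLog betaNorm) z).c1.c1 := ⟨_, rfl⟩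
    obtain ⟨r, hr⟩ : ∃ r, r = (jet v u (negLog betaNorm) z).c2.c2 := ⟨_, rfl⟩
    rw [← hp] at r1 r3
    rw [← hr] at r3
    rw [← hp, ← hr]
    have hpr : p = (p.re : ℂ) := by
      have hm0 : (betaNorm z : ℂ) ≠ 0 := by exact_mod_cast hb.ne'
      refine mul_left_cancel₀ hm0 ?_
      rw [r1, ← re_eq r1]; push_cast; rfl
    have e1 := re_eq r1
    have e3 := re_eq r3
    have e4 : (r - 2 * p ^ 2).re = r.re - 2 * p.re ^ 2 := by
      rw [hpr]; norm_cast
    rw [e4] at e3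
    rw [← e1] at hq
    rw [← e3, norm_neg, norm_mul, Complex.norm_ofNat] at hl
    have h4 : (2 * ‖∑ i, (x i).c1 * (x i).c1 - g.c1 * δ.c1‖) ^ 2 ≤ (betaNorm z * p.re) ^ 2 := by
      gcongr
    have h5 : 0 ≤ betaNorm z ^ 2 * (r.re - p.re ^ 2) := by nlinarith
    have := nonneg_of_mul_nonneg_right h5 (by positivity : 0 < betaNorm z ^ 2)
    linarith
  · obtain ⟨u, g, δ, x, μ, hg0, hx, hδ, h1, hx2, hg2, hδ2⟩ := exists_lift_conj hz v
    have hm0 : (betaNorm z : ℂ) ≠ 0 := by exact_mod_cast hb.ne'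
    have hzz : ∑ i, star (z i) * star (z i) = star (∑ i, z i ^ 2) := by
      rw [star_sum]; exact Finset.sum_congr rfl fun i _ => by rw [star_pow]; ring
    have h2 : 2 * ∑ i, (x i).c2 * star (z i) - g.c2 - δ.c2 * star (∑ i, z i ^ 2) = 0 := by
      simp only [hx2, hg2, hδ2, mul_assoc, ← Finset.mul_sum, hzz]
      ring
    obtain ⟨r1, r2, r3⟩ := betaNorm_mixed hz rfl hg0 hx hδ h1 h2
    have q1 := (quadric_jet hg0 hx hδ).1
    refine ⟨u, ?_, ?_⟩
    · refine (mul_eq_zero.mp (r2.trans ?_)).resolve_left hm0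
      have s := congrArg star q1
      simp only [star_sub, star_mul', star_sum, star_zero, star_ofNat] at s
      have e : ∑ i, star (z i) * star (x i).c1 = ∑ i, star (x i).c1 * star (z i) :=
        Finset.sum_congr rfl fun i _ => mul_comm _ _
      simp only [hx2, hg2, hδ2, mul_assoc, ← Finset.mul_sum, star_sum, e]
      linear_combination μ * s
    · obtain ⟨p, hp⟩ : ∃ p, p = (jet v u (negLog betaNorm) z).c1.c1 := ⟨_, rfl⟩
      obtain ⟨r, hr⟩ : ∃ r, r = (jet v u (negLog betaNorm) z).c2.c2 := ⟨_, rfl⟩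
      rw [← hp] at r1 r3
      rw [← hr] at r3
      rw [← hp, ← hr]
      rw [lieForm_eq_ofReal] at r1 r3
      have hpr : p = (p.re : ℂ) := by
        refine mul_left_cancel₀ hm0 ?_
        rw [r1, ← re_eq r1]; push_cast; rfl
      have e4 : (r - 2 * p ^ 2).re = r.re - 2 * p.re ^ 2 := by
        rw [hpr]; norm_cast
      have e3 := re_eq r3
      rw [e4] at e3
      have e5 : 2 * ∑ i, ‖(x i).c2‖ ^ 2 - ‖g.c2‖ ^ 2 - ‖δ.c2‖ ^ 2 = -(‖μ‖ ^ 2 * betaNorm z) := by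
        simp only [hx2, hg2, hδ2, norm_mul, norm_star, mul_pow, ← Finset.mul_sum, betaNorm]
        ring
      -- the conjugate lift has negative square `-β`
      have h6 : betaNorm z * (r.re - 2 * p.re ^ 2) ≤ 0 := by
        rw [e3, e5]; exact neg_nonpos.mpr (by positivity)
      have := nonpos_of_mul_nonpos_right h6 hb
      linarith

end LieBallBounds

/-! ### The four types -/

/-- Uniform bounds over the base domain give uniform pinching over the Cartan-Hartogs domain. -/
theorem pinched_of_baseBounds {κ : Type} [Fintype κ] [DecidableEq κ] {N : ℕ} {K lam γ κ₀ a₀ : ℝ}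
    {D : Set (κ → ℂ)} {h : (κ → ℂ) → ℝ} (hK : 0 < K) (hlam : 0 < lam) (hc : 0 < γ + N / K)
    (hκ : 0 < κ₀) (ha : 0 ≤ a₀) (hb : ∀ ζ ∈ D, BaseBounds h ζ κ₀ a₀) :
    GeneratesMetricOn (generator N K lam γ h) (hartogs N K D h) ∧
    ∃ a C : ℝ, 0 < a ∧ 0 < C ∧ ∀ z ∈ hartogs N K D h, ∀ v, v ≠ 0 →
      -a ≤ holSecCurvature (metricMatrix (generator N K lam γ h)) z v ∧
      holSecCurvature (metricMatrix (generator N K lam γ h)) z v ≤ -C :=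
  ⟨fun z hz => (hartogs_curvature hK hlam hc hκ ha (hb _ hz.1) hz.2).1, _, _, by positivity,
    lt_min (by positivity) (by positivity),
    fun z hz => (hartogs_curvature hK hlam hc hκ ha (hb _ hz.1) hz.2).2⟩

end CartanHartogs

end

theorem mainTheorem3 (N : ℕ) (hN : 1 ≤ N) (K lam : ℝ) (hK : 0 < K) (hlam : 0 < lam) :
    (∀ m n : ℕ, 1 ≤ m → 1 ≤ n →
      CartanHartogs.GeneratesMetricOn (CartanHartogs.GI m n N K lam)
        (CartanHartogs.YI m n N K) ∧
      ∃ a C : ℝ, 0 < a ∧ 0 < C ∧ ∀ z ∈ CartanHartogs.YI m n N K, ∀ v, v ≠ 0 →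
        -a ≤ CartanHartogs.holSecCurvature
          (CartanHartogs.metricMatrix (CartanHartogs.GI m n N K lam)) z v ∧
        CartanHartogs.holSecCurvature
          (CartanHartogs.metricMatrix (CartanHartogs.GI m n N K lam)) z v ≤ -C) ∧
    (∀ p : ℕ, 1 ≤ p →
      CartanHartogs.GeneratesMetricOn (CartanHartogs.GII p N K lam)
        (CartanHartogs.YII p N K) ∧
      ∃ a C : ℝ, 0 < a ∧ 0 < C ∧ ∀ z ∈ CartanHartogs.YII p N K, ∀ v, v ≠ 0 →
        -a ≤ CartanHartogs.holSecCurvature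
          (CartanHartogs.metricMatrix (CartanHartogs.GII p N K lam)) z v ∧
        CartanHartogs.holSecCurvature
          (CartanHartogs.metricMatrix (CartanHartogs.GII p N K lam)) z v ≤ -C) ∧
    (∀ q : ℕ, 1 ≤ q →
      CartanHartogs.GeneratesMetricOn (CartanHartogs.GIII q N K lam)
        (CartanHartogs.YIII q N K) ∧
      ∃ a C : ℝ, 0 < a ∧ 0 < C ∧ ∀ z ∈ CartanHartogs.YIII q N K, ∀ v, v ≠ 0 →
        -a ≤ CartanHartogs.holSecCurvature
          (CartanHartogs.metricMatrix (CartanHartogs.GIII q N K lam)) z v ∧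
        CartanHartogs.holSecCurvature
          (CartanHartogs.metricMatrix (CartanHartogs.GIII q N K lam)) z v ≤ -C) ∧
    (∀ n : ℕ, 1 ≤ n →
      CartanHartogs.GeneratesMetricOn (CartanHartogs.GIV n N K lam)
        (CartanHartogs.YIV n N K) ∧
      ∃ a C : ℝ, 0 < a ∧ 0 < C ∧ ∀ z ∈ CartanHartogs.YIV n N K, ∀ v, v ≠ 0 →
        -a ≤ CartanHartogs.holSecCurvature
          (CartanHartogs.metricMatrix (CartanHartogs.GIV n N K lam)) z v ∧
        CartanHartogs.holSecCurvature
          (CartanHartogs.metricMatrix (CartanHartogs.GIV n N K lam)) z v ≤ -C) := by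
  have hNK : 0 < (N : ℝ) / K := div_pos (by exact_mod_cast hN) hK
  refine ⟨fun m n hm _ => ?_, fun p hp => ?_, fun q hq => ?_, fun n _ => ?_⟩
  · exact CartanHartogs.pinched_of_baseBounds hK hlam (by positivity)
      (div_pos two_pos (by exact_mod_cast hm)) zero_le_two
      fun _ hζ => CartanHartogs.baseBounds_typeI hm hζ
  · exact CartanHartogs.pinched_of_baseBounds hK hlam (by positivity)
      (div_pos two_pos (by exact_mod_cast hp)) zero_le_two
      fun _ hζ => CartanHartogs.baseBounds_typeII hp hζ
  · have hq1 : (1 : ℝ) ≤ q := by exact_mod_cast hq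
    exact CartanHartogs.pinched_of_baseBounds hK hlam (by linarith)
      (div_pos two_pos (by linarith)) zero_le_two
      fun _ hζ => CartanHartogs.baseBounds_typeIII hq hζ
  · exact CartanHartogs.pinched_of_baseBounds hK hlam (by positivity) one_pos zero_le_two
      fun _ hζ => CartanHartogs.baseBounds_typeIV hζ
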